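/- **Theorem (Friedlander).** Let $\Gamma$ be a connected compact metric graph, that is, finitely many compact intervals (edges) of positive lengths whose endpoints are glued together at vertices (loops and multiple edges allowed), and let $L>0$ be its total length, the sum of its edge lengths. Let $0=\mu_1(\Gamma)<\mu_2(\Gamma)\le\mu_3(\Gamma)\le\dots$ denote the eigenvalues, counted with multiplicity, of the Laplacian on $\Gamma$ with standard (continuity–Kirchhoff) vertex conditions, i.e. of the self-adjoint operator in $L^2(\Gamma)$ associated with the form $a(f,g)=\int_\Gamma f'g'\,dx$ on $H^1(\Gamma)=\{f\in C(\Gamma): f|_e\in H^1(e)\text{ for every edge } e\}$. Then $\mu_1(\Gamma)=0$, and for every $k\ge 2$ $$\mu_k(\Gamma)\;\ge\;\frac{\pi^2k^2}{4L^2},$$ with equality if and only if $\Gamma$ is isometric to the equilateral $k$-star of total length $L$ ($k$ edges of length $L/k$ glued together at one endpoint each). -/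

import Mathlib

open MeasureTheory Set
open scoped ENNReal ContDiff

/-- A metric graph with edge set `E`: every edge `e` is a compact interval `[0, len e]` of positive
length, and `vtx` is the partition of the set of all interval endpoints whose classes are the
vertices. Here `(e, false)` is the endpoint `0` and `(e, true)` is the endpoint `len e` of `e`.
Loops and multiple edges are allowed. The graph is compact when `E` is finite. -/
structure MetricGraph (E : Type*) where
  len : E → ℝ
  len_pos : ∀ e, 0 < len e
  vtx : Setoid (E × Bool)

noncomputable section

namespace MetricGraph

variable {E : Type*} (Γ : MetricGraph E)

/-- The total length, i.e. the sum of all edge lengths. -/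
def totalLength [Fintype E] : ℝ := ∑ e, Γ.len e

/-- The disjoint union of the edge intervals. -/
abbrev Pre : Type _ := Σ e : E, Icc (0 : ℝ) (Γ.len e)

/-- An interval endpoint, as a point of the disjoint union. -/
def endpt (s : E × Bool) : Γ.Pre :=
  ⟨s.1, if s.2 then ⟨Γ.len s.1, (Γ.len_pos s.1).le, le_rfl⟩ else ⟨0, le_rfl, (Γ.len_pos s.1).le⟩⟩

theorem endpt_injective : Function.Injective Γ.endpt := by
  rintro ⟨e, a⟩ ⟨e', b⟩ h
  have he : e = e' := congrArg Sigma.fst h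
  subst he
  have h2 := eq_of_heq (Sigma.mk.inj h).2
  have hpos := Γ.len_pos e
  cases a <;> cases b
  · rfl
  · have h3 : (0 : ℝ) = Γ.len e := by simpa [Subtype.ext_iff] using h2
    linarith
  · have h3 : Γ.len e = (0 : ℝ) := by simpa [Subtype.ext_iff] using h2
    linarith
  · rfl

/-- The gluing relation: two points are identified iff they are equal or they are interval
endpoints belonging to the same vertex. -/
def glue : Setoid Γ.Pre where
  r x y := x = y ∨ ∃ s t : E × Bool, Γ.vtx s t ∧ x = Γ.endpt s ∧ y = Γ.endpt t
  iseqv :=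
    { refl := fun _ => Or.inl rfl
      symm := by
        rintro x y (rfl | ⟨s, t, h, rfl, rfl⟩)
        · exact Or.inl rfl
        · exact Or.inr ⟨t, s, Γ.vtx.symm h, rfl, rfl⟩
      trans := by
        rintro x y z (rfl | ⟨s, t, h, rfl, rfl⟩) hyz
        · exact hyz
        · rcases hyz with rfl | ⟨s', t', h', hy, rfl⟩
          · exact Or.inr ⟨s, t, h, rfl, rfl⟩
          · obtain rfl := Γ.endpt_injective hy
            exact Or.inr ⟨s, t', Γ.vtx.trans h h', rfl, rfl⟩ }

/-- The metric graph as a set of points. -/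
def Point : Type _ := Quotient Γ.glue

/-- The point of the graph with coordinate `x` on the edge `e`. -/
def pt (e : E) (x : Icc (0 : ℝ) (Γ.len e)) : Γ.Point := Quotient.mk Γ.glue ⟨e, x⟩

/-- The quotient topology: a set is open iff its trace on every edge is relatively open. -/
instance : TopologicalSpace Γ.Point := inferInstanceAs (TopologicalSpace (Quotient Γ.glue))

/-- `Γ.Chain x y r`: one can travel from `x` to `y` along finitely many segments, each contained
in a single edge, of total length `r`. -/
inductive Chain : Γ.Point → Γ.Point → ℝ → Prop
  | nil (x : Γ.Point) : Chain x x 0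
  | cons (e : E) (a b : Icc (0 : ℝ) (Γ.len e)) (z : Γ.Point) (r : ℝ) :
      Chain (Γ.pt e b) z r → Chain (Γ.pt e a) z (|(a : ℝ) - b| + r)

/-- The path distance on the graph (infinite when the points cannot be joined). -/
def edist (x y : Γ.Point) : ℝ≥0∞ := ⨅ (r : ℝ) (_ : Γ.Chain x y r), ENNReal.ofReal r

/-- The graph is connected if all distances are finite. -/
def IsConnected : Prop := ∀ x y : Γ.Point, Γ.edist x y < ⊤

/-- Two metric graphs are isometric if there is a distance-preserving bijection between them. -/
def IsIsometric {E' : Type*} (Γ' : MetricGraph E') : Prop :=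
  ∃ Φ : Γ.Point ≃ Γ'.Point, ∀ x y, Γ'.edist (Φ x) (Φ y) = Γ.edist x y

/-- The restriction of a function to the edge `e`, in the coordinate of `e` (extended to all of
`ℝ` by constants; only its values on `[0, len e]` are ever used). -/
def onEdge (f : Γ.Point → ℝ) (e : E) : ℝ → ℝ :=
  fun x => f (Γ.pt e (projIcc 0 (Γ.len e) (Γ.len_pos e).le x))

/-- Lebesgue measure on the interval of the edge `e`. -/
def edgeMeasure (e : E) : Measure ℝ := volume.restrict (Ioo 0 (Γ.len e))

/-- Square-integrable functions on the graph. -/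
def MemL2 (f : Γ.Point → ℝ) : Prop := ∀ e, MemLp (Γ.onEdge f e) 2 (Γ.edgeMeasure e)

/-- `g` is, on every edge, a weak derivative of `f` belonging to `L²`. -/
def HasWeakDeriv (f : Γ.Point → ℝ) (g : E → ℝ → ℝ) : Prop :=
  ∀ e, MemLp (g e) 2 (Γ.edgeMeasure e) ∧
    ∀ φ : ℝ → ℝ, ContDiff ℝ ∞ φ → HasCompactSupport φ → tsupport φ ⊆ Ioo 0 (Γ.len e) →
      ∫ x, Γ.onEdge f e x * deriv φ x ∂(Γ.edgeMeasure e) =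
        -∫ x, g e x * φ x ∂(Γ.edgeMeasure e)

/-- `Γ.MemH1 f g`: the function `f` belongs to `H¹(Γ)`, i.e. it is continuous on the graph and
has a weak derivative in `L²` on every edge, and its weak derivative is `g`. -/
def MemH1 (f : Γ.Point → ℝ) (g : E → ℝ → ℝ) : Prop := Continuous f ∧ Γ.HasWeakDeriv f g

/-- `Γ.IsLaplacian f h`: `f` is in the domain of the standard (continuity-Kirchhoff) Laplacian `A`
and `A f = h`. As usual, `A` is the operator in `L²(Γ)` associated with the form
`a(f, v) = ∫ f' v'` on `H¹(Γ)`. -/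
def IsLaplacian [Fintype E] (f h : Γ.Point → ℝ) : Prop :=
  Γ.MemL2 h ∧ ∃ f' : E → ℝ → ℝ, Γ.MemH1 f f' ∧
    ∀ (v : Γ.Point → ℝ) (v' : E → ℝ → ℝ), Γ.MemH1 v v' →
      ∑ e, ∫ x, f' e x * v' e x ∂(Γ.edgeMeasure e) =
        ∑ e, ∫ x, Γ.onEdge h e x * Γ.onEdge v e x ∂(Γ.edgeMeasure e)

/-- `f` is an eigenfunction of the standard Laplacian for the eigenvalue `s`. -/
def IsEigenfunction [Fintype E] (s : ℝ) (f : Γ.Point → ℝ) : Prop :=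
  f ≠ 0 ∧ Γ.IsLaplacian f (s • f)

/-- The `k`-th eigenvalue (`k ≥ 1`) of the standard Laplacian, eigenvalues being numbered in
increasing order and repeated according to multiplicity: the least `t` such that there are `k`
linearly independent eigenfunctions with eigenvalues at most `t`. -/
def eigenvalue [Fintype E] (k : ℕ) : ℝ :=
  sInf {t : ℝ | ∃ f : Fin k → Γ.Point → ℝ, LinearIndependent ℝ f ∧
    ∀ i, ∃ s ≤ t, Γ.IsEigenfunction s (f i)}

/-- The equilateral `k`-star of total length `L`: `k` edges of length `L / k`, glued together at
their endpoints `0`. -/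
def equilateralStar (k : ℕ) (L : ℝ) (hk : 0 < k) (hL : 0 < L) : MetricGraph (Fin k) where
  len _ := L / k
  len_pos _ := div_pos hL (Nat.cast_pos.mpr hk)
  vtx :=
    { r := fun s t => s = t ∨ (s.2 = false ∧ t.2 = false)
      iseqv :=
        { refl := fun _ => Or.inl rfl
          symm := by
            rintro s t (rfl | ⟨h, h'⟩)
            · exact Or.inl rfl
            · exact Or.inr ⟨h', h⟩
          trans := by
            rintro s t u (rfl | ⟨h, h'⟩) htu
            · exact htu
            · rcases htu with rfl | ⟨_, h2⟩
              · exact Or.inr ⟨h, h'⟩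
              · exact Or.inr ⟨h, h2⟩ } }

end MetricGraph

end

/-!
Write `ℓ = L / k` and `λ = (π / (2 ℓ))² = π² k² / (4 L²)`. The number `λ` is the first Dirichlet
eigenvalue of an interval of length `2 ℓ`.

*The bound.* After separating some edges at vertices, the connected graph becomes a tree of segments
(`STree.exists_spanning`), and the walk around a tree of length `a` is a closed curve of length `2 a`
which traverses every segment twice. If a function vanishes at the root of a tree of length at most
`(m + 1) ℓ` and at the `m` points which cut the walk into equal arcs, then by the Dirichlet inequality
on the arcs the form `∫ (f'² - λ f²)` is nonnegative, and it is definite if the tree is shorter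
(`STree.WF.exists_points`). A tree of length `k ℓ` can be cut at a point `q` into one part of length
`ℓ`, or two shorter parts of total length at least `ℓ`, and a remainder of length at most `(k - 1) ℓ`
(`STree.WF.exists_cut`). So zeros at `q` and at `k - 2` points of the remainder, which are only `k - 1`
linear conditions, make the form nonnegative on the whole graph (`MetricGraph.exists_points`). Since
the span of `k` eigenfunctions contains a nonzero function satisfying these conditions, `μ_k ≥ λ`
(`MetricGraph.le_of_mem_spectralBounds`).

*Equality.* Now let `V` be a `k`-dimensional space of functions on which the form is nonpositive. The
functions in `V` have no common zero, as otherwise the constants could be added to `V`, contradicting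
the bound for `k + 1`. On a tree of length `ℓ`, equality in the Dirichlet inequality says that a function
vanishing at the root is a multiple of a sine along the walk around the tree, which rises and falls
once; hence the tree is a path (`STree.WF.isPath_of_eq_sin`). By the Cauchy-Schwarz inequality for the
nonpositive form, isotropic elements of `V` are orthogonal to all of `V`, in particular to a function
`g` with `g q ≠ 0`, and for a sine on a single path starting at `q` this is impossible
(`STree.WF.vanishOn_of_energy_eq_zero`). Counting dimensions, the functions in `V` vanishing at `q` show
that all branches at `q` are paths of length `ℓ` (`STree.WF.starLike`, `STree.WF.exists_starLike`). Any
two of the legs carry a function in `V` which is a sine on one of them and the opposite sine on the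
other, so that the legs meet only at `q` (`STree.legs_injective`), and the graph is isometric to the
star (`MetricGraph.isIsometric_equilateralStar`).

Conversely, an isometry `Φ` from the graph to the star has speed one where it takes values inside a
leg and therefore preserves integrals over the legs. So combinations of the constants and the sines on
the legs can be pulled back to a `k`-dimensional space on which the form is nonpositive
(`MetricGraph.exists_submodule_of_isIsometric`).

*The spectrum.* The passage between such spaces and eigenvalues is the variational principle
`MetricGraph.exists_eigenfunctions`. It rests on the completeness of `H¹(Γ)` and on the compactness of
its embedding into `L²(Γ)`; the latter follows from `MetricGraph.exists_points`, which says that on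
functions with sufficiently many zeros the `L²` norm is small compared to that of the derivative. The
same bound shows that there are finitely many eigenvalues in every bounded interval, so that the
infimum which defines `μ_k` is attained (`MetricGraph.eigenvalue_mem_spectralBounds`).
-/

/-! ### Sobolev functions on an interval -/

/-- `IsH1On F G a b`: on the interval `[a, b]` the function `F` is the primitive of the
square-integrable function `G`, i.e. `F ∈ H¹(a, b)` with derivative `G`. -/
structure IsH1On (F G : ℝ → ℝ) (a b : ℝ) : Prop where
  memLp : MemLp G 2 (volume.restrict (Ioc a b))
  eq_add : ∀ s ∈ Icc a b, F s = F a + ∫ t in a..s, G t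

namespace IsH1On

variable {F G U V : ℝ → ℝ} {a b c d : ℝ}

theorem intervalIntegrable (h : IsH1On F G a b) (hab : a ≤ b) :
    IntervalIntegrable G volume a b := by
  rw [intervalIntegrable_iff_integrableOn_Ioc_of_le hab]
  exact h.memLp.integrable (by norm_num)

theorem congr (h : IsH1On F G a b) (hF : ∀ s ∈ Icc a b, U s = F s)
    (hG : ∀ s ∈ Ioc a b, V s = G s) : IsH1On U V a b := by
  refine ⟨h.memLp.ae_eq ((ae_restrict_iff' measurableSet_Ioc).2
    (Filter.Eventually.of_forall fun s hs => (hG s hs).symm)), fun s hs => ?_⟩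
  rw [hF s hs, hF a ⟨le_rfl, hs.1.trans hs.2⟩, h.eq_add s hs]
  congr 1
  refine intervalIntegral.integral_congr_ae (Filter.Eventually.of_forall fun t ht => ?_)
  rw [uIoc_of_le hs.1] at ht
  exact (hG t ⟨ht.1, ht.2.trans hs.2⟩).symm

theorem absolutelyContinuous (h : IsH1On F G a b) (hab : a ≤ b) : AbsolutelyContinuousOnInterval F a b := by
  have h1 := (h.intervalIntegrable hab).absolutelyContinuousOnInterval_intervalIntegral
    (c := a) left_mem_uIcc
  have h2 : AbsolutelyContinuousOnInterval (fun _ : ℝ => F a) a b :=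
    ((LipschitzWith.const (F a)).lipschitzOnWith).absolutelyContinuousOnInterval
  have h3 := h2.add h1
  rw [absolutelyContinuousOnInterval_iff] at h3 ⊢
  intro ε hε
  obtain ⟨δ, hδ, H⟩ := h3 ε hε
  refine ⟨δ, hδ, fun E hE hlt => ?_⟩
  have := H E hE hlt
  convert this using 2 with i hi
  have hE' := hE.1 i hi
  rw [uIcc_of_le hab] at hE'
  simp only [Pi.add_apply]
  rw [h.eq_add _ hE'.1, h.eq_add _ hE'.2]

theorem continuousOn (h : IsH1On F G a b) (hab : a ≤ b) : ContinuousOn F (Icc a b) := by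
  simpa [uIcc_of_le hab] using (h.absolutelyContinuous hab).continuousOn

theorem ae_hasDerivAt (h : IsH1On F G a b) (hab : a ≤ b) :
    ∀ᵐ x, x ∈ Ioo a b → HasDerivAt F (G x) x := by
  filter_upwards [(h.intervalIntegrable hab).ae_hasDerivAt_integral] with x hx hxab
  have h1 := hx (by rw [uIcc_of_le hab]; exact Ioo_subset_Icc_self hxab) a left_mem_uIcc
  refine (h1.const_add (F a)).congr_of_eventuallyEq ?_
  filter_upwards [Ioo_mem_nhds hxab.1 hxab.2] with y hy
  exact h.eq_add y (Ioo_subset_Icc_self hy)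

theorem memLp_mul_continuous {μ : Measure ℝ} (hG : MemLp G 2 (μ.restrict (Ioc a b)))
    (hU : ContinuousOn U (Icc a b)) : MemLp (fun x => G x * U x) 2 (μ.restrict (Ioc a b)) := by
  obtain ⟨C, hC⟩ := isCompact_Icc.exists_bound_of_continuousOn hU
  have hUm : AEStronglyMeasurable U (μ.restrict (Ioc a b)) :=
    (hU.mono Ioc_subset_Icc_self).aestronglyMeasurable measurableSet_Ioc
  refine MemLp.of_le_mul (c := C) hG (hG.1.mul hUm) ?_
  filter_upwards [ae_restrict_mem measurableSet_Ioc] with x hx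
  rw [norm_mul, mul_comm]
  exact mul_le_mul_of_nonneg_right (hC x (Ioc_subset_Icc_self hx)) (norm_nonneg _)

theorem of_continuousOn (hF : ∀ x ∈ Icc a b, HasDerivAt F (G x) x)
    (hG : ContinuousOn G (Icc a b)) : IsH1On F G a b := by
  refine ⟨?_, fun s hs => ?_⟩
  · have h1 : MemLp (fun _ : ℝ => (1 : ℝ)) 2 (volume.restrict (Ioc a b)) := memLp_const 1
    simpa using memLp_mul_continuous h1 hG
  · rw [intervalIntegral.integral_eq_sub_of_hasDerivAt (f := F)]
    · ring
    · intro x hx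
      rw [uIcc_of_le hs.1] at hx
      exact hF x ⟨hx.1, hx.2.trans hs.2⟩
    · refine ContinuousOn.intervalIntegrable ?_
      rw [uIcc_of_le hs.1]
      exact hG.mono (Icc_subset_Icc_right hs.2)

theorem mono (h : IsH1On F G a b) (hac : a ≤ c) (hcd : c ≤ d) (hdb : d ≤ b) :
    IsH1On F G c d := by
  have hab := (hac.trans hcd).trans hdb
  refine ⟨h.memLp.mono_measure (Measure.restrict_mono (Ioc_subset_Ioc hac hdb) le_rfl),
    fun s hs => ?_⟩
  have hI := h.intervalIntegrable hab
  have hac' : IntervalIntegrable G volume a c := hI.mono_set (by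
    rw [uIcc_of_le hac, uIcc_of_le hab]; exact Icc_subset_Icc_right (hcd.trans hdb))
  have hcs' : IntervalIntegrable G volume c s := hI.mono_set (by
    rw [uIcc_of_le hs.1, uIcc_of_le hab]; exact Icc_subset_Icc hac (hs.2.trans hdb))
  rw [h.eq_add s ⟨hac.trans hs.1, hs.2.trans hdb⟩, h.eq_add c ⟨hac, hcd.trans hdb⟩,
    ← intervalIntegral.integral_add_adjacent_intervals hac' hcs', add_assoc]

theorem linear (h : IsH1On F G a b) (h' : IsH1On U V a b) (α β : ℝ) :
    IsH1On (fun x => α * F x + β * U x) (fun x => α * G x + β * V x) a b := by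
  refine ⟨(h.memLp.const_mul α).add (h'.memLp.const_mul β), fun s hs => ?_⟩
  have hab := hs.1.trans hs.2
  have e1 := (h.mono le_rfl hs.1 hs.2).intervalIntegrable hs.1
  have e2 := (h'.mono le_rfl hs.1 hs.2).intervalIntegrable hs.1
  rw [intervalIntegral.integral_add (e1.const_mul α) (e2.const_mul β),
    intervalIntegral.integral_const_mul, intervalIntegral.integral_const_mul,
    h.eq_add s hs, h'.eq_add s hs]
  ring

theorem mul (h : IsH1On F G a b) (h' : IsH1On U V a b) (hab : a ≤ b) :
    IsH1On (fun x => F x * U x) (fun x => G x * U x + F x * V x) a b := by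
  refine ⟨?_, fun s hs => ?_⟩
  · refine (memLp_mul_continuous h.memLp (h'.continuousOn hab)).add ?_
    simpa only [mul_comm] using memLp_mul_continuous h'.memLp (h.continuousOn hab)
  · have h1 := h.mono le_rfl hs.1 hs.2
    have h2 := h'.mono le_rfl hs.1 hs.2
    have h3 := (h1.absolutelyContinuous hs.1).integral_deriv_mul_eq_sub (h2.absolutelyContinuous hs.1)
    have h4 : ∫ x in a..s, deriv F x * U x + F x * deriv U x =
        ∫ x in a..s, G x * U x + F x * V x := by
      refine intervalIntegral.integral_congr_ae ?_
      have hne : ∀ᵐ x : ℝ, x ≠ s := by simp [ae_iff, measure_singleton]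
      filter_upwards [h1.ae_hasDerivAt hs.1, h2.ae_hasDerivAt hs.1, hne] with x hx hx' hxs hxm
      rw [uIoc_of_le hs.1] at hxm
      have hxm' : x ∈ Ioo a s := ⟨hxm.1, lt_of_le_of_ne hxm.2 hxs⟩
      rw [(hx hxm').deriv, (hx' hxm').deriv]
    rw [← h4, h3]
    ring

theorem integrable_mul (h : MemLp G 2 (volume.restrict (Ioc a b)))
    (h' : MemLp V 2 (volume.restrict (Ioc a b))) (hab : a ≤ b) :
    IntervalIntegrable (fun x => G x * V x) volume a b := by
  rw [intervalIntegrable_iff_integrableOn_Ioc_of_le hab]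
  exact h.integrable_mul h'

theorem memLp_self (h : IsH1On F G a b) (hab : a ≤ b) :
    MemLp F 2 (volume.restrict (Ioc a b)) := by
  have h1 : MemLp (fun _ : ℝ => (1 : ℝ)) 2 (volume.restrict (Ioc a b)) := memLp_const 1
  simpa using memLp_mul_continuous h1 (h.continuousOn hab)

theorem ae_eq_zero_of_integral_sq_nonpos (hab : a ≤ b)
    (hG : MemLp G 2 (volume.restrict (Ioc a b))) (h0 : ∫ x in a..b, G x ^ 2 ≤ 0) :
    G =ᵐ[volume.restrict (Ioc a b)] 0 := by
  rw [intervalIntegral.integral_of_le hab] at h0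
  have h1 : ∫ x in Ioc a b, G x ^ 2 = 0 := le_antisymm h0 (integral_nonneg fun x => sq_nonneg _)
  rw [integral_eq_zero_iff_of_nonneg (fun x => sq_nonneg _) hG.integrable_sq] at h1
  filter_upwards [h1] with x hx
  simpa using hx

theorem eq_left_of_deriv_ae_zero (h : IsH1On F G a b)
    (h0 : G =ᵐ[volume.restrict (Ioc a b)] 0) : ∀ s ∈ Icc a b, F s = F a := by
  intro s hs
  rw [h.eq_add s hs, intervalIntegral.integral_of_le hs.1]
  have : ∫ t in Ioc a s, G t = ∫ t in Ioc a s, (0 : ℝ) :=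
    integral_congr_ae (ae_restrict_of_ae_restrict_of_subset (Ioc_subset_Ioc_right hs.2) h0)
  rw [this]; simp

theorem intervalIntegrable_sq_sub (h : IsH1On F G a b) (hab : a ≤ b) (lam : ℝ) :
    IntervalIntegrable (fun x => G x ^ 2 - lam * F x ^ 2) volume a b := by
  have hF := h.memLp_self hab
  simpa only [pow_two] using (integrable_mul h.memLp h.memLp hab).sub
    ((integrable_mul hF hF hab).const_mul lam)

theorem integral_sq_sub (h : IsH1On F G a b) (hab : a ≤ b) (lam : ℝ) :
    ∫ x in a..b, (G x ^ 2 - lam * F x ^ 2) =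
      (∫ x in a..b, G x ^ 2) - lam * ∫ x in a..b, F x ^ 2 := by
  have hF := h.memLp_self hab
  have e1 := integrable_mul h.memLp h.memLp hab
  have e2 := integrable_mul hF hF hab
  simp only [pow_two]
  rw [intervalIntegral.integral_sub e1 (e2.const_mul lam), intervalIntegral.integral_const_mul]

/-! ### The first Dirichlet eigenvalue of an interval -/

/-- Jacobi's completion of the square: `w` solves the Riccati equation `w' = -ω² - w²`, so that
`(G - w F)²` and `G² - ω² F²` differ by the derivative of `w F²`. -/
theorem integral_eq_integral_sq_of_dirichlet (h : IsH1On F G a b) (hab : a ≤ b) {w : ℝ → ℝ}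
    {om : ℝ} (hw : ∀ x ∈ Icc a b, HasDerivAt w (-om ^ 2 - w x ^ 2) x) (ha : F a = 0)
    (hb : F b = 0) :
    ∫ x in a..b, (G x ^ 2 - om ^ 2 * F x ^ 2) = ∫ x in a..b, (G x - w x * F x) ^ 2 := by
  have hwc : ContinuousOn w (Icc a b) := fun x hx => (hw x hx).continuousAt.continuousWithinAt
  have hwH : IsH1On w (fun x => -om ^ 2 - w x ^ 2) a b :=
    of_continuousOn hw (continuousOn_const.sub (hwc.pow 2))
  have hP := (h.mul h hab).mul hwH hab
  have hz := hP.eq_add b ⟨hab, le_rfl⟩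
  rw [ha, hb] at hz
  have hF := h.memLp_self hab
  have hFw : MemLp (fun x => F x * w x) 2 (volume.restrict (Ioc a b)) :=
    memLp_mul_continuous hF hwc
  have hd := h.memLp.sub hFw
  have e1 := integrable_mul h.memLp h.memLp hab
  have e2 := integrable_mul hF hF hab
  have e3 := integrable_mul hd hd hab
  have e4 := hP.intervalIntegrable hab
  have e5 : (fun x => G x ^ 2 - om ^ 2 * F x ^ 2) = fun x => (G x - w x * F x) ^ 2 +
      ((G x * F x + F x * G x) * w x + F x * F x * (-om ^ 2 - w x ^ 2)) := by
    funext x; ring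
  rw [e5, intervalIntegral.integral_add _ e4]
  · linarith
  · refine e3.congr (fun x _ => ?_)
    simp only [Pi.sub_apply]; ring

/-- On an interval shorter than `π / ω` the equation `u'' = -ω² u` has a positive solution; its
derivative is called `v`. It is a sine, shifted so that the interval lies between two zeros. -/
theorem exists_pos_solution {om : ℝ} (hom : 0 < om) (hab : om * (b - a) < Real.pi) :
    ∃ u : ℝ → ℝ, ∃ v : ℝ → ℝ, (∀ x ∈ Icc a b, 0 < u x) ∧ (∀ x, HasDerivAt u (v x) x) ∧
      ∀ x, HasDerivAt v (-om ^ 2 * u x) x := by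
  set d := (Real.pi - om * (b - a)) / 2 with hd
  refine ⟨fun x => Real.sin (om * (x - a) + d), fun x => Real.cos (om * (x - a) + d) * om,
    fun x hx => ?_, fun x => ?_, fun x => ?_⟩
  · have h1 : 0 ≤ om * (x - a) := mul_nonneg hom.le (by linarith [hx.1])
    have h2 : om * (x - a) ≤ om * (b - a) := mul_le_mul_of_nonneg_left (by linarith [hx.2]) hom.le
    exact Real.sin_pos_of_pos_of_lt_pi (by linarith) (by linarith)
  · have h1 : HasDerivAt (fun x => om * (x - a) + d) om x := by
      simpa using (((hasDerivAt_id x).sub_const a).const_mul om).add_const d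
    exact h1.sin
  · have h1 : HasDerivAt (fun x => om * (x - a) + d) om x := by
      simpa using (((hasDerivAt_id x).sub_const a).const_mul om).add_const d
    exact (h1.cos.mul_const om).congr_deriv (by ring)

/-- Below the first Dirichlet eigenvalue the energy form is positive definite on `H¹₀(a, b)`. The
Riccati equation is solved by `w = u' / u`, and if `F' = w F` then `F / u` is constant. -/
theorem dirichlet_strict (h : IsH1On F G a b) (hab : a ≤ b) {om : ℝ} (hom : 0 < om)
    (hlt : om * (b - a) < Real.pi) (ha : F a = 0) (hb : F b = 0) :
    0 ≤ ∫ x in a..b, (G x ^ 2 - om ^ 2 * F x ^ 2) ∧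
      (∫ x in a..b, (G x ^ 2 - om ^ 2 * F x ^ 2) ≤ 0 → ∀ x ∈ Icc a b, F x = 0) := by
  obtain ⟨u, v, hu, hu', hv'⟩ := exists_pos_solution hom hlt
  have hw : ∀ x ∈ Icc a b, HasDerivAt (fun x => v x / u x) (-om ^ 2 - (v x / u x) ^ 2) x := by
    intro x hx
    have hne := (hu x hx).ne'
    exact ((hv' x).div (hu' x) hne).congr_deriv (by field_simp)
  rw [h.integral_eq_integral_sq_of_dirichlet hab hw ha hb]
  refine ⟨intervalIntegral.integral_nonneg hab fun x _ => sq_nonneg _, fun h0 => ?_⟩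
  have hwc : ContinuousOn (fun x => v x / u x) (Icc a b) :=
    fun x hx => (hw x hx).continuousAt.continuousWithinAt
  have hFw : MemLp (fun x => v x / u x * F x) 2 (volume.restrict (Ioc a b)) := by
    simpa only [mul_comm] using memLp_mul_continuous (h.memLp_self hab) hwc
  have hae := ae_eq_zero_of_integral_sq_nonpos hab (h.memLp.sub hFw) h0
  -- `F / u` has vanishing derivative
  have hi : ∀ x ∈ Icc a b, HasDerivAt (fun x => (u x)⁻¹) (-v x / u x ^ 2) x :=
    fun x hx => (hu' x).inv (hu x hx).ne'
  have huc : ContinuousOn u (Icc a b) := fun x _ => (hu' x).continuousAt.continuousWithinAt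
  have hvc : ContinuousOn v (Icc a b) := fun x _ => (hv' x).continuousAt.continuousWithinAt
  have hiH : IsH1On (fun x => (u x)⁻¹) (fun x => -v x / u x ^ 2) a b :=
    of_continuousOn hi (hvc.neg.div (huc.pow 2) fun x hx => (pow_pos (hu x hx) 2).ne')
  have hP := h.mul hiH hab
  have hz := hP.eq_left_of_deriv_ae_zero (by
    filter_upwards [hae, ae_restrict_mem measurableSet_Ioc] with x hx hxm
    have hne := (hu x (Ioc_subset_Icc_self hxm)).ne'
    simp only [Pi.sub_apply, Pi.zero_apply] at hx
    have : G x = v x / u x * F x := by linarith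
    rw [this]
    simp only [Pi.zero_apply]
    field_simp
    ring)
  intro x hx
  have := hz x hx
  rw [ha, zero_mul] at this
  rcases mul_eq_zero.1 this with h1 | h1
  · exact h1
  · exact absurd h1 (inv_pos.2 (hu x hx)).ne'

/-- The case of the first Dirichlet eigenvalue itself: the energy form is nonnegative, by
continuity in `ω`. -/
theorem dirichlet_nonneg (h : IsH1On F G a b) (hab : a ≤ b) {om : ℝ} (hom : 0 < om)
    (hle : om * (b - a) ≤ Real.pi) (ha : F a = 0) (hb : F b = 0) :
    0 ≤ ∫ x in a..b, (G x ^ 2 - om ^ 2 * F x ^ 2) := by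
  have key : ∀ r ∈ Ioo (0 : ℝ) 1, 0 ≤ (∫ x in a..b, G x ^ 2) - (r * om) ^ 2 *
      ∫ x in a..b, F x ^ 2 := by
    intro r hr
    have h1 : r * om * (b - a) < Real.pi := by
      rcases (mul_nonneg hom.le (sub_nonneg.2 hab)).eq_or_lt with h0 | h0
      · rw [mul_assoc, ← h0, mul_zero]; exact Real.pi_pos
      · rw [mul_assoc]; nlinarith [hr.2]
    rw [← h.integral_sq_sub hab]
    exact (h.dirichlet_strict hab (mul_pos hr.1 hom) h1 ha hb).1
  rw [h.integral_sq_sub hab]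
  have hcont : Filter.Tendsto (fun r : ℝ => (∫ x in a..b, G x ^ 2) - (r * om) ^ 2 *
      ∫ x in a..b, F x ^ 2) (nhdsWithin 1 (Iio 1))
      (nhds ((∫ x in a..b, G x ^ 2) - (1 * om) ^ 2 * ∫ x in a..b, F x ^ 2)) := by
    have : Continuous fun r : ℝ => (∫ x in a..b, G x ^ 2) - (r * om) ^ 2 *
      ∫ x in a..b, F x ^ 2 := by fun_prop
    exact this.continuousWithinAt
  rw [one_mul] at hcont
  refine ge_of_tendsto hcont ?_
  filter_upwards [Ioo_mem_nhdsLT (show (0 : ℝ) < 1 by norm_num)] with r hr using key r hr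

/-- Pairing with a multiple of `sin (ω (x - a))` gives only boundary terms. -/
theorem integral_mul_sin (h : IsH1On F G a b) (hab : a ≤ b) (om : ℝ) :
    ∫ x in a..b, ((om * Real.cos (om * (x - a))) * G x -
      om ^ 2 * (Real.sin (om * (x - a)) * F x)) =
      om * Real.cos (om * (b - a)) * F b - om * F a := by
  have hc : ∀ x, HasDerivAt (fun x => om * Real.cos (om * (x - a)))
      (-om ^ 2 * Real.sin (om * (x - a))) x := by
    intro x
    have h1 : HasDerivAt (fun x => om * (x - a)) om x := by
      simpa using ((hasDerivAt_id x).sub_const a).const_mul om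
    exact (h1.cos.const_mul om).congr_deriv (by ring)
  have hcH : IsH1On (fun x => om * Real.cos (om * (x - a)))
      (fun x => -om ^ 2 * Real.sin (om * (x - a))) a b :=
    of_continuousOn (fun x _ => hc x) (by fun_prop)
  have hz := (h.mul hcH hab).eq_add b ⟨hab, le_rfl⟩
  simp only [sub_self, mul_zero, Real.cos_zero, mul_one] at hz
  have e : (fun x => G x * (om * Real.cos (om * (x - a))) +
      F x * (-om ^ 2 * Real.sin (om * (x - a)))) = fun x =>
      ((om * Real.cos (om * (x - a))) * G x - om ^ 2 * (Real.sin (om * (x - a)) * F x)) := by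
    funext x; ring
  rw [e] at hz
  linarith

theorem isH1On_sin (c om a b : ℝ) : IsH1On (fun x => c * Real.sin (om * (x - a)))
    (fun x => c * (om * Real.cos (om * (x - a)))) a b := by
  refine of_continuousOn (fun x _ => ?_) (by fun_prop)
  have h1 : HasDerivAt (fun x => om * (x - a)) om x := by
    simpa using ((hasDerivAt_id x).sub_const a).const_mul om
  exact (h1.sin.const_mul c).congr_deriv (by ring)

/-- The extremal functions for the first Dirichlet eigenvalue are the multiples of the sine: after
subtracting the sine with the same value at the midpoint, the strict inequality applies to both
halves of the interval. -/
theorem eq_sin_of_dirichlet (h : IsH1On F G a b) (hab : a ≤ b) {om : ℝ} (hom : 0 < om)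
    (heq : om * (b - a) = Real.pi) (ha : F a = 0) (hb : F b = 0)
    (hQ : ∫ x in a..b, (G x ^ 2 - om ^ 2 * F x ^ 2) ≤ 0) :
    ∃ c, ∀ x ∈ Icc a b, F x = c * Real.sin (om * (x - a)) := by
  set m := (a + b) / 2 with hm
  have hma : om * (m - a) = Real.pi / 2 := by rw [hm]; linarith
  have hmb : om * (b - m) = Real.pi / 2 := by rw [hm]; linarith
  have ham : a ≤ m := by rw [hm]; linarith
  have hmb' : m ≤ b := by rw [hm]; linarith
  set c := F m with hc
  refine ⟨c, ?_⟩
  set S := fun x => c * Real.sin (om * (x - a)) with hS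
  set S' := fun x => c * (om * Real.cos (om * (x - a))) with hS'
  have hSH : IsH1On S S' a b := isH1On_sin c om a b
  have hD := h.linear hSH 1 (-1)
  have hSa : S a = 0 := by simp [hS]
  have hSb : S b = 0 := by simp [hS, heq]
  have hSm : S m = F m := by simp [hS, hma, hc]
  have hFlp := h.memLp_self hab
  have hSlp := hSH.memLp_self hab
  have hDlp := hD.memLp_self hab
  have I1 := h.integral_mul_sin hab om
  have I2 := hSH.integral_mul_sin hab om
  rw [ha, hb, mul_zero, mul_zero, sub_zero] at I1
  rw [hSa, hSb, mul_zero, mul_zero, sub_zero] at I2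
  have hQD : ∫ x in a..b, ((1 * G x + -1 * S' x) ^ 2 - om ^ 2 * (1 * F x + -1 * S x) ^ 2) =
      ∫ x in a..b, (G x ^ 2 - om ^ 2 * F x ^ 2) := by
    have e : (fun x => (1 * G x + -1 * S' x) ^ 2 - om ^ 2 * (1 * F x + -1 * S x) ^ 2) =
      fun x => (G x ^ 2 - om ^ 2 * F x ^ 2) - (2 * c) * ((om * Real.cos (om * (x - a))) * G x -
      om ^ 2 * (Real.sin (om * (x - a)) * F x)) + c * ((om * Real.cos (om * (x - a))) * S' x -
      om ^ 2 * (Real.sin (om * (x - a)) * S x)) := by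
      funext x; simp only [hS, hS']; ring
    have hcosc : ContinuousOn (fun x => om * Real.cos (om * (x - a))) (Icc a b) := by fun_prop
    have hsinc : ContinuousOn (fun x => Real.sin (om * (x - a))) (Icc a b) := by fun_prop
    have one : MemLp (fun _ : ℝ => (1 : ℝ)) 2 (volume.restrict (Ioc a b)) := memLp_const 1
    have hcl := memLp_mul_continuous one hcosc
    have hsl := memLp_mul_continuous one hsinc
    simp only [one_mul] at hcl hsl
    have i1 := h.intervalIntegrable_sq_sub hab (om ^ 2)
    have i2 := (integrable_mul hcl h.memLp hab).sub ((integrable_mul hsl hFlp hab).const_mul (om ^ 2))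
    have i3 := (integrable_mul hcl hSH.memLp hab).sub
      ((integrable_mul hsl hSlp hab).const_mul (om ^ 2))
    rw [e, intervalIntegral.integral_add (i1.sub (i2.const_mul _)) (i3.const_mul _),
      intervalIntegral.integral_sub i1 (i2.const_mul _), intervalIntegral.integral_const_mul,
      intervalIntegral.integral_const_mul, I1, I2]
    ring
  -- `F - S` vanishes at the endpoints and at the midpoint, and its energy is that of `F`
  have hD1 := hD.mono le_rfl ham hmb'
  have hD2 := hD.mono ham hmb' le_rfl
  have hpi := Real.pi_pos
  have q1 := hD1.dirichlet_strict ham hom (by linarith) (by simp [ha, hSa]) (by simp [hSm])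
  have q2 := hD2.dirichlet_strict hmb' hom (by linarith) (by simp [hSm]) (by simp [hb, hSb])
  have hadd := intervalIntegral.integral_add_adjacent_intervals
    (hD1.intervalIntegrable_sq_sub ham (om ^ 2)) (hD2.intervalIntegrable_sq_sub hmb' (om ^ 2))
  rw [hQD] at hadd
  have z1 := q1.2 (by linarith [q2.1])
  have z2 := q2.2 (by linarith [q1.1])
  intro x hx
  rcases le_total x m with hxm | hxm
  · have := z1 x ⟨hx.1, hxm⟩
    simp only [hS] at this; linarith
  · have := z2 x ⟨hxm, hx.2⟩
    simp only [hS] at this; linarith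

end IsH1On

/-! ### Weak derivatives -/

section Weak

variable {a b : ℝ} {w : ℝ → ℝ}

/-- The lemma of du Bois-Reymond: a continuous function with vanishing weak derivative is
constant. -/
theorem eq_of_integral_mul_deriv_eq_zero (hab : a < b) (hw : ContinuousOn w (Icc a b))
    (h : ∀ φ : ℝ → ℝ, ContDiff ℝ ∞ φ → HasCompactSupport φ → tsupport φ ⊆ Ioo a b →
      ∫ x in Ioo a b, w x * deriv φ x = 0) : ∀ x ∈ Icc a b, w x = w a := by
  have hm : (a + b) / 2 ∈ Ioo a b := ⟨by linarith, by linarith⟩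
  let B : ContDiffBump ((a + b) / 2) :=
    ⟨(b - a) / 8, (b - a) / 4, by linarith, by linarith⟩
  set η : ℝ → ℝ := B.normed volume with hη
  have hηs : ContDiff ℝ ∞ η := B.contDiff_normed
  have hηc : HasCompactSupport η := B.hasCompactSupport_normed
  have hηi : ∫ x, η x = 1 := B.integral_normed
  have hηt : tsupport η ⊆ Ioo a b := by
    rw [hη, B.tsupport_normed_eq, Real.closedBall_eq_Icc]
    intro x hx
    have h4 : B.rOut = (b - a) / 4 := rfl
    rw [h4] at hx
    exact ⟨by linarith [hx.1], by linarith [hx.2]⟩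
  have hwL : LocallyIntegrableOn w (Ioo a b) :=
    (hw.mono Ioo_subset_Icc_self).locallyIntegrableOn measurableSet_Ioo
  have hwI : ∀ ψ : ℝ → ℝ, Continuous ψ → IntegrableOn (fun x => w x * ψ x) (Ioo a b) := by
    intro ψ hψ
    exact ((hw.mul hψ.continuousOn).integrableOn_Icc).mono_set Ioo_subset_Icc_self
  set C := ∫ x in Ioo a b, w x * η x with hC
  -- a test function minus its mean times `η` is the derivative of a test function
  have key : ∀ ψ : ℝ → ℝ, ContDiff ℝ ∞ ψ → HasCompactSupport ψ → tsupport ψ ⊆ Ioo a b →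
      ∫ x in Ioo a b, w x * ψ x = C * ∫ x, ψ x := by
    intro ψ hψ hψc hψt
    set m := ∫ x, ψ x with hmdef
    set ρ : ℝ → ℝ := fun x => ψ x - m * η x with hρ
    have hρs : ContDiff ℝ ∞ ρ := hψ.sub (contDiff_const.mul hηs)
    have hρc : HasCompactSupport ρ := hψc.sub hηc.mul_left
    have hρt : tsupport ρ ⊆ Ioo a b := by
      refine (closure_minimal ?_ ((isClosed_tsupport ψ).union (isClosed_tsupport η))).trans
        (union_subset hψt hηt)
      intro x hx
      by_contra hcon
      simp only [mem_union, not_or] at hcon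
      apply hx
      simp [hρ, image_eq_zero_of_notMem_tsupport hcon.1, image_eq_zero_of_notMem_tsupport hcon.2]
    have hρi : ∫ x, ρ x = 0 := by
      rw [hρ, integral_sub (hψ.continuous.integrable_of_hasCompactSupport hψc)
        ((hηs.continuous.integrable_of_hasCompactSupport hηc).const_mul m),
        integral_const_mul, hηi]
      simp [hmdef]
    have hρint : Integrable ρ := hρs.continuous.integrable_of_hasCompactSupport hρc
    obtain ⟨c, d, hac, hcd, hdb, hsub⟩ : ∃ c d, a < c ∧ c ≤ d ∧ d < b ∧ tsupport ρ ⊆ Icc c d := by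
      rcases (tsupport ρ).eq_empty_or_nonempty with he | hne
      · exact ⟨(a + b) / 2, (a + b) / 2, hm.1, le_rfl, hm.2, by simp [he]⟩
      · have hcomp : IsCompact (tsupport ρ) := hρc
        have h1 := hcomp.sInf_mem hne
        have h2 := hcomp.sSup_mem hne
        exact ⟨sInf (tsupport ρ), sSup (tsupport ρ), (hρt h1).1, csInf_le_csSup hne
          hcomp.bddBelow hcomp.bddAbove, (hρt h2).2,
          fun x hx => ⟨csInf_le hcomp.bddBelow hx, le_csSup hcomp.bddAbove hx⟩⟩
    have hρ0 : ∀ x, x ∉ Icc c d → ρ x = 0 := fun x hx =>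
      image_eq_zero_of_notMem_tsupport fun h' => hx (hsub h')
    set φ : ℝ → ℝ := fun x => ∫ t in a..x, ρ t with hφ
    have hφd : ∀ x, HasDerivAt φ (ρ x) x := fun x =>
      hρs.continuous.integral_hasStrictDerivAt a x |>.hasDerivAt
    have hφ' : deriv φ = ρ := funext fun x => (hφd x).deriv
    have hφs : ContDiff ℝ ∞ φ := by
      rw [contDiff_infty_iff_deriv, hφ']
      exact ⟨fun x => (hφd x).differentiableAt, hρs⟩
    have hφl : ∀ x, x < c → φ x = 0 := by
      intro x hx
      rw [hφ]
      refine (intervalIntegral.integral_congr fun t ht => ?_).trans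
        (intervalIntegral.integral_zero)
      refine hρ0 t fun ht' => ?_
      rw [mem_uIcc] at ht
      rcases ht with ht | ht <;> linarith [ht'.1, ht.1, ht.2]
    have hφr : ∀ x, d < x → φ x = 0 := by
      intro x hx
      have e1 : ∫ t in a..x, ρ t = ∫ t, ρ t := by
        rw [intervalIntegral.integral_of_le (by linarith)]
        refine setIntegral_eq_integral_of_forall_compl_eq_zero fun t ht => hρ0 t fun ht' => ht ?_
        exact ⟨by linarith [ht'.1], by linarith [ht'.2]⟩
      rw [hφ]; simp only; rw [e1, hρi]
    have hφsub : tsupport φ ⊆ Icc c d := by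
      refine closure_minimal (fun x hx => ?_) isClosed_Icc
      by_contra hcon
      rw [mem_Icc, not_and_or, not_le, not_le] at hcon
      exact hx (hcon.elim (hφl x) (hφr x))
    have hz := h φ hφs (HasCompactSupport.of_support_subset_isCompact isCompact_Icc
      ((subset_tsupport φ).trans hφsub))
      (hφsub.trans fun x hx => ⟨by linarith [hx.1], by linarith [hx.2]⟩)
    rw [hφ'] at hz
    have e2 : (fun x => w x * ρ x) = fun x => w x * ψ x - m * (w x * η x) := by
      funext x; simp only [hρ]; ring
    rw [e2, integral_sub (hwI ψ hψ.continuous) ((hwI η hηs.continuous).const_mul m),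
      integral_const_mul] at hz
    rw [← hC] at hz
    linarith
  have hae : ∀ᵐ x, x ∈ Ioo a b → w x - C = 0 := by
    refine isOpen_Ioo.ae_eq_zero_of_integral_contDiff_smul_eq_zero
      (f := fun x => w x - C) ?_ fun ψ hψ hψc hψt => ?_
    · exact ((hw.sub continuousOn_const).mono Ioo_subset_Icc_self).locallyIntegrableOn
        measurableSet_Ioo
    · have e1 : ∫ x, ψ x • (w x - C) = ∫ x in Ioo a b, ψ x • (w x - C) := by
        refine (setIntegral_eq_integral_of_forall_compl_eq_zero fun x hx => ?_).symm
        rw [image_eq_zero_of_notMem_tsupport fun h' => hx (hψt h'), zero_smul]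
      have e2 : ∫ x, ψ x = ∫ x in Ioo a b, ψ x := by
        refine (setIntegral_eq_integral_of_forall_compl_eq_zero fun x hx => ?_).symm
        rw [image_eq_zero_of_notMem_tsupport fun h' => hx (hψt h')]
      have e3 : (fun x => ψ x • (w x - C)) = fun x => w x * ψ x - C * ψ x := by
        funext x; simp only [smul_eq_mul]; ring
      have hψI : IntegrableOn ψ (Ioo a b) :=
        (hψ.continuous.integrable_of_hasCompactSupport hψc).integrableOn
      rw [e1, e3, integral_sub (hwI ψ hψ.continuous) (hψI.const_mul C), key ψ hψ hψc hψt,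
        integral_const_mul, ← e2, sub_self]
  have hae' : ∀ᵐ x ∂(volume.restrict (Icc a b)), w x = C := by
    rw [ae_restrict_iff' measurableSet_Icc]
    have n1 : ∀ᵐ x : ℝ, x ≠ a := by simp [ae_iff, measure_singleton]
    have n2 : ∀ᵐ x : ℝ, x ≠ b := by simp [ae_iff, measure_singleton]
    filter_upwards [hae, n1, n2] with x hx ha hb hxm
    exact sub_eq_zero.1 (hx ⟨lt_of_le_of_ne hxm.1 ha.symm, lt_of_le_of_ne hxm.2 hb⟩)
  have heq : EqOn w (fun _ => C) (Icc a b) :=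
    Measure.eqOn_Icc_of_ae_eq volume hab.ne hae' hw continuousOn_const
  intro x hx
  rw [heq hx, heq (left_mem_Icc.2 hab.le)]

end Weak

namespace MetricGraph

variable {E : Type*} (Γ : MetricGraph E)

theorem memLp_edgeMeasure_iff {g : ℝ → ℝ} {e : E} :
    MemLp g 2 (Γ.edgeMeasure e) ↔ MemLp g 2 (volume.restrict (Ioc 0 (Γ.len e))) := by
  rw [edgeMeasure, Measure.restrict_congr_set Ioo_ae_eq_Ioc]

theorem integral_edgeMeasure (g : ℝ → ℝ) (e : E) :
    ∫ x, g x ∂(Γ.edgeMeasure e) = ∫ x in (0 : ℝ)..(Γ.len e), g x := by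
  rw [edgeMeasure, Measure.restrict_congr_set Ioo_ae_eq_Ioc,
    intervalIntegral.integral_of_le (Γ.len_pos e).le]

theorem continuous_onEdge {f : Γ.Point → ℝ} (hf : Continuous f) (e : E) :
    Continuous (Γ.onEdge f e) := by
  have h1 : Continuous (Γ.pt e) := continuous_quotient_mk'.comp continuous_sigmaMk
  exact hf.comp (h1.comp continuous_projIcc)

/-- A function on the graph is continuous as soon as it is so on every edge. -/
theorem continuous_of_onEdge {f : Γ.Point → ℝ}
    (h : ∀ e, ContinuousOn (Γ.onEdge f e) (Icc 0 (Γ.len e))) : Continuous f := by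
  have h1 : Continuous fun x : Γ.Pre => f (Γ.pt x.1 x.2) :=
    continuous_sigma fun e => (h e).domRestrict.congr fun x => by simp [onEdge]
  exact (isQuotientMap_quotient_mk' (s := Γ.glue)).continuous_iff.2 h1

/-- A continuous function has the weak derivative `g` in `L²` on an edge if and only if it is there a
primitive of `g`. -/
theorem memH1_iff {f : Γ.Point → ℝ} {g : E → ℝ → ℝ} :
    Γ.MemH1 f g ↔ Continuous f ∧ ∀ e, IsH1On (Γ.onEdge f e) (g e) 0 (Γ.len e) := by
  refine and_congr_right fun hf => forall_congr' fun e => ?_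
  have hl := Γ.len_pos e
  have hc := (Γ.continuous_onEdge hf e).continuousOn (s := Icc 0 (Γ.len e))
  constructor
  · rintro ⟨hg, hφ⟩
    rw [memLp_edgeMeasure_iff] at hg
    set P : ℝ → ℝ := fun x => ∫ t in (0 : ℝ)..x, g e t with hP
    have hPH : IsH1On P (g e) 0 (Γ.len e) := ⟨hg, fun s _ => by simp [hP]⟩
    have hz := eq_of_integral_mul_deriv_eq_zero (w := fun x => Γ.onEdge f e x - P x) hl
      (hc.sub (hPH.continuousOn hl.le)) (by
        intro φ hs hcs ht
        have h1 := hφ φ hs hcs ht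
        have hφH : IsH1On φ (deriv φ) 0 (Γ.len e) := IsH1On.of_continuousOn
          (fun x _ => (hs.differentiable (by norm_num) x).hasDerivAt)
          (hs.continuous_deriv (by norm_num)).continuousOn
        have h2 := (hPH.mul hφH hl.le).eq_add _ (right_mem_Icc.2 hl.le)
        have z1 : φ 0 = 0 := image_eq_zero_of_notMem_tsupport fun h' => lt_irrefl _ (ht h').1
        have z2 : φ (Γ.len e) = 0 :=
          image_eq_zero_of_notMem_tsupport fun h' => lt_irrefl _ (ht h').2
        have hφL := hφH.memLp_self hl.le
        have hPL := hPH.memLp_self hl.le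
        have hfL : MemLp (Γ.onEdge f e) 2 (volume.restrict (Ioc 0 (Γ.len e))) := by
          have one : MemLp (fun _ : ℝ => (1 : ℝ)) 2 (volume.restrict (Ioc 0 (Γ.len e))) :=
            memLp_const 1
          simpa using IsH1On.memLp_mul_continuous one hc
        have i1 := IsH1On.integrable_mul hPH.memLp hφL hl.le
        have i2 := IsH1On.integrable_mul hPL hφH.memLp hl.le
        have i3 := IsH1On.integrable_mul hfL hφH.memLp hl.le
        rw [z1, z2, mul_zero, mul_zero, zero_add, intervalIntegral.integral_add i1 i2] at h2
        rw [Γ.integral_edgeMeasure, Γ.integral_edgeMeasure] at h1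
        rw [← integral_Ioc_eq_integral_Ioo, ← intervalIntegral.integral_of_le hl.le]
        have e1 : (fun x => (Γ.onEdge f e x - P x) * deriv φ x) =
            fun x => Γ.onEdge f e x * deriv φ x - P x * deriv φ x := by funext x; ring
        rw [e1, intervalIntegral.integral_sub i3 i2]
        linarith)
    refine ⟨hg, fun s hs => ?_⟩
    have := hz s hs
    simp only [hP, intervalIntegral.integral_same, sub_zero] at this
    linarith
  · intro h
    refine ⟨Γ.memLp_edgeMeasure_iff.2 h.memLp, fun φ hs _ ht => ?_⟩
    have hφH : IsH1On φ (deriv φ) 0 (Γ.len e) := IsH1On.of_continuousOn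
      (fun x _ => (hs.differentiable (by norm_num) x).hasDerivAt)
      (hs.continuous_deriv (by norm_num)).continuousOn
    have h2 := (h.mul hφH hl.le).eq_add _ (right_mem_Icc.2 hl.le)
    have z1 : φ 0 = 0 := image_eq_zero_of_notMem_tsupport fun h' => lt_irrefl _ (ht h').1
    have z2 : φ (Γ.len e) = 0 := image_eq_zero_of_notMem_tsupport fun h' => lt_irrefl _ (ht h').2
    have i1 := IsH1On.integrable_mul h.memLp (hφH.memLp_self hl.le) hl.le
    have i2 := IsH1On.integrable_mul (h.memLp_self hl.le) hφH.memLp hl.le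
    rw [z1, z2, mul_zero, mul_zero, zero_add, intervalIntegral.integral_add i1 i2] at h2
    rw [Γ.integral_edgeMeasure, Γ.integral_edgeMeasure]
    linarith

end MetricGraph

namespace MetricGraph

variable {E : Type*} (Γ : MetricGraph E)

/-! ### The path distance -/

variable {Γ} in
theorem Chain.nonneg {x y : Γ.Point} {r : ℝ} (h : Γ.Chain x y r) : 0 ≤ r := by
  induction h with
  | nil => exact le_rfl
  | cons e a b z r _ ih => positivity

variable {Γ} in
theorem Chain.trans {x y z : Γ.Point} {r s : ℝ} (h : Γ.Chain x y r) (h' : Γ.Chain y z s) :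
    Γ.Chain x z (r + s) := by
  induction h with
  | nil => simpa using h'
  | cons e a b _ r _ ih => rw [add_assoc]; exact .cons e a b _ _ (ih h')

variable {Γ} in
theorem Chain.symm {x y : Γ.Point} {r : ℝ} (h : Γ.Chain x y r) : Γ.Chain y x r := by
  induction h with
  | nil x => exact .nil x
  | cons e a b z r _ ih =>
    have h1 := ih.trans (.cons e b a _ _ (.nil _))
    rwa [add_zero, abs_sub_comm, add_comm] at h1

theorem edist_symm (x y : Γ.Point) : Γ.edist x y = Γ.edist y x :=
  le_antisymm (le_iInf₂ fun r h => iInf₂_le r h.symm) (le_iInf₂ fun r h => iInf₂_le r h.symm)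

theorem edist_triangle (x y z : Γ.Point) : Γ.edist x z ≤ Γ.edist x y + Γ.edist y z := by
  simp only [edist, ENNReal.iInf_add, ENNReal.add_iInf]
  refine le_iInf₂ fun r h => le_iInf₂ fun s h' => ?_
  rw [← ENNReal.ofReal_add h'.nonneg h.nonneg]
  exact iInf₂_le _ (h'.trans h)

theorem edist_self (x : Γ.Point) : Γ.edist x x = 0 :=
  le_antisymm ((iInf₂_le 0 (.nil x)).trans (by simp)) bot_le

theorem edist_pt_le (e : E) (a b : Icc (0 : ℝ) (Γ.len e)) :
    Γ.edist (Γ.pt e a) (Γ.pt e b) ≤ ENNReal.ofReal |(a : ℝ) - b| :=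
  (iInf₂_le _ (.cons e a b _ 0 (.nil _))).trans (by rw [add_zero])

/-- A function into an extended pseudometric structure that is `1`-Lipschitz on every edge is
`1`-Lipschitz for the path distance. -/
theorem le_edist_of_edge {d : Γ.Point → Γ.Point → ℝ≥0∞} (h0 : ∀ x, d x x = 0)
    (htri : ∀ x y z, d x z ≤ d x y + d y z)
    (h : ∀ e (a b : Icc (0 : ℝ) (Γ.len e)), d (Γ.pt e a) (Γ.pt e b) ≤ ENNReal.ofReal |(a : ℝ) - b|)
    (x y : Γ.Point) : d x y ≤ Γ.edist x y := by
  refine le_iInf₂ fun r hr => ?_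
  induction hr with
  | nil x => simp [h0]
  | cons e a b z r hr ih =>
    rw [ENNReal.ofReal_add (abs_nonneg _) hr.nonneg]
    exact (htri _ (Γ.pt e b) _).trans (add_le_add (h e a b) ih)

/-- The point with coordinate `x` on the edge `e`; coordinates outside the interval of the edge are
moved to its nearest endpoint. -/
noncomputable def ptR (e : E) (x : ℝ) : Γ.Point := Γ.pt e (projIcc 0 (Γ.len e) (Γ.len_pos e).le x)

theorem edist_ptR_le (e : E) {x y : ℝ} (hx : x ∈ Icc 0 (Γ.len e)) (hy : y ∈ Icc 0 (Γ.len e)) :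
    Γ.edist (Γ.ptR e x) (Γ.ptR e y) ≤ ENNReal.ofReal |x - y| := by
  have := Γ.edist_pt_le e ⟨x, hx⟩ ⟨y, hy⟩
  rwa [ptR, ptR, projIcc_of_mem _ hx, projIcc_of_mem _ hy]

theorem ptR_coe (e : E) (x : Icc (0 : ℝ) (Γ.len e)) : Γ.ptR e x = Γ.pt e x := by
  rw [ptR, projIcc_val]

theorem exists_eq_ptR (q : Γ.Point) : ∃ e, ∃ x ∈ Icc 0 (Γ.len e), q = Γ.ptR e x := by
  induction q using Quotient.inductionOn with
  | h q => exact ⟨q.1, q.2, q.2.2, (Γ.ptR_coe q.1 q.2).symm⟩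

/-! ### Functions in `H¹` together with their derivatives -/

/-- The space of pairs of a function in `H¹(Γ)` and a representative of its derivative. -/
def H1 : Submodule ℝ ((Γ.Point → ℝ) × (E → ℝ → ℝ)) where
  carrier := {w | Γ.MemH1 w.1 w.2}
  zero_mem' := by
    refine Γ.memH1_iff.2 ⟨continuous_const, fun e => ⟨MemLp.zero, fun s _ => ?_⟩⟩
    simp [onEdge]
  add_mem' := by
    intro v w hv hw
    have hv' := Γ.memH1_iff.1 hv
    have hw' := Γ.memH1_iff.1 hw
    refine Γ.memH1_iff.2 ⟨hv'.1.add hw'.1, fun e => ?_⟩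
    refine ((hv'.2 e).linear (hw'.2 e) 1 1).congr (fun s _ => ?_) (fun s _ => ?_)
    · simp [onEdge]
    · simp
  smul_mem' := by
    intro c w hw
    have hw' := Γ.memH1_iff.1 hw
    refine Γ.memH1_iff.2 ⟨hw'.1.const_smul c, fun e => ?_⟩
    refine ((hw'.2 e).linear (hw'.2 e) c 0).congr (fun s _ => ?_) (fun s _ => ?_)
    · simp [onEdge]
    · simp

variable {Γ}

theorem isH1On_onEdge {w : (Γ.Point → ℝ) × (E → ℝ → ℝ)} (hw : w ∈ Γ.H1) (e : E) :
    IsH1On (fun x => w.1 (Γ.ptR e x)) (w.2 e) 0 (Γ.len e) := (Γ.memH1_iff.1 hw).2 e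

/-- The density `v' w' - λ v w` on the edges. -/
noncomputable def density (lam : ℝ) (v w : (Γ.Point → ℝ) × (E → ℝ → ℝ)) (e : E) (x : ℝ) : ℝ :=
  v.2 e x * w.2 e x - lam * (v.1 (Γ.ptR e x) * w.1 (Γ.ptR e x))

theorem intervalIntegrable_density (lam : ℝ) {v w : (Γ.Point → ℝ) × (E → ℝ → ℝ)} (hv : v ∈ Γ.H1)
    (hw : w ∈ Γ.H1) (e : E) : IntervalIntegrable (density lam v w e) volume 0 (Γ.len e) := by
  have hl := (Γ.len_pos e).le
  have hv' := isH1On_onEdge hv e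
  have hw' := isH1On_onEdge hw e
  exact (IsH1On.integrable_mul hv'.memLp hw'.memLp hl).sub
    ((IsH1On.integrable_mul (hv'.memLp_self hl) (hw'.memLp_self hl) hl).const_mul lam)

variable (Γ)

/-! ### Curves -/

/-- A curve in the graph, parametrised by `[0, τ]`, together with the operation which pulls back
derivatives of functions on the graph to derivatives along the curve. -/
structure Curve where
  τ : ℝ
  pos : ℝ → Γ.Point
  der : (E → ℝ → ℝ) → ℝ → ℝ

variable {Γ}

namespace Curve

/-- `c` is a curve of speed at most `1` from `p` to `q`, along which functions in `H¹(Γ)` restrict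
to functions in `H¹`. -/
structure IsCurve (c : Γ.Curve) (p q : Γ.Point) : Prop where
  nonneg : 0 ≤ c.τ
  left : c.pos 0 = p
  right : c.pos c.τ = q
  isH1On : ∀ w ∈ Γ.H1, IsH1On (fun s => w.1 (c.pos s)) (c.der w.2) 0 c.τ
  edist_le : ∀ s ∈ Icc 0 c.τ, ∀ t ∈ Icc 0 c.τ, s ≤ t →
    Γ.edist (c.pos s) (c.pos t) ≤ ENNReal.ofReal (t - s)

/-- The form `∫ (v' w' - λ v w)` along a curve. -/
noncomputable def form (c : Γ.Curve) (lam : ℝ) (v w : (Γ.Point → ℝ) × (E → ℝ → ℝ)) : ℝ :=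
  ∫ s in (0 : ℝ)..c.τ, (c.der v.2 s * c.der w.2 s - lam * (v.1 (c.pos s) * w.1 (c.pos s)))

/-- Concatenation of curves. -/
noncomputable def append (c d : Γ.Curve) : Γ.Curve where
  τ := c.τ + d.τ
  pos s := if s ≤ c.τ then c.pos s else d.pos (s - c.τ)
  der g s := if s ≤ c.τ then c.der g s else d.der g (s - c.τ)

/-- The segment from `x` to `y` on the edge `e`. -/
noncomputable def seg (e : E) (x y : ℝ) : Γ.Curve where
  τ := |y - x|
  pos s := Γ.ptR e (if x ≤ y then x + s else x - s)
  der g s := if x ≤ y then g e (x + s) else -g e (x - s)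

/-- The constant curve. -/
def const (p : Γ.Point) : Γ.Curve := ⟨0, fun _ => p, fun _ _ => 0⟩

theorem isCurve_const (p : Γ.Point) : (const p).IsCurve p p where
  nonneg := le_rfl
  left := rfl
  right := rfl
  isH1On w _ := ⟨MemLp.zero, fun s _ => by simp [const]⟩
  edist_le s _ t _ _ := by simp [const, edist_self]

end Curve

end MetricGraph

namespace IsH1On

variable {F G U V : ℝ → ℝ} {a b : ℝ}

theorem comp_add_left {x t : ℝ} (h : IsH1On F G x (x + t)) :
    IsH1On (fun s => F (x + s)) (fun s => G (x + s)) 0 t := by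
  refine ⟨?_, fun s hs => ?_⟩
  · have h1 := (measurePreserving_add_left volume x).restrict_preimage
      (s := Ioc x (x + t)) measurableSet_Ioc
    have h2 := h.memLp.comp_measurePreserving h1
    simpa [Function.comp_def] using h2
  · rw [h.eq_add (x + s) ⟨by linarith [hs.1], by linarith [hs.2]⟩,
      intervalIntegral.integral_comp_add_left]
    simp

theorem comp_sub_left {x t : ℝ} (h : IsH1On F G (x - t) x) :
    IsH1On (fun s => F (x - s)) (fun s => -G (x - s)) 0 t := by
  refine ⟨MemLp.neg ?_, fun s hs => ?_⟩
  · have h1 := (Measure.measurePreserving_sub_left volume x).restrict_preimage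
      (s := Ioc (x - t) x) measurableSet_Ioc
    have h2 := h.memLp.comp_measurePreserving h1
    have h3 : (fun s => x - s) ⁻¹' Ioc (x - t) x = Ico 0 t := by
      ext s; simp only [mem_preimage, mem_Ioc, mem_Ico]; constructor <;> intro h <;> constructor <;>
        linarith [h.1, h.2]
    rw [h3, Measure.restrict_congr_set Ico_ae_eq_Ioc] at h2
    exact h2
  · have h1 := (h.mono le_rfl (show x - t ≤ x - s by linarith [hs.2]) (by linarith [hs.1]))
    have h2 := h.mono (show x - t ≤ x - s by linarith [hs.2]) (by linarith [hs.1]) le_rfl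
    have h3 := h2.eq_add x ⟨by linarith [hs.1], le_rfl⟩
    rw [intervalIntegral.integral_neg, intervalIntegral.integral_comp_sub_left, sub_zero, h3]
    ring

end IsH1On

section Append

variable {A B : ℝ → ℝ} {a b : ℝ}

theorem intervalIntegrable_append (ha : 0 ≤ a) (hb : 0 ≤ b) (hA : IntervalIntegrable A volume 0 a)
    (hB : IntervalIntegrable B volume 0 b) :
    IntervalIntegrable (fun s => if s ≤ a then A s else B (s - a)) volume 0 a ∧
    IntervalIntegrable (fun s => if s ≤ a then A s else B (s - a)) volume a (a + b) := by
  constructor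
  · refine hA.congr fun s hs => ?_
    rw [uIoc_of_le ha] at hs
    exact (if_pos hs.2).symm
  · have h1 := hB.comp_sub_right a
    rw [zero_add, add_comm b a] at h1
    refine h1.congr fun s hs => ?_
    rw [uIoc_of_le (by linarith)] at hs
    exact (if_neg (not_le.2 hs.1)).symm

theorem integral_append_right {s : ℝ} (hs : a ≤ s) :
    ∫ t in a..s, (if t ≤ a then A t else B (t - a)) = ∫ t in (0 : ℝ)..(s - a), B t := by
  have h1 : ∫ t in a..s, (if t ≤ a then A t else B (t - a)) = ∫ t in a..s, B (t - a) := by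
    refine intervalIntegral.integral_congr_ae (Filter.Eventually.of_forall fun t ht => ?_)
    rw [uIoc_of_le hs] at ht
    exact if_neg (not_le.2 ht.1)
  rw [h1, intervalIntegral.integral_comp_sub_right, sub_self]

theorem integral_append_left {s : ℝ} (hs : 0 ≤ s) (hsa : s ≤ a) :
    ∫ t in (0 : ℝ)..s, (if t ≤ a then A t else B (t - a)) = ∫ t in (0 : ℝ)..s, A t := by
  refine intervalIntegral.integral_congr_ae (Filter.Eventually.of_forall fun t ht => ?_)
  rw [uIoc_of_le hs] at ht
  exact if_pos (ht.2.trans hsa)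

theorem integral_append (ha : 0 ≤ a) (hb : 0 ≤ b) (hA : IntervalIntegrable A volume 0 a)
    (hB : IntervalIntegrable B volume 0 b) :
    ∫ s in (0 : ℝ)..(a + b), (if s ≤ a then A s else B (s - a)) =
      (∫ s in (0 : ℝ)..a, A s) + ∫ s in (0 : ℝ)..b, B s := by
  obtain ⟨h1, h2⟩ := intervalIntegrable_append ha hb hA hB
  rw [← intervalIntegral.integral_add_adjacent_intervals h1 h2, integral_append_left ha le_rfl,
    integral_append_right (by linarith)]
  simp

theorem IsH1On.append {F G U V : ℝ → ℝ} (ha : 0 ≤ a) (hb : 0 ≤ b) (h : IsH1On F G 0 a)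
    (h' : IsH1On U V 0 b) (hFU : F a = U 0) :
    IsH1On (fun s => if s ≤ a then F s else U (s - a)) (fun s => if s ≤ a then G s else V (s - a))
      0 (a + b) := by
  obtain ⟨i1, i2⟩ := intervalIntegrable_append ha hb (h.intervalIntegrable ha)
    (h'.intervalIntegrable hb)
  obtain ⟨j1, j2⟩ := intervalIntegrable_append ha hb (IsH1On.integrable_mul h.memLp h.memLp ha)
    (IsH1On.integrable_mul h'.memLp h'.memLp hb)
  have hab : 0 ≤ a + b := add_nonneg ha hb
  refine ⟨?_, fun s hs => ?_⟩
  · have i3 := i1.trans i2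
    have j3 := j1.trans j2
    rw [intervalIntegrable_iff_integrableOn_Ioc_of_le hab] at i3 j3
    rw [memLp_two_iff_integrable_sq i3.1]
    refine j3.congr (Filter.Eventually.of_forall fun s => ?_)
    simp only
    split_ifs <;> ring
  · simp only [if_pos ha]
    rcases le_total s a with hsa | hsa
    · rw [if_pos hsa, integral_append_left hs.1 hsa, h.eq_add s ⟨hs.1, hsa⟩]
    · have e1 : (if s ≤ a then F s else U (s - a)) = U (s - a) := by
        split_ifs with h1
        · have : s = a := le_antisymm h1 hsa
          rw [this, hFU, sub_self]
        · rfl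
      have i4 : IntervalIntegrable (fun s => if s ≤ a then G s else V (s - a)) volume a s :=
        i2.mono_set (by
          rw [uIcc_of_le hsa, uIcc_of_le (by linarith)]; exact Icc_subset_Icc_right hs.2)
      rw [e1, ← intervalIntegral.integral_add_adjacent_intervals i1 i4,
        integral_append_left ha le_rfl, integral_append_right hsa,
        h'.eq_add (s - a) ⟨by linarith, by linarith [hs.2]⟩, ← hFU, h.eq_add a ⟨ha, le_rfl⟩]
      ring

end Append

namespace MetricGraph.Curve

variable {E : Type*} {Γ : MetricGraph E}

theorem IsCurve.append {c d : Γ.Curve} {p q r : Γ.Point} (hc : c.IsCurve p q)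
    (hd : d.IsCurve q r) : (c.append d).IsCurve p r where
  nonneg := add_nonneg hc.nonneg hd.nonneg
  left := by simp [Curve.append, hc.nonneg, hc.left]
  right := by
    simp only [Curve.append]
    split_ifs with h
    · have h0 : d.τ = 0 := le_antisymm (by linarith) hd.nonneg
      rw [h0, add_zero, hc.right, ← hd.left, ← hd.right, h0]
    · rw [add_sub_cancel_left, hd.right]
  isH1On w hw := by
    have := (hc.isH1On w hw).append hc.nonneg hd.nonneg (hd.isH1On w hw)
      (by simp only [hc.right, hd.left])
    refine this.congr (fun s _ => ?_) (fun s _ => ?_)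
    · simp only [Curve.append]; split_ifs <;> rfl
    · rfl
  edist_le s hs t ht hst := by
    simp only [Curve.append] at hs ht ⊢
    split_ifs with h1 h2 h2
    · exact hc.edist_le s ⟨hs.1, h1⟩ t ⟨ht.1, h2⟩ hst
    · have e1 := hc.edist_le s ⟨hs.1, h1⟩ c.τ ⟨hc.nonneg, le_rfl⟩ h1
      have e2 := hd.edist_le 0 ⟨le_rfl, hd.nonneg⟩ (t - c.τ) ⟨by linarith, by linarith [ht.2]⟩
        (by linarith)
      rw [hc.right] at e1
      rw [hd.left] at e2
      refine (Γ.edist_triangle _ q _).trans ((add_le_add e1 e2).trans ?_)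
      rw [← ENNReal.ofReal_add (by linarith) (by linarith)]
      exact ENNReal.ofReal_le_ofReal (by linarith)
    · exact absurd (hst.trans h2) h1
    · have e2 := hd.edist_le (s - c.τ) ⟨by linarith, by linarith [hs.2]⟩ (t - c.τ)
        ⟨by linarith, by linarith [ht.2]⟩ (by linarith)
      refine e2.trans (ENNReal.ofReal_le_ofReal (by linarith))

theorem IsCurve.intervalIntegrable_form {c : Γ.Curve} {p q : Γ.Point} (hc : c.IsCurve p q)
    (lam : ℝ) {v w : (Γ.Point → ℝ) × (E → ℝ → ℝ)} (hv : v ∈ Γ.H1) (hw : w ∈ Γ.H1) :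
    IntervalIntegrable (fun s => c.der v.2 s * c.der w.2 s -
      lam * (v.1 (c.pos s) * w.1 (c.pos s))) volume 0 c.τ :=
  (IsH1On.integrable_mul (hc.isH1On v hv).memLp (hc.isH1On w hw).memLp hc.nonneg).sub
    ((IsH1On.integrable_mul ((hc.isH1On v hv).memLp_self hc.nonneg)
      ((hc.isH1On w hw).memLp_self hc.nonneg) hc.nonneg).const_mul lam)

theorem IsCurve.form_append {c d : Γ.Curve} {p q r : Γ.Point} (hc : c.IsCurve p q)
    (hd : d.IsCurve q r) (lam : ℝ) {v w : (Γ.Point → ℝ) × (E → ℝ → ℝ)} (hv : v ∈ Γ.H1)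
    (hw : w ∈ Γ.H1) : (c.append d).form lam v w = c.form lam v w + d.form lam v w := by
  rw [form, form, form, ← integral_append hc.nonneg hd.nonneg
    (hc.intervalIntegrable_form lam hv hw) (hd.intervalIntegrable_form lam hv hw)]
  refine intervalIntegral.integral_congr fun s _ => ?_
  simp only [Curve.append]
  split_ifs <;> rfl

theorem isCurve_seg (e : E) {x y : ℝ} (hx : x ∈ Icc 0 (Γ.len e)) (hy : y ∈ Icc 0 (Γ.len e)) :
    (seg e x y : Γ.Curve).IsCurve (Γ.ptR e x) (Γ.ptR e y) where
  nonneg := abs_nonneg _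
  left := by simp [seg]
  right := by
    simp only [seg]
    split_ifs with h
    · rw [abs_of_nonneg (by linarith)]; congr 1; ring
    · rw [abs_of_nonpos (by linarith)]; congr 1; ring
  isH1On w hw := by
    have h0 := isH1On_onEdge hw e
    simp only [seg]
    split_ifs with h
    · have h1 := h0.mono hx.1 h hy.2
      rw [abs_of_nonneg (by linarith)]
      exact IsH1On.comp_add_left (F := fun x => w.1 (Γ.ptR e x)) (by simpa using h1)
    · push Not at h
      have h1 := h0.mono hy.1 h.le hx.2
      rw [abs_of_nonpos (by linarith)]
      exact IsH1On.comp_sub_left (F := fun x => w.1 (Γ.ptR e x)) (by simpa using h1)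
  edist_le s hs t ht hst := by
    simp only [seg] at hs ht ⊢
    split_ifs with h
    · rw [abs_of_nonneg (by linarith)] at hs ht
      refine (Γ.edist_ptR_le e ⟨by linarith [hs.1, hx.1], by linarith [hs.2, hy.2]⟩
        ⟨by linarith [ht.1, hx.1], by linarith [ht.2, hy.2]⟩).trans
        (ENNReal.ofReal_le_ofReal ?_)
      rw [abs_le]; constructor <;> linarith
    · rw [abs_of_nonpos (by linarith)] at hs ht
      refine (Γ.edist_ptR_le e ⟨by linarith [hs.2, hy.1], by linarith [hs.1, hx.2]⟩
        ⟨by linarith [ht.2, hy.1], by linarith [ht.1, hx.2]⟩).trans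
        (ENNReal.ofReal_le_ofReal ?_)
      rw [abs_le]; constructor <;> linarith

theorem form_seg (e : E) (x y lam : ℝ) (v w : (Γ.Point → ℝ) × (E → ℝ → ℝ)) :
    (seg e x y : Γ.Curve).form lam v w = ∫ t in (min x y)..(max x y), density lam v w e t := by
  rcases le_or_gt x y with h | h
  · rw [min_eq_left h, max_eq_right h, form]
    simp only [seg, if_pos h, abs_of_nonneg (sub_nonneg.2 h)]
    have := intervalIntegral.integral_comp_add_left (a := 0) (b := y - x) (density lam v w e) x
    simpa [density] using this
  · rw [min_eq_right h.le, max_eq_left h.le, form]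
    simp only [seg, if_neg (not_le.2 h), abs_of_nonpos (sub_nonpos.2 h.le)]
    have := intervalIntegral.integral_comp_sub_left (a := 0) (b := x - y) (density lam v w e) x
    simpa [density] using this

end MetricGraph.Curve

/-! ### Trees of segments and walks around them -/

/-- A rooted plane tree whose edges are labelled by segments of edges of a metric graph. The tree
`node e x y sub rest` consists of the segment of the edge `e` which leads from the root, with
coordinate `x`, to the point with coordinate `y`, of the tree `sub` rooted at that point, and of the
tree `rest` rooted at the same point as the whole tree. -/
inductive STree (E : Type*) : Type _
  | nil : STree E
  | node (e : E) (x y : ℝ) (sub rest : STree E) : STree E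

namespace STree

variable {E : Type*} {Γ : MetricGraph E}

open MetricGraph

/-- The total length of the segments. -/
def length : STree E → ℝ
  | nil => 0
  | node _ x y sub rest => |y - x| + sub.length + rest.length

/-- The tree is rooted at `p`, and its segments fit together and are nondegenerate. -/
def WF (Γ : MetricGraph E) : STree E → Γ.Point → Prop
  | nil, _ => True
  | node e x y sub rest, p => p = Γ.ptR e x ∧ x ≠ y ∧ x ∈ Icc 0 (Γ.len e) ∧ y ∈ Icc 0 (Γ.len e) ∧
      sub.WF Γ (Γ.ptR e y) ∧ rest.WF Γ p

/-- The set of segments, as triples consisting of an edge, the smaller and the larger coordinate. -/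
def segs : STree E → Set (E × ℝ × ℝ)
  | nil => ∅
  | node e x y sub rest => insert (e, min x y, max x y) (sub.segs ∪ rest.segs)

/-- The form `∫ (v' w' - λ v w)` over all segments. -/
noncomputable def form (lam : ℝ) (v w : (Γ.Point → ℝ) × (E → ℝ → ℝ)) : STree E → ℝ
  | nil => 0
  | node e x y sub rest =>
      (∫ t in (min x y)..(max x y), density lam v w e t) + sub.form lam v w + rest.form lam v w

/-- The union of two trees with the same root. -/
def append : STree E → STree E → STree E
  | nil, B => B
  | node e x y sub rest, B => node e x y sub (rest.append B)

/-- The walk around a tree, which traverses every segment once in each direction. -/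
noncomputable def tour (Γ : MetricGraph E) : STree E → Γ.Point → Γ.Curve
  | nil, p => Curve.const p
  | node e x y sub rest, p => (Curve.seg e x y).append
      ((sub.tour Γ (Γ.ptR e y)).append ((Curve.seg e y x).append (rest.tour Γ p)))

/-- The function `f` vanishes on all segments. -/
def VanishOn (f : Γ.Point → ℝ) (T : STree E) : Prop :=
  ∀ s ∈ T.segs, ∀ t ∈ Icc s.2.1 s.2.2, f (Γ.ptR s.1 t) = 0

theorem length_nonneg : ∀ T : STree E, 0 ≤ T.length
  | nil => le_rfl
  | node _ x y sub rest =>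
    add_nonneg (add_nonneg (abs_nonneg (y - x)) sub.length_nonneg) rest.length_nonneg

theorem WF.eq_nil {T : STree E} {p : Γ.Point} (h : T.WF Γ p) (h0 : T.length ≤ 0) : T = nil := by
  cases T with
  | nil => rfl
  | node e x y sub rest =>
    have h1 : 0 < |y - x| := abs_pos.2 (sub_ne_zero.2 h.2.1.symm)
    simp only [length] at h0
    linarith [sub.length_nonneg, rest.length_nonneg]

theorem append_nil : ∀ T : STree E, T.append nil = T
  | nil => rfl
  | node e x y sub rest => by rw [append, rest.append_nil]

theorem length_append : ∀ A B : STree E, (A.append B).length = A.length + B.length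
  | nil, B => by simp [append, length]
  | node e x y sub rest, B => by simp only [append, length, rest.length_append B]; ring

theorem segs_append : ∀ A B : STree E, (A.append B).segs = A.segs ∪ B.segs
  | nil, B => by simp [append, segs]
  | node e x y sub rest, B => by
    simp only [append, segs, rest.segs_append B, insert_union, union_assoc]

theorem form_append (lam : ℝ) (v w : (Γ.Point → ℝ) × (E → ℝ → ℝ)) : ∀ A B : STree E,
    (A.append B).form lam v w = A.form lam v w + B.form lam v w
  | nil, B => by simp [append, form]
  | node e x y sub rest, B => by simp only [append, form, rest.form_append lam v w B]; ring

theorem WF.append {p : Γ.Point} : ∀ {A B : STree E}, A.WF Γ p → B.WF Γ p → (A.append B).WF Γ p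
  | nil, _, _, hB => hB
  | node _ _ _ _ _, _, hA, hB =>
    ⟨hA.1, hA.2.1, hA.2.2.1, hA.2.2.2.1, hA.2.2.2.2.1, hA.2.2.2.2.2.append hB⟩

theorem WF.isCurve_tour : ∀ {T : STree E} {p : Γ.Point}, T.WF Γ p → (T.tour Γ p).IsCurve p p
  | nil, p, _ => Curve.isCurve_const p
  | node e x y sub rest, p, h => by
    obtain ⟨rfl, -, hx, hy, hs, hr⟩ := h
    exact (Curve.isCurve_seg e hx hy).append (hs.isCurve_tour.append
      ((Curve.isCurve_seg e hy hx).append hr.isCurve_tour))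

theorem tour_τ : ∀ (T : STree E) (p : Γ.Point), (T.tour Γ p).τ = 2 * T.length
  | nil, p => by simp [tour, Curve.const, length]
  | node e x y sub rest, p => by
    simp only [tour, Curve.append, Curve.seg, length, sub.tour_τ, rest.tour_τ, abs_sub_comm x y]
    ring

theorem WF.form_tour (lam : ℝ) {v w : (Γ.Point → ℝ) × (E → ℝ → ℝ)} (hv : v ∈ Γ.H1)
    (hw : w ∈ Γ.H1) : ∀ {T : STree E} {p : Γ.Point}, T.WF Γ p →
      (T.tour Γ p).form lam v w = 2 * T.form lam v w
  | nil, p, _ => by simp [tour, Curve.const, Curve.form, form]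
  | node e x y sub rest, p, h => by
    obtain ⟨rfl, -, hx, hy, hs, hr⟩ := h
    have c1 := Curve.isCurve_seg (Γ := Γ) e hx hy
    have c2 := Curve.isCurve_seg (Γ := Γ) e hy hx
    rw [tour, c1.form_append (hs.isCurve_tour.append (c2.append hr.isCurve_tour)) lam hv hw,
      hs.isCurve_tour.form_append (c2.append hr.isCurve_tour) lam hv hw,
      c2.form_append hr.isCurve_tour lam hv hw, hs.form_tour lam hv hw, hr.form_tour lam hv hw,
      Curve.form_seg, Curve.form_seg, form, min_comm y x, max_comm y x]
    ring

end STree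

namespace MetricGraph.Curve

variable {E : Type*} {Γ : MetricGraph E}

theorem append_pos_left (c d : Γ.Curve) {s : ℝ} (hs : s ≤ c.τ) :
    (c.append d).pos s = c.pos s := if_pos hs

theorem IsCurve.append_pos_right {c d : Γ.Curve} {p q r : Γ.Point} (hc : c.IsCurve p q)
    (hd : d.IsCurve q r) {s : ℝ} (hs : 0 ≤ s) : (c.append d).pos (c.τ + s) = d.pos s := by
  rcases hs.eq_or_lt with rfl | hs
  · rw [add_zero, append_pos_left c d le_rfl, hc.right, hd.left]
  · have h1 : ¬c.τ + s ≤ c.τ := by linarith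
    exact (if_neg h1).trans (by rw [add_sub_cancel_left])

theorem seg_pos (e : E) (x y t : ℝ) (ht : t ∈ Icc (min x y) (max x y)) :
    ∃ s ∈ Icc 0 |y - x|, (seg e x y : Γ.Curve).pos s = Γ.ptR e t := by
  rcases le_or_gt x y with h | h
  · rw [min_eq_left h, max_eq_right h] at ht
    refine ⟨t - x, ?_, ?_⟩
    · rw [abs_of_nonneg (by linarith)]; exact ⟨by linarith [ht.1], by linarith [ht.2]⟩
    · simp [seg, if_pos h]
  · rw [min_eq_right h.le, max_eq_left h.le] at ht
    refine ⟨x - t, ?_, ?_⟩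
    · rw [abs_of_nonpos (by linarith)]; exact ⟨by linarith [ht.2], by linarith [ht.1]⟩
    · simp [seg, if_neg (not_le.2 h)]

end MetricGraph.Curve

namespace STree

variable {E : Type*} {Γ : MetricGraph E}

open MetricGraph

/-- The walk around `sub` is the part of the walk around `node e x y sub rest` which starts at time
`|y - x|`. -/
theorem WF.tour_pos_sub {e : E} {x y : ℝ} {sub rest : STree E} {p : Γ.Point}
    (h : (node e x y sub rest).WF Γ p) {s : ℝ} (hs : 0 ≤ s) (hs' : s ≤ 2 * sub.length) :
    ((node e x y sub rest).tour Γ p).pos (|y - x| + s) = (sub.tour Γ (Γ.ptR e y)).pos s := by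
  obtain ⟨rfl, -, hx, hy, hS, hr⟩ := h
  have c2 := Curve.isCurve_seg (Γ := Γ) e hy hx
  refine ((Curve.isCurve_seg (Γ := Γ) e hx hy).append_pos_right
    (hS.isCurve_tour.append (c2.append hr.isCurve_tour)) hs).trans
    (Curve.append_pos_left _ _ ?_)
  rwa [tour_τ]

/-- The walk around `rest` is the last part of the walk around `node e x y sub rest`. -/
theorem WF.tour_pos_rest {e : E} {x y : ℝ} {sub rest : STree E} {p : Γ.Point}
    (h : (node e x y sub rest).WF Γ p) {s : ℝ} (hs : 0 ≤ s) :
    ((node e x y sub rest).tour Γ p).pos (|y - x| + (2 * sub.length + (|y - x| + s))) =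
      (rest.tour Γ p).pos s := by
  obtain ⟨rfl, -, hx, hy, hS, hr⟩ := h
  have c2 := Curve.isCurve_seg (Γ := Γ) e hy hx
  have n1 := abs_nonneg (y - x)
  have n2 := sub.length_nonneg
  refine ((Curve.isCurve_seg (Γ := Γ) e hx hy).append_pos_right
    (hS.isCurve_tour.append (c2.append hr.isCurve_tour)) (by positivity)).trans ?_
  rw [← sub.tour_τ (Γ.ptR e y), abs_sub_comm y x]
  exact (hS.isCurve_tour.append_pos_right (c2.append hr.isCurve_tour) (by positivity)).trans
    (c2.append_pos_right hr.isCurve_tour hs)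

theorem WF.vanishOn_of_tour {f : Γ.Point → ℝ} : ∀ {T : STree E} {p : Γ.Point}, T.WF Γ p →
    (∀ s ∈ Icc 0 (T.tour Γ p).τ, f ((T.tour Γ p).pos s) = 0) → VanishOn f T
  | nil, p, _, _ => by intro s hs; exact absurd hs (notMem_empty s)
  | node e x y sub rest, p, h, h0 => by
    have hWF := h
    obtain ⟨rfl, -, hx, hy, hs, hr⟩ := h
    rw [tour_τ, length] at h0
    have n1 := sub.length_nonneg
    have n2 := rest.length_nonneg
    have n3 := abs_nonneg (y - x)
    have hsub : VanishOn f sub := hs.vanishOn_of_tour fun s hs' => by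
      rw [tour_τ] at hs'
      rw [← hWF.tour_pos_sub hs'.1 hs'.2]
      exact h0 _ ⟨by linarith [hs'.1], by linarith [hs'.2]⟩
    have hrest : VanishOn f rest := hr.vanishOn_of_tour fun s hs' => by
      rw [tour_τ] at hs'
      rw [← hWF.tour_pos_rest hs'.1]
      exact h0 _ ⟨by linarith [hs'.1], by linarith [hs'.2]⟩
    intro s hsm t ht
    rcases hsm with rfl | hsm | hsm
    · obtain ⟨s, hs1, hs2⟩ := Curve.seg_pos (Γ := Γ) e x y t ht
      have := h0 s ⟨hs1.1, by linarith [hs1.2]⟩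
      rwa [tour, Curve.append_pos_left _ _ hs1.2, hs2] at this
    · exact hsub s hsm t ht
    · exact hrest s hsm t ht

/-- Where a function vanishes, its derivative vanishes almost everywhere. -/
theorem form_eq_zero_of_vanishOn {lam : ℝ} {v w : (Γ.Point → ℝ) × (E → ℝ → ℝ)} (hv : v ∈ Γ.H1) :
    ∀ {T : STree E} {p : Γ.Point}, T.WF Γ p → VanishOn v.1 T → T.form lam v w = 0
  | nil, _, _, _ => rfl
  | node e x y sub rest, p, h, h0 => by
    obtain ⟨rfl, -, hx, hy, hs, hr⟩ := h
    have h1 := form_eq_zero_of_vanishOn (lam := lam) (w := w) hv hs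
      fun s hs => h0 s (Or.inr (Or.inl hs))
    have h2 := form_eq_zero_of_vanishOn (lam := lam) (w := w) hv hr
      fun s hs => h0 s (Or.inr (Or.inr hs))
    have h3 := h0 (e, min x y, max x y) (Or.inl rfl)
    have hle : min x y ≤ max x y := min_le_max
    have h4 := ((isH1On_onEdge hv e).mono (le_min hx.1 hy.1) hle (max_le hx.2 hy.2)).ae_hasDerivAt hle
    rw [form, h1, h2, add_zero, add_zero]
    have hne : ∀ᵐ t : ℝ, t ≠ max x y := by simp [ae_iff, measure_singleton]
    refine (intervalIntegral.integral_congr_ae (g := fun _ => 0) ?_).trans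
      intervalIntegral.integral_zero
    filter_upwards [h4, hne] with t ht htn htm
    rw [uIoc_of_le hle] at htm
    have htm' : t ∈ Ioo (min x y) (max x y) := ⟨htm.1, lt_of_le_of_ne htm.2 htn⟩
    have hz : HasDerivAt (fun x => v.1 (Γ.ptR e x)) 0 t := by
      refine (hasDerivAt_const t (0 : ℝ)).congr_of_eventuallyEq ?_
      filter_upwards [Ioo_mem_nhds htm'.1 htm'.2] with u hu
      exact h3 u (Ioo_subset_Icc_self hu)
    have hg : v.2 e t = 0 := (ht htm').unique hz
    have hf : v.1 (Γ.ptR e t) = 0 := h3 t (Ioo_subset_Icc_self htm')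
    simp [density, hg, hf]

/-! ### The energy form on a tree -/

/-- For a tree of length at most `(m + 1) ℓ` rooted at `p`, there are `m` points such that the energy
form at frequency `π / (2 ℓ)` is nonnegative on the functions vanishing at `p` and at these points,
and definite if the length is strictly smaller: the walk around the tree has at most the length
`2 (m + 1) ℓ`, and the points cut it into `m + 1` equal arcs. -/
theorem WF.exists_points {T : STree E} {p : Γ.Point} (h : T.WF Γ p) {ℓ : ℝ} (hℓ : 0 < ℓ) (m : ℕ)
    (hT : T.length ≤ (m + 1) * ℓ) : ∃ S : List Γ.Point, S.length = m ∧
      ∀ w ∈ Γ.H1, w.1 p = 0 → (∀ q ∈ S, w.1 q = 0) →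
        0 ≤ T.form ((Real.pi / (2 * ℓ)) ^ 2) w w ∧
        (T.length < (m + 1) * ℓ → T.form ((Real.pi / (2 * ℓ)) ^ 2) w w ≤ 0 →
          VanishOn w.1 T) := by
  set c := T.tour Γ p with hc
  have hcc := h.isCurve_tour
  rw [← hc] at hcc
  have hτ : c.τ = 2 * T.length := T.tour_τ p
  set om := Real.pi / (2 * ℓ) with hom
  have hom0 : 0 < om := by positivity
  have hm : (0 : ℝ) < m + 1 := by positivity
  set a : ℕ → ℝ := fun j => c.τ * j / (m + 1) with ha
  have ha0 : a 0 = 0 := by simp [ha]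
  have ham : a (m + 1) = c.τ := by simp only [ha]; push_cast; field_simp
  have hamono : Monotone a := by
    refine monotone_nat_of_le_succ fun j => ?_
    simp only [ha]
    push_cast
    have := hcc.nonneg
    gcongr
    linarith
  have hastep : ∀ j, a (j + 1) - a j = 2 * T.length / (m + 1) := by
    intro j; simp only [ha, hτ]; push_cast; field_simp; ring
  have hstep : ∀ j, om * (a (j + 1) - a j) = Real.pi * (T.length / ((m + 1) * ℓ)) := by
    intro j; rw [hastep, hom]; field_simp
  refine ⟨(List.range m).map fun j => c.pos (a (j + 1)), by simp, fun w hw hp hS => ?_⟩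
  have hH := hcc.isH1On w hw
  have hzero : ∀ j, j ≤ m + 1 → w.1 (c.pos (a j)) = 0 := by
    intro j hj
    rcases j with _ | j
    · rw [ha0, hcc.left, hp]
    · rcases (Nat.lt_or_ge j m) with hjm | hjm
      · exact hS _ (List.mem_map.2 ⟨j, List.mem_range.2 hjm, rfl⟩)
      · have : j = m := by omega
        rw [this, ham, hcc.right, hp]
  have hsubH : ∀ j, j < m + 1 → IsH1On (fun s => w.1 (c.pos s)) (c.der w.2) (a j) (a (j + 1)) := by
    intro j hj
    refine hH.mono ?_ (hamono (Nat.le_succ j)) ?_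
    · rw [← ha0]; exact hamono (Nat.zero_le j)
    · rw [← ham]; exact hamono hj
  have hsum : 2 * T.form (om ^ 2) w w = ∑ j ∈ Finset.range (m + 1), ∫ s in (a j)..(a (j + 1)),
      (c.der w.2 s ^ 2 - om ^ 2 * w.1 (c.pos s) ^ 2) := by
    rw [← h.form_tour (om ^ 2) hw hw, Curve.form, ← hc, ← ham]
    rw [intervalIntegral.sum_integral_adjacent_intervals, ha0]
    · simp only [pow_two]
    · intro j hj
      exact (hsubH j hj).intervalIntegrable_sq_sub (hamono (Nat.le_succ j)) (om ^ 2)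
  have hle1 : T.length / ((m + 1) * ℓ) ≤ 1 := by rw [div_le_one (by positivity)]; exact hT
  have hpos : ∀ j ∈ Finset.range (m + 1), 0 ≤ ∫ s in (a j)..(a (j + 1)),
      (c.der w.2 s ^ 2 - om ^ 2 * w.1 (c.pos s) ^ 2) := by
    intro j hj
    have hj' := Finset.mem_range.1 hj
    refine (hsubH j hj').dirichlet_nonneg (hamono (Nat.le_succ j)) hom0 ?_ (hzero j hj'.le)
      (hzero (j + 1) hj')
    rw [hstep]
    nlinarith [Real.pi_pos]
  refine ⟨?_, fun hlt hQ => ?_⟩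
  · have := Finset.sum_nonneg hpos
    linarith
  · have hlt1 : T.length / ((m + 1) * ℓ) < 1 := by rw [div_lt_one (by positivity)]; exact hlt
    have hz : ∀ j ∈ Finset.range (m + 1), ∫ s in (a j)..(a (j + 1)),
      (c.der w.2 s ^ 2 - om ^ 2 * w.1 (c.pos s) ^ 2) = 0 := by
      rw [← Finset.sum_eq_zero_iff_of_nonneg hpos]
      have := Finset.sum_nonneg hpos
      linarith
    refine h.vanishOn_of_tour fun s hs => ?_
    rw [← hc] at hs ⊢
    obtain ⟨j, hj, hsj⟩ : ∃ j < m + 1, s ∈ Icc (a j) (a (j + 1)) := by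
      have key : ∀ n : ℕ, s ≤ a (n + 1) → ∃ j < n + 1, s ∈ Icc (a j) (a (j + 1)) := by
        intro n
        induction n with
        | zero => intro hn; exact ⟨0, by omega, by rw [ha0]; exact hs.1, hn⟩
        | succ n ih =>
          intro hn
          rcases le_total s (a (n + 1)) with h1 | h1
          · obtain ⟨j, hj, hj'⟩ := ih h1
            exact ⟨j, by omega, hj'⟩
          · exact ⟨n + 1, by omega, h1, hn⟩
      exact key m (by rw [ham]; exact hs.2)
    refine ((hsubH j hj).dirichlet_strict (hamono (Nat.le_succ j)) hom0 ?_ (hzero j hj.le)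
      (hzero (j + 1) hj)).2 (hz j (Finset.mem_range.2 hj)).le s hsj
    rw [hstep]
    nlinarith [Real.pi_pos]

/-- A tree of length `ℓ` with a function of vanishing energy form: along the walk around the tree
the function is a multiple of a sine. -/
theorem WF.exists_eq_sin {T : STree E} {p : Γ.Point} (h : T.WF Γ p) {ℓ : ℝ} (hℓ : 0 < ℓ)
    (hT : T.length = ℓ) {w : (Γ.Point → ℝ) × (E → ℝ → ℝ)} (hw : w ∈ Γ.H1) (hp : w.1 p = 0)
    (hQ : T.form ((Real.pi / (2 * ℓ)) ^ 2) w w ≤ 0) :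
    ∃ c, ∀ s ∈ Icc 0 (2 * ℓ), w.1 ((T.tour Γ p).pos s) = c * Real.sin (Real.pi / (2 * ℓ) * s) := by
  have hcc := h.isCurve_tour
  have hH := hcc.isH1On w hw
  have hτ : (T.tour Γ p).τ = 2 * ℓ := by rw [T.tour_τ p, hT]
  rw [hτ] at hH
  have := hH.eq_sin_of_dirichlet (by positivity) (om := Real.pi / (2 * ℓ)) (by positivity)
    (by field_simp; ring) (by simpa [hcc.left] using hp) (by
      have := hcc.right
      rw [hτ] at this
      simpa [this] using hp) (by
      have h2 := h.form_tour ((Real.pi / (2 * ℓ)) ^ 2) hw hw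
      rw [Curve.form, hτ] at h2
      simp only [← pow_two] at h2
      rw [h2]
      linarith)
  simpa using this

/-- The energy form pairs a sine along the walk around a tree with any function to a multiple of
the value of the function at the root. -/
theorem WF.form_of_eq_sin {T : STree E} {p : Γ.Point} (h : T.WF Γ p) {ℓ : ℝ} (hℓ : 0 < ℓ)
    (hT : T.length = ℓ) {w g : (Γ.Point → ℝ) × (E → ℝ → ℝ)} (hw : w ∈ Γ.H1) (hg : g ∈ Γ.H1) {c : ℝ}
    (hc : ∀ s ∈ Icc 0 (2 * ℓ), w.1 ((T.tour Γ p).pos s) = c * Real.sin (Real.pi / (2 * ℓ) * s)) :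
    T.form ((Real.pi / (2 * ℓ)) ^ 2) w g = -(c * (Real.pi / (2 * ℓ))) * g.1 p := by
  have hcc := h.isCurve_tour
  have hH := hcc.isH1On w hw
  have hG := hcc.isH1On g hg
  have hτ : (T.tour Γ p).τ = 2 * ℓ := by rw [T.tour_τ p, hT]
  rw [hτ] at hH hG
  have hr := hcc.right
  rw [hτ] at hr
  set om := Real.pi / (2 * ℓ) with hom
  have h1 := hG.integral_mul_sin (by positivity) om
  have h2 := h.form_tour (om ^ 2) hw hg
  have hne : ∀ᵐ t : ℝ, t ≠ 2 * ℓ := by simp [ae_iff, measure_singleton]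
  have h3 : (T.tour Γ p).form (om ^ 2) w g = c * ∫ x in (0 : ℝ)..(2 * ℓ),
      ((om * Real.cos (om * (x - 0))) * (T.tour Γ p).der g.2 x -
      om ^ 2 * (Real.sin (om * (x - 0)) * g.1 ((T.tour Γ p).pos x))) := by
    rw [Curve.form, hτ, ← intervalIntegral.integral_const_mul]
    refine intervalIntegral.integral_congr_ae ?_
    filter_upwards [hH.ae_hasDerivAt (by positivity), hne] with t ht htn htm
    rw [uIoc_of_le (by positivity)] at htm
    have htm' : t ∈ Ioo 0 (2 * ℓ) := ⟨htm.1, lt_of_le_of_ne htm.2 htn⟩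
    have hz : HasDerivAt (fun s => w.1 ((T.tour Γ p).pos s)) (c * (om * Real.cos (om * t))) t := by
      have h4 : HasDerivAt (fun x => c * Real.sin (om * x)) (c * (om * Real.cos (om * t))) t := by
        have h5 : HasDerivAt (fun x => om * x) om t := by
          simpa using (hasDerivAt_id t).const_mul om
        exact (h5.sin.const_mul c).congr_deriv (by ring)
      refine h4.congr_of_eventuallyEq ?_
      filter_upwards [Ioo_mem_nhds htm'.1 htm'.2] with u hu
      exact hc u (Ioo_subset_Icc_self hu)
    rw [(ht htm').unique hz, hc t (Ioo_subset_Icc_self htm'), sub_zero]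
    ring
  have h6 : om * (2 * ℓ) = Real.pi := by rw [hom]; field_simp
  rw [h3, h1, hr, hcc.left, sub_zero, h6, Real.cos_pi] at h2
  linarith

/-- All branch points of the tree are trivial: it is a path starting at its root. -/
def IsPath : STree E → Prop
  | nil => True
  | node _ _ _ sub rest => rest = nil ∧ sub.IsPath

/-- If a nonzero function is a sine, rising and falling once, along the walk around a tree, then the
tree is a path: otherwise the walk would return to some point at two times at which the sine takes
different values. -/
theorem WF.isPath_of_eq_sin {f : Γ.Point → ℝ} {ℓ : ℝ} (hℓ : 0 < ℓ) {c : ℝ} (hc : c ≠ 0) :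
    ∀ {T : STree E} {p : Γ.Point} {a : ℝ}, T.WF Γ p → 0 ≤ a → a + T.length = ℓ →
      (∀ s ∈ Icc 0 (2 * T.length), f ((T.tour Γ p).pos s) =
        c * Real.sin (Real.pi / (2 * ℓ) * (a + s))) → T.IsPath
  | nil, _, _, _, _, _, _ => trivial
  | node e x y sub rest, p, a, h, ha, hT, h0 => by
    have hWF := h
    obtain ⟨rfl, hxy, hx, hy, hs, hr⟩ := h
    have n1 := sub.length_nonneg
    have n2 := rest.length_nonneg
    have n3 : 0 < |y - x| := abs_pos.2 (sub_ne_zero.2 hxy.symm)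
    have hsub : ∀ s ∈ Icc 0 (2 * sub.length), f ((sub.tour Γ (Γ.ptR e y)).pos s) =
        c * Real.sin (Real.pi / (2 * ℓ) * (a + |y - x| + s)) := by
      intro s hs'
      have := h0 (|y - x| + s) ⟨by linarith [hs'.1], by
        simp only [length]; linarith [hs'.2]⟩
      rw [hWF.tour_pos_sub hs'.1 hs'.2] at this
      rw [this]; ring_nf
    have hlen : a + |y - x| + sub.length + rest.length = ℓ := by
      simp only [length] at hT; linarith
    have hrest : rest.length ≤ 0 := by
      by_contra hcon
      -- the walk is at the root at time `0` and again after the tour of the first branch, at a time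
      -- before `2 ℓ - 2 a`; by symmetry of the sine the values at these times differ
      push Not at hcon
      have z0 := h0 0 ⟨le_rfl, by simp only [length]; linarith⟩
      have z1 := h0 (|y - x| + (2 * sub.length + (|y - x| + 0))) ⟨by positivity, by
        simp only [length]; linarith⟩
      have e0 : ((tour Γ (node e x y sub rest) (Γ.ptR e x))).pos 0 = Γ.ptR e x :=
        hWF.isCurve_tour.left
      rw [e0] at z0
      rw [hWF.tour_pos_rest le_rfl, hr.isCurve_tour.left, z0] at z1
      have z2 := mul_left_cancel₀ hc z1
      set u := Real.pi / (2 * ℓ) * (a + 0) with hu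
      set v := Real.pi / (2 * ℓ) * (a + (|y - x| + (2 * sub.length + (|y - x| + 0)))) with hv
      have z3 := Real.sin_sub_sin v u
      rw [← z2, sub_self] at z3
      have hpi := Real.pi_pos
      have hk : 0 < Real.pi / (2 * ℓ) := by positivity
      have hk2 : Real.pi / (2 * ℓ) * ℓ = Real.pi / 2 := by field_simp
      have s1 : 0 < Real.sin ((v - u) / 2) := by
        have e2 : (v - u) / 2 = Real.pi / (2 * ℓ) * (|y - x| + sub.length) := by
          rw [hu, hv]; ring
        rw [e2]
        refine Real.sin_pos_of_pos_of_lt_pi (by positivity) ?_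
        have : Real.pi / (2 * ℓ) * (|y - x| + sub.length) ≤ Real.pi / (2 * ℓ) * ℓ :=
          mul_le_mul_of_nonneg_left (by linarith) hk.le
        linarith
      have s2 : 0 < Real.cos ((v + u) / 2) := by
        have e2 : (v + u) / 2 = Real.pi / (2 * ℓ) * (a + |y - x| + sub.length) := by
          rw [hu, hv]; ring
        rw [e2]
        have : Real.pi / (2 * ℓ) * (a + |y - x| + sub.length) < Real.pi / (2 * ℓ) * ℓ :=
          mul_lt_mul_of_pos_left (by linarith) hk
        refine Real.cos_pos_of_mem_Ioo ⟨?_, by linarith⟩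
        have : 0 ≤ Real.pi / (2 * ℓ) * (a + |y - x| + sub.length) := by positivity
        linarith
      have := mul_pos s1 s2
      nlinarith
    have hnil := hr.eq_nil hrest
    refine ⟨hnil, hs.isPath_of_eq_sin hℓ hc (a := a + |y - x|) (by positivity) ?_ hsub⟩
    rw [hnil, length, add_zero] at hlen
    exact hlen

end STree

namespace MetricGraph

variable {E : Type*} {Γ : MetricGraph E}

/-- Distinct coordinates of the same point belong to endpoints of edges. -/
theorem ptR_eq_ptR {e e' : E} {x x' : ℝ} (hx : x ∈ Icc 0 (Γ.len e)) (hx' : x' ∈ Icc 0 (Γ.len e'))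
    (h : Γ.ptR e x = Γ.ptR e' x') :
    (e = e' ∧ x = x') ∨ ((x = 0 ∨ x = Γ.len e) ∧ (x' = 0 ∨ x' = Γ.len e')) := by
  rw [ptR, ptR, projIcc_of_mem _ hx, projIcc_of_mem _ hx'] at h
  have key : ∀ {e : E} {x : ℝ} (hx : x ∈ Icc 0 (Γ.len e)) (s : E × Bool),
      (⟨e, ⟨x, hx⟩⟩ : Γ.Pre) = Γ.endpt s → x = 0 ∨ x = Γ.len e := by
    rintro e x hx ⟨e₁, b⟩ h
    have he : e = e₁ := congrArg Sigma.fst h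
    subst he
    have h2 := eq_of_heq (Sigma.mk.inj h).2
    cases b
    · exact Or.inl (congrArg Subtype.val h2)
    · exact Or.inr (congrArg Subtype.val h2)
  rcases Quotient.exact h with h | ⟨s, t, -, hs, ht⟩
  · left
    have he : e = e' := congrArg Sigma.fst h
    subst he
    exact ⟨rfl, congrArg Subtype.val (eq_of_heq (Sigma.mk.inj h).2)⟩
  · exact Or.inr ⟨key hx s hs, key hx' t ht⟩

end MetricGraph

namespace STree

variable {E : Type*} {Γ : MetricGraph E}

open MetricGraph

/-! ### Cutting trees -/

/-- `R.Refines S`: the segments of `R` are those of `S`, up to their arrangement and up to the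
subdivision of a segment into two. -/
structure Refines (Γ : MetricGraph E) (R S : STree E) : Prop where
  length_eq : R.length = S.length
  form_eq : ∀ lam : ℝ, ∀ v ∈ Γ.H1, ∀ w ∈ Γ.H1, R.form lam v w = S.form lam v w
  segs : ∀ s ∈ S.segs, s ∈ R.segs ∨
    ∃ c ∈ Icc s.2.1 s.2.2, (s.1, s.2.1, c) ∈ R.segs ∧ (s.1, c, s.2.2) ∈ R.segs

theorem Refines.vanishOn {R S : STree E} (h : R.Refines Γ S) {f : Γ.Point → ℝ}
    (h0 : VanishOn f R) : VanishOn f S := by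
  intro s hs t ht
  rcases h.segs s hs with h1 | ⟨c, -, h1, h2⟩
  · exact h0 s h1 t ht
  · rcases le_total t c with htc | htc
    · exact h0 _ h1 t ⟨ht.1, htc⟩
    · exact h0 _ h2 t ⟨htc, ht.2⟩

theorem VanishOn.append {f : Γ.Point → ℝ} {A B : STree E} (hA : VanishOn f A) (hB : VanishOn f B) :
    VanishOn f (A.append B) := by
  intro s hs
  rw [segs_append] at hs
  exact hs.elim (hA s) (hB s)

theorem Refines.of_eq {R S S' : STree E} (h : R.Refines Γ S) (h1 : S.length = S'.length)
    (h2 : ∀ (lam : ℝ) (v w : (Γ.Point → ℝ) × (E → ℝ → ℝ)), S.form lam v w = S'.form lam v w)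
    (h3 : S.segs = S'.segs) : R.Refines Γ S' :=
  ⟨h.length_eq.trans h1, fun lam v hv w hw => (h.form_eq lam v hv w hw).trans (h2 lam v w),
    h3 ▸ h.segs⟩

theorem Refines.refl (S : STree E) : S.Refines Γ S :=
  ⟨rfl, fun _ _ _ _ _ => rfl, fun _ hs => Or.inl hs⟩

/-- The subdivision of the first segment of a tree at an inner point. -/
theorem refines_cut {e : E} {x y z : ℝ} (hx : x ∈ Icc 0 (Γ.len e)) (hy : y ∈ Icc 0 (Γ.len e))
    (hz : (x ≤ z ∧ z ≤ y) ∨ (y ≤ z ∧ z ≤ x)) (sub rest : STree E) :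
    ((node e z y sub nil).append (node e z x rest nil)).Refines Γ (node e x y sub rest) := by
  have hlen : |y - z| + |x - z| = |y - x| := by
    rcases hz with h | h
    · rw [abs_of_nonneg (by linarith), abs_of_nonpos (by linarith), abs_of_nonneg (by linarith)]
      ring
    · rw [abs_of_nonpos (by linarith), abs_of_nonneg (by linarith), abs_of_nonpos (by linarith)]
      ring
  refine ⟨?_, fun lam v hv w hw => ?_, ?_⟩
  · simp only [append, length]; linarith
  · have hI := intervalIntegrable_density lam hv hw e
    rw [intervalIntegrable_iff_integrableOn_Icc_of_le (Γ.len_pos e).le] at hI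
    have hsub : ∀ {a b : ℝ}, a ∈ Icc 0 (Γ.len e) → b ∈ Icc 0 (Γ.len e) →
        IntervalIntegrable (density lam v w e) volume a b := by
      intro a b ha hb
      exact (hI.mono_set (uIcc_subset_Icc ha hb)).intervalIntegrable
    have hint : (∫ t in (min z y)..(max z y), density lam v w e t) +
        (∫ t in (min z x)..(max z x), density lam v w e t) =
        ∫ t in (min x y)..(max x y), density lam v w e t := by
      rcases hz with h | h
      · have hzm : z ∈ Icc 0 (Γ.len e) := ⟨hx.1.trans h.1, h.2.trans hy.2⟩
        rw [min_eq_left h.2, max_eq_right h.2, min_eq_right h.1, max_eq_left h.1,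
          min_eq_left (h.1.trans h.2), max_eq_right (h.1.trans h.2), add_comm,
          intervalIntegral.integral_add_adjacent_intervals (hsub hx hzm) (hsub hzm hy)]
      · have hzm : z ∈ Icc 0 (Γ.len e) := ⟨hy.1.trans h.1, h.2.trans hx.2⟩
        rw [min_eq_right h.1, max_eq_left h.1, min_eq_left h.2, max_eq_right h.2,
          min_eq_right (h.1.trans h.2), max_eq_left (h.1.trans h.2),
          intervalIntegral.integral_add_adjacent_intervals (hsub hy hzm) (hsub hzm hx)]
    simp only [append, form]
    linarith
  · intro s hs
    simp only [append, STree.segs, union_empty] at hs ⊢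
    rcases hs with rfl | hs | hs
    · right
      rcases hz with h | h
      · refine ⟨z, by simp [min_eq_left (h.1.trans h.2), max_eq_right (h.1.trans h.2), h], ?_, ?_⟩
        · right; right; left
          simp [min_eq_left (h.1.trans h.2), min_eq_right h.1, max_eq_left h.1]
        · left
          simp [max_eq_right (h.1.trans h.2), min_eq_left h.2, max_eq_right h.2]
      · refine ⟨z, by simp [min_eq_right (h.1.trans h.2), max_eq_left (h.1.trans h.2), h], ?_, ?_⟩
        · left
          simp [min_eq_right (h.1.trans h.2), min_eq_right h.1, max_eq_left h.1]
        · right; right; left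
          simp [max_eq_left (h.1.trans h.2), min_eq_left h.2, max_eq_right h.2]
    · exact Or.inl (Or.inr (Or.inl hs))
    · exact Or.inl (Or.inr (Or.inr (Or.inr hs)))

/-- A tree of length at least `ℓ` can be cut at a point into a part of length exactly `ℓ`, or into
two parts shorter than `ℓ` but not so together, and the remainder. The point is found by moving away
from the root as long as the part of the tree beyond is long enough; the tree `C` collects the parts
left behind. -/
theorem WF.exists_cut {ℓ : ℝ} : ∀ {T C : STree E} {p : Γ.Point}, T.WF Γ p → C.WF Γ p →
    0 < ℓ → ℓ ≤ T.length → ∃ (q : Γ.Point) (A B C' : STree E), A.WF Γ q ∧ B.WF Γ q ∧ C'.WF Γ q ∧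
      (A.append (B.append C')).Refines Γ (T.append C) ∧
      ((A.length = ℓ ∧ B = nil) ∨ (A.length < ℓ ∧ B.length < ℓ ∧ ℓ ≤ A.length + B.length))
  | nil, _, _, _, _, hℓ, h => absurd h (by simp [length, hℓ])
  | node e x y sub rest, C, p, hT, hC, hℓ, h => by
    have hT' := hT
    obtain ⟨rfl, hxy, hx, hy, hs, hr⟩ := hT
    have n3 : 0 < |y - x| := abs_pos.2 (sub_ne_zero.2 hxy.symm)
    -- if `sub` is long enough, the cut is made there; seen from its root, the rest of the tree hangs
    -- on the first segment, traversed backwards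
    rcases le_or_gt ℓ sub.length with h1 | h1
    · have hC' : (node e y x (rest.append C) nil).WF Γ (Γ.ptR e y) :=
        ⟨rfl, hxy.symm, hy, hx, hr.append hC, trivial⟩
      obtain ⟨q, A, B, C', hA, hB, hC', hR, hcase⟩ := hs.exists_cut hC' hℓ h1
      refine ⟨q, A, B, C', hA, hB, hC', hR.of_eq ?_ ?_ ?_, hcase⟩
      · simp only [length_append, length, abs_sub_comm x y]; ring
      · intro lam v w
        simp only [form_append, form, min_comm x y, max_comm x y]; ring
      · simp only [segs_append, segs, min_comm x y, max_comm x y, union_empty]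
        ext s; simp only [mem_union, mem_insert_iff]; tauto
    rcases lt_trichotomy (|y - x| + sub.length) ℓ with h2 | h2 | h2
    · -- the first branch is too short: either `rest` is long enough, or the cut is made at the root
      have hA : (node e x y sub nil).WF Γ (Γ.ptR e x) := ⟨rfl, hxy, hx, hy, hs, trivial⟩
      rcases le_or_gt ℓ rest.length with h3 | h3
      · obtain ⟨q, A, B, C', hA, hB, hC', hR, hcase⟩ := hr.exists_cut (hA.append hC) hℓ h3
        refine ⟨q, A, B, C', hA, hB, hC', hR.of_eq ?_ ?_ ?_, hcase⟩
        · simp only [length_append, length]; ring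
        · intro lam v w
          simp only [form_append, form]; ring
        · simp only [segs_append, segs]
          ext s; simp only [mem_union, mem_insert_iff]; tauto
      · refine ⟨_, node e x y sub nil, rest, C, hA, hr, hC, Refines.refl _,
          Or.inr ⟨by simpa [length] using h2, h3, by simpa [length] using h⟩⟩
    · refine ⟨_, node e x y sub nil, nil, rest.append C, ⟨rfl, hxy, hx, hy, hs, trivial⟩, trivial,
        hr.append hC, Refines.refl _, Or.inl ⟨by simpa [length] using h2, rfl⟩⟩
    · -- the cut is made inside the segment, at distance `ℓ - sub.length` from its far end
      set r := (ℓ - sub.length) / |y - x| with hr'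
      have hr0 : 0 < r := div_pos (by linarith) n3
      have hr1 : r < 1 := by rw [hr', div_lt_one n3]; linarith
      set z := y + (x - y) * r with hz
      have hyz : |y - z| = ℓ - sub.length := by
        have : y - z = (y - x) * r := by rw [hz]; ring
        rw [this, abs_mul, abs_of_pos hr0, hr']; field_simp
      have hzb : (x ≤ z ∧ z ≤ y) ∨ (y ≤ z ∧ z ≤ x) := by
        rcases le_total x y with hle | hle
        · left; constructor <;> rw [hz] <;> nlinarith
        · right; constructor <;> rw [hz] <;> nlinarith
      have hzm : z ∈ Icc 0 (Γ.len e) := by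
        rcases hzb with hb | hb
        · exact ⟨hx.1.trans hb.1, hb.2.trans hy.2⟩
        · exact ⟨hy.1.trans hb.1, hb.2.trans hx.2⟩
      have hzy : z ≠ y := by
        intro h'; rw [h', sub_self, abs_zero] at hyz; linarith
      have hzx : z ≠ x := by
        intro h'; rw [h'] at hyz; linarith
      refine ⟨Γ.ptR e z, node e z y sub nil, nil, node e z x (rest.append C) nil,
        ⟨rfl, hzy, hzm, hy, hs, trivial⟩, trivial, ⟨rfl, hzx, hzm, hx, hr.append hC, trivial⟩,
        refines_cut hx hy hzb sub (rest.append C), Or.inl ⟨?_, rfl⟩⟩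
      simp only [length]; linarith

/-! ### Spanning trees -/

/-- The set of vertices of a tree rooted at a given point. -/
def verts (Γ : MetricGraph E) : STree E → Γ.Point → Set Γ.Point
  | nil, p => {p}
  | node e _ y sub rest, p => sub.verts Γ (Γ.ptR e y) ∪ rest.verts Γ p

theorem root_mem_verts : ∀ (T : STree E) (p : Γ.Point), p ∈ T.verts Γ p
  | nil, _ => rfl
  | node _ _ _ _ rest, p => Or.inr (rest.root_mem_verts p)

/-- The endpoints of the segments of a tree are vertices. -/
theorem WF.mem_verts : ∀ {T : STree E} {p : Γ.Point}, T.WF Γ p → ∀ s ∈ T.segs,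
    Γ.ptR s.1 s.2.1 ∈ T.verts Γ p ∧ Γ.ptR s.1 s.2.2 ∈ T.verts Γ p
  | nil, _, _, s, hs => absurd hs (notMem_empty s)
  | node e x y sub rest, p, h, s, hs => by
    obtain ⟨rfl, -, -, -, hS, hr⟩ := h
    rcases hs with rfl | hs | hs
    · have h1 : Γ.ptR e x ∈ (node e x y sub rest).verts Γ (Γ.ptR e x) :=
        root_mem_verts _ _
      have h2 : Γ.ptR e y ∈ (node e x y sub rest).verts Γ (Γ.ptR e x) :=
        Or.inl (root_mem_verts _ _)
      rcases le_total x y with hle | hle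
      · simp only [min_eq_left hle, max_eq_right hle]; exact ⟨h1, h2⟩
      · simp only [min_eq_right hle, max_eq_left hle]; exact ⟨h2, h1⟩
    · exact ⟨Or.inl (hS.mem_verts s hs).1, Or.inl (hS.mem_verts s hs).2⟩
    · exact ⟨Or.inr (hr.mem_verts s hs).1, Or.inr (hr.mem_verts s hs).2⟩

/-- A segment can be attached to a tree at each of its vertices. -/
theorem WF.exists_insert {e₀ : E} {x₀ y₀ : ℝ} (hxy₀ : x₀ ≠ y₀) (hx₀ : x₀ ∈ Icc 0 (Γ.len e₀))
    (hy₀ : y₀ ∈ Icc 0 (Γ.len e₀)) : ∀ {T : STree E} {p : Γ.Point}, T.WF Γ p →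
    Γ.ptR e₀ x₀ ∈ T.verts Γ p → ∃ T' : STree E, T'.WF Γ p ∧ T'.length = |y₀ - x₀| + T.length ∧
      (∀ (lam : ℝ) (v w : (Γ.Point → ℝ) × (E → ℝ → ℝ)), T'.form lam v w =
        (∫ t in (min x₀ y₀)..(max x₀ y₀), density lam v w e₀ t) + T.form lam v w) ∧
      T'.segs = insert (e₀, min x₀ y₀, max x₀ y₀) T.segs
  | nil, p, _, hv => ⟨node e₀ x₀ y₀ nil nil, ⟨hv.symm, hxy₀, hx₀, hy₀, trivial, trivial⟩,
      by simp [length], by simp [form], by simp [segs]⟩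
  | node e x y sub rest, p, h, hv => by
    obtain ⟨rfl, hxy, hx, hy, hS, hr⟩ := h
    rcases hv with hv | hv
    · obtain ⟨S, h1, h2, h3, h4⟩ := hS.exists_insert hxy₀ hx₀ hy₀ hv
      refine ⟨node e x y S rest, ⟨rfl, hxy, hx, hy, h1, hr⟩, ?_, ?_, ?_⟩
      · simp only [length, h2]; ring
      · intro lam v w; simp only [form, h3]; ring
      · simp only [segs, h4]; ext s; simp only [mem_union, mem_insert_iff]; tauto
    · obtain ⟨S, h1, h2, h3, h4⟩ := hr.exists_insert hxy₀ hx₀ hy₀ hv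
      refine ⟨node e x y sub S, ⟨rfl, hxy, hx, hy, hS, h1⟩, ?_, ?_, ?_⟩
      · simp only [length, h2]; ring
      · intro lam v w; simp only [form, h3]; ring
      · simp only [segs, h4]; ext s; simp only [mem_union, mem_insert_iff]; tauto

/-- A connected graph has a spanning tree in the following sense: all edges can be arranged into a
tree. Where the graph has cycles, the tree comes from it by separating some edges at a vertex. -/
theorem exists_spanning [Fintype E] [Nonempty E] (hconn : Γ.IsConnected) :
    ∃ (T : STree E) (p : Γ.Point), T.WF Γ p ∧ T.length = Γ.totalLength ∧
      (∀ (lam : ℝ) (v w : (Γ.Point → ℝ) × (E → ℝ → ℝ)),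
        T.form lam v w = ∑ e, ∫ t in (0 : ℝ)..(Γ.len e), density lam v w e t) ∧
      ∀ e, (e, 0, Γ.len e) ∈ T.segs := by
  classical
  have hl : ∀ e, 0 ≤ Γ.len e := fun e => (Γ.len_pos e).le
  have key : ∀ n : ℕ, n + 1 ≤ Fintype.card E → ∃ S : Finset E, S.card = n + 1 ∧
      ∃ (T : STree E) (p : Γ.Point), T.WF Γ p ∧ T.length = ∑ e ∈ S, Γ.len e ∧
      (∀ (lam : ℝ) (v w : (Γ.Point → ℝ) × (E → ℝ → ℝ)),
        T.form lam v w = ∑ e ∈ S, ∫ t in (0 : ℝ)..(Γ.len e), density lam v w e t) ∧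
      ∀ e ∈ S, (e, 0, Γ.len e) ∈ T.segs := by
    intro n
    induction n with
    | zero =>
      intro _
      obtain ⟨e⟩ := ‹Nonempty E›
      refine ⟨{e}, by simp, node e 0 (Γ.len e) nil nil, Γ.ptR e 0,
        ⟨rfl, (Γ.len_pos e).ne, ⟨le_rfl, hl e⟩, ⟨hl e, le_rfl⟩, trivial, trivial⟩, ?_, ?_, ?_⟩
      · simp [length, abs_of_nonneg (hl e)]
      · intro lam v w; simp [form, hl e]
      · intro e' he'
        rw [Finset.mem_singleton] at he'
        subst he'
        simp [segs, hl e']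
    | succ n ih =>
      intro hn
      obtain ⟨S, hS, T, p, hT, hlen, hform, hsegs⟩ := ih (by omega)
      obtain ⟨e₁, he₁⟩ : ∃ e, e ∈ S := Finset.card_pos.1 (by omega)
      obtain ⟨e₂, he₂⟩ : ∃ e, e ∉ S := by
        by_contra hcon
        push Not at hcon
        have : S = Finset.univ := Finset.eq_univ_iff_forall.2 hcon
        rw [this, Finset.card_univ] at hS
        omega
      set U : Set Γ.Point := {q | ∃ e ∈ S, ∃ x ∈ Icc 0 (Γ.len e), q = Γ.ptR e x} with hU
      -- an endpoint of an unused edge lying on the tree is a vertex of the tree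
      have hvert : ∀ e ∉ S, ∀ x ∈ Icc 0 (Γ.len e), Γ.ptR e x ∈ U →
          Γ.ptR e x ∈ T.verts Γ p ∧ (x = 0 ∨ x = Γ.len e) := by
        rintro e he x hx ⟨e', he', x', hx', heq⟩
        rcases ptR_eq_ptR hx hx' heq with h | h
        · exact absurd (h.1 ▸ he') he
        · have h1 := hT.mem_verts _ (hsegs e' he')
          refine ⟨?_, h.1⟩
          rw [heq]
          rcases h.2 with rfl | rfl
          · exact h1.1
          · exact h1.2
      -- otherwise `U` would be closed under moving along edges
      obtain ⟨e, he, x, hx, hxU⟩ : ∃ e ∉ S, ∃ x ∈ Icc 0 (Γ.len e), Γ.ptR e x ∈ U := by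
        by_contra hcon
        push Not at hcon
        have hclosed : ∀ {a b : Γ.Point} {r : ℝ}, Γ.Chain a b r → a ∈ U → b ∈ U := by
          intro a b r hch
          induction hch with
          | nil => exact id
          | cons e a b z r _ ih =>
            intro ha
            refine ih ?_
            by_cases heS : e ∈ S
            · exact ⟨e, heS, b, b.2, (Γ.ptR_coe e b).symm⟩
            · rw [← Γ.ptR_coe e a] at ha
              exact absurd ha (hcon e heS a a.2)
        have h1 := hconn (Γ.ptR e₁ 0) (Γ.ptR e₂ 0)
        rw [MetricGraph.edist] at h1
        simp only [iInf_lt_iff] at h1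
        obtain ⟨r, hr, -⟩ := h1
        exact hcon e₂ he₂ 0 ⟨le_rfl, hl e₂⟩ (hclosed hr ⟨e₁, he₁, 0, ⟨le_rfl, hl e₁⟩, rfl⟩)
      obtain ⟨hxv, hx0⟩ := hvert e he x hx hxU
      have hfin : ∀ y, min x y = 0 → max x y = Γ.len e → x ≠ y → y ∈ Icc 0 (Γ.len e) →
          |y - x| = Γ.len e → ∃ S : Finset E, S.card = n + 1 + 1 ∧
      ∃ (T : STree E) (p : Γ.Point), T.WF Γ p ∧ T.length = ∑ e ∈ S, Γ.len e ∧
      (∀ (lam : ℝ) (v w : (Γ.Point → ℝ) × (E → ℝ → ℝ)),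
        T.form lam v w = ∑ e ∈ S, ∫ t in (0 : ℝ)..(Γ.len e), density lam v w e t) ∧
      ∀ e ∈ S, (e, 0, Γ.len e) ∈ T.segs := by
        intro y h1 h2 h3 h4 h5
        obtain ⟨T', a1, a2, a3, a4⟩ := hT.exists_insert h3 hx h4 hxv
        refine ⟨insert e S, by rw [Finset.card_insert_of_notMem he, hS], T', p, a1, ?_, ?_, ?_⟩
        · rw [a2, h5, Finset.sum_insert he, hlen]
        · intro lam v w
          rw [a3, h1, h2, Finset.sum_insert he, hform]
        · intro e' he'
          rw [a4, h1, h2]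
          rcases Finset.mem_insert.1 he' with rfl | h'
          · exact Or.inl rfl
          · exact Or.inr (hsegs e' h')
      rcases hx0 with rfl | rfl
      · exact hfin (Γ.len e) (min_eq_left (hl e)) (max_eq_right (hl e)) (Γ.len_pos e).ne
          ⟨hl e, le_rfl⟩ (by rw [sub_zero, abs_of_nonneg (hl e)])
      · exact hfin 0 (min_eq_right (hl e)) (max_eq_left (hl e)) (Γ.len_pos e).ne'
          ⟨le_rfl, hl e⟩ (by rw [zero_sub, abs_neg, abs_of_nonneg (hl e)])
  have hcard : 0 < Fintype.card E := Fintype.card_pos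
  obtain ⟨S, hS, T, p, h1, h2, h3, h4⟩ := key (Fintype.card E - 1) (by omega)
  have hSu : S = Finset.univ := (Finset.card_eq_iff_eq_univ S).1 (by omega)
  subst hSu
  exact ⟨T, p, h1, h2, h3, fun e => h4 e (Finset.mem_univ e)⟩

end STree

namespace MetricGraph

variable {E : Type*} {Γ : MetricGraph E}

/-! ### Spaces of functions with nonpositive energy -/

/-- The functions in `W` which vanish at all points of a list. -/
def vanishing (W : Submodule ℝ ((Γ.Point → ℝ) × (E → ℝ → ℝ))) (S : List Γ.Point) :
    Submodule ℝ ((Γ.Point → ℝ) × (E → ℝ → ℝ)) where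
  carrier := {w | w ∈ W ∧ ∀ q ∈ S, w.1 q = 0}
  zero_mem' := ⟨W.zero_mem, fun _ _ => rfl⟩
  add_mem' := fun {a b} ha hb => ⟨W.add_mem ha.1 hb.1, fun q hq => by
    simp [ha.2 q hq, hb.2 q hq]⟩
  smul_mem' := fun c a ha => ⟨W.smul_mem c ha.1, fun q hq => by simp [ha.2 q hq]⟩

theorem vanishing_le (W : Submodule ℝ ((Γ.Point → ℝ) × (E → ℝ → ℝ))) (S : List Γ.Point) :
    vanishing W S ≤ W := fun _ h => h.1

instance (W : Submodule ℝ ((Γ.Point → ℝ) × (E → ℝ → ℝ))) [FiniteDimensional ℝ W]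
    (S : List Γ.Point) : FiniteDimensional ℝ (vanishing W S) :=
  Submodule.finiteDimensional_of_le (vanishing_le W S)

/-- Vanishing at `m` points is at most `m` linear conditions. -/
theorem finrank_le_finrank_vanishing (W : Submodule ℝ ((Γ.Point → ℝ) × (E → ℝ → ℝ)))
    [FiniteDimensional ℝ W] (S : List Γ.Point) :
    Module.finrank ℝ W ≤ Module.finrank ℝ (vanishing W S) + S.length := by
  let φ : W →ₗ[ℝ] (Fin S.length → ℝ) :=
    { toFun := fun w i => w.1.1 (S.get i)
      map_add' := fun _ _ => rfl
      map_smul' := fun _ _ => rfl }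
  have h1 := φ.finrank_range_add_finrank_ker
  have h2 : Module.finrank ℝ (LinearMap.range φ) ≤ S.length := by
    simpa using (LinearMap.range φ).finrank_le
  have h3 : (LinearMap.ker φ).map W.subtype = vanishing W S := by
    ext w
    constructor
    · rintro ⟨v, hv, rfl⟩
      refine ⟨v.2, fun q hq => ?_⟩
      obtain ⟨i, hi⟩ := List.get_of_mem hq
      rw [← hi]
      exact congrFun (LinearMap.mem_ker.1 hv) i
    · rintro ⟨hw, h0⟩
      refine ⟨⟨w, hw⟩, LinearMap.mem_ker.2 (funext fun i => h0 _ (List.get_mem S i)), rfl⟩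
  have h4 : Module.finrank ℝ (vanishing W S) = Module.finrank ℝ (LinearMap.ker φ) := by
    rw [← h3]
    exact (Submodule.equivMapOfInjective W.subtype W.injective_subtype (LinearMap.ker φ)).finrank_eq.symm
  omega

theorem exists_ne_zero_of_length_lt (W : Submodule ℝ ((Γ.Point → ℝ) × (E → ℝ → ℝ)))
    [FiniteDimensional ℝ W] (S : List Γ.Point) (h : S.length < Module.finrank ℝ W) :
    ∃ w ∈ W, w ≠ 0 ∧ ∀ q ∈ S, w.1 q = 0 := by
  have h1 := finrank_le_finrank_vanishing W S
  have h2 : 0 < Module.finrank ℝ (vanishing W S) := by omega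
  have : Nontrivial (vanishing W S) := Module.finrank_pos_iff.1 h2
  obtain ⟨⟨w, hw⟩, hne⟩ := exists_ne (0 : vanishing W S)
  exact ⟨w, hw.1, fun h => hne (Subtype.ext h), hw.2⟩

/-- The form `∫ (v' w' - λ v w)` over the whole graph. -/
noncomputable def form [Fintype E] (lam : ℝ) (v w : (Γ.Point → ℝ) × (E → ℝ → ℝ)) : ℝ :=
  ∑ e, ∫ t in (0 : ℝ)..(Γ.len e), density lam v w e t

end MetricGraph

namespace STree

variable {E : Type*} {Γ : MetricGraph E} {ℓ : ℝ}

open MetricGraph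

/-- The form on a tree for the parameter `(π / (2 ℓ))²`, the first eigenvalue on an interval of
length `ℓ` with one Dirichlet and one Neumann endpoint. -/
noncomputable abbrev energy (T : STree E) (ℓ : ℝ) (v w : (Γ.Point → ℝ) × (E → ℝ → ℝ)) : ℝ :=
  T.form ((Real.pi / (2 * ℓ)) ^ 2) v w

theorem WF.form_add_smul (lam : ℝ) {v w : (Γ.Point → ℝ) × (E → ℝ → ℝ)} (hv : v ∈ Γ.H1)
    (hw : w ∈ Γ.H1) (t : ℝ) : ∀ {T : STree E} {p : Γ.Point}, T.WF Γ p →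
      T.form lam (v + t • w) (v + t • w) =
        T.form lam v v + 2 * t * T.form lam v w + t ^ 2 * T.form lam w w
  | nil, _, _ => by simp [form]
  | node e x y sub rest, p, h => by
    obtain ⟨-, -, hx, hy, hS, hr⟩ := h
    have hI : ∀ {v w : (Γ.Point → ℝ) × (E → ℝ → ℝ)}, v ∈ Γ.H1 → w ∈ Γ.H1 →
        IntervalIntegrable (density lam v w e) volume (min x y) (max x y) := by
      intro v w hv hw
      refine (intervalIntegrable_density lam hv hw e).mono_set ?_
      rw [uIcc_of_le min_le_max, uIcc_of_le (Γ.len_pos e).le]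
      exact Icc_subset_Icc (le_min hx.1 hy.1) (max_le hx.2 hy.2)
    have e1 : ∫ s in (min x y)..(max x y), density lam (v + t • w) (v + t • w) e s =
        (∫ s in (min x y)..(max x y), density lam v v e s) +
        2 * t * (∫ s in (min x y)..(max x y), density lam v w e s) +
        t ^ 2 * ∫ s in (min x y)..(max x y), density lam w w e s := by
      rw [← intervalIntegral.integral_const_mul, ← intervalIntegral.integral_const_mul,
        ← intervalIntegral.integral_add (hI hv hv) ((hI hv hw).const_mul _),
        ← intervalIntegral.integral_add ((hI hv hv).add ((hI hv hw).const_mul _))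
          ((hI hw hw).const_mul _)]
      refine intervalIntegral.integral_congr fun s _ => ?_
      simp only [density, Prod.fst_add, Prod.snd_add, Prod.smul_fst, Prod.smul_snd, Pi.add_apply,
        Pi.smul_apply, smul_eq_mul]
      ring
    simp only [form, hS.form_add_smul lam hv hw t, hr.form_add_smul lam hv hw t, e1]
    ring

/-- `W` is a space of functions in `H¹` on which the energy form of `T` is nonpositive, and whose
elements are determined by their values on `T`. -/
structure NegSpace (T : STree E) (ℓ : ℝ) (W : Submodule ℝ ((Γ.Point → ℝ) × (E → ℝ → ℝ))) :
    Prop where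
  le : W ≤ Γ.H1
  nonpos : ∀ w ∈ W, T.energy ℓ w w ≤ 0
  inj : ∀ w ∈ W, VanishOn w.1 T → w = 0

/-- The Cauchy-Schwarz inequality for a nonpositive form: isotropic vectors lie in the radical. -/
theorem NegSpace.energy_eq_zero {T : STree E} {W : Submodule ℝ ((Γ.Point → ℝ) × (E → ℝ → ℝ))}
    (h : T.NegSpace ℓ W) {p : Γ.Point} (hT : T.WF Γ p) {v g : (Γ.Point → ℝ) × (E → ℝ → ℝ)}
    (hv : v ∈ W) (hg : g ∈ W) (h0 : 0 ≤ T.energy ℓ v v) : T.energy ℓ v g = 0 := by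
  by_contra hne
  set a := T.energy ℓ v g with ha
  set b := T.energy ℓ g g with hb
  have hb0 : b ≤ 0 := h.nonpos g hg
  -- the form on `v + t g` is at least this quadratic polynomial, which is positive for a small `t` with
  -- the sign of `a`
  have key : ∀ t : ℝ, 2 * t * a + t ^ 2 * b ≤ 0 := by
    intro t
    have h1 := h.nonpos (v + t • g) (W.add_mem hv (W.smul_mem t hg))
    rw [energy, hT.form_add_smul _ (h.le hv) (h.le hg)] at h1
    have : T.form ((Real.pi / (2 * ℓ)) ^ 2) v v = T.energy ℓ v v := rfl
    linarith
  have h1 := key (a / (1 - b))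
  have hb1 : 0 < 1 - b := by linarith
  have h2 : 2 * (a / (1 - b)) * a + (a / (1 - b)) ^ 2 * b = a ^ 2 * (2 - b) / (1 - b) ^ 2 := by
    field_simp; ring
  rw [h2] at h1
  have h3 : 0 < a ^ 2 * (2 - b) / (1 - b) ^ 2 := by
    have : 0 < 2 - b := by linarith
    have : 0 < a ^ 2 := by positivity
    positivity
  linarith

theorem WF.energy_nonneg {T : STree E} {p : Γ.Point} (h : T.WF Γ p) (hℓ : 0 < ℓ)
    (hT : T.length ≤ ℓ) {w : (Γ.Point → ℝ) × (E → ℝ → ℝ)} (hw : w ∈ Γ.H1) (hp : w.1 p = 0) :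
    0 ≤ T.energy ℓ w w := by
  obtain ⟨S, hS, hS'⟩ := h.exists_points hℓ 0 (by simpa using hT)
  obtain rfl := List.length_eq_zero_iff.1 hS
  exact (hS' w hw hp (by simp)).1

theorem WF.vanishOn_of_lt {T : STree E} {p : Γ.Point} (h : T.WF Γ p) (hℓ : 0 < ℓ)
    (hT : T.length < ℓ) {w : (Γ.Point → ℝ) × (E → ℝ → ℝ)} (hw : w ∈ Γ.H1) (hp : w.1 p = 0)
    (hQ : T.energy ℓ w w ≤ 0) : VanishOn w.1 T := by
  obtain ⟨S, hS, hS'⟩ := h.exists_points hℓ 0 (by simpa using hT.le)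
  obtain rfl := List.length_eq_zero_iff.1 hS
  exact (hS' w hw hp (by simp)).2 (by simpa using hT) hQ

/-- On a tree of length `ℓ`, a function vanishing at the root which is orthogonal, for the energy
form, to itself and to a function not vanishing at the root, has to vanish. -/
theorem WF.vanishOn_of_energy_eq_zero {T : STree E} {p : Γ.Point} (h : T.WF Γ p) (hℓ : 0 < ℓ)
    (hT : T.length = ℓ) {w g : (Γ.Point → ℝ) × (E → ℝ → ℝ)} (hw : w ∈ Γ.H1) (hg : g ∈ Γ.H1)
    (hp : w.1 p = 0) (hQ : T.energy ℓ w w ≤ 0) (hgp : g.1 p ≠ 0) (h0 : T.energy ℓ w g = 0) :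
    VanishOn w.1 T := by
  obtain ⟨c, hc⟩ := h.exists_eq_sin hℓ hT hw hp hQ
  rw [energy, h.form_of_eq_sin hℓ hT hw hg hc] at h0
  have hpi := Real.pi_pos
  have hc0 : c = 0 := by
    rcases mul_eq_zero.1 h0 with h1 | h1
    · rw [neg_eq_zero] at h1
      rcases mul_eq_zero.1 h1 with h2 | h2
      · exact h2
      · exact absurd h2 (by positivity)
    · exact absurd h1 hgp
  refine h.vanishOn_of_tour fun s hs => ?_
  rw [T.tour_τ, hT] at hs
  rw [hc s hs, hc0, zero_mul]

/-- A branch whose length is a multiple `i ℓ` of `ℓ` with `2 ≤ i` carries no `i`-dimensional space of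
functions vanishing at the root with nonpositive energy form. For the proof a short piece at the root
is removed, so that the condition at the root is lost but the length is below `i ℓ`. -/
theorem WF.finrank_lt_of_branch {e : E} {x y : ℝ} {sub : STree E} {p : Γ.Point}
    (h : (node e x y sub nil).WF Γ p) (hℓ : 0 < ℓ) {i : ℕ} (hi : 2 ≤ i)
    (hT : (node e x y sub nil).length = i * ℓ) {W : Submodule ℝ ((Γ.Point → ℝ) × (E → ℝ → ℝ))}
    [FiniteDimensional ℝ W] (hW : (node e x y sub nil).NegSpace ℓ W) (hp : ∀ w ∈ W, w.1 p = 0) :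
    Module.finrank ℝ W < i := by
  by_contra hcon
  push Not at hcon
  have hT0 := h
  obtain ⟨rfl, hxy, hx, hy, hS, -⟩ := h
  obtain ⟨j, rfl⟩ : ∃ j, i = j + 2 := ⟨i - 2, by omega⟩
  push_cast at hT
  have n3 : 0 < |y - x| := abs_pos.2 (sub_ne_zero.2 hxy.symm)
  -- the tree is cut at `z`, close to the root, into `R`, rooted at `z`, and the piece between the root
  -- and `z`, which is called `P` when rooted at `z` and `P'` when rooted at the root
  set ε := min |y - x| ℓ / 2 with hε
  have hε0 : 0 < ε := by rw [hε]; positivity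
  have hε1 : ε < |y - x| := by rw [hε]; linarith [min_le_left |y - x| ℓ]
  have hε2 : ε < ℓ := by rw [hε]; linarith [min_le_right |y - x| ℓ]
  set r := ε / |y - x| with hr
  have hr0 : 0 < r := by positivity
  have hr1 : r < 1 := (div_lt_one n3).2 hε1
  set z := x + (y - x) * r with hz
  have hzx : |z - x| = ε := by
    have : z - x = (y - x) * r := by rw [hz]; ring
    rw [this, abs_mul, abs_of_pos hr0, hr]; field_simp
  have hzb : (x ≤ z ∧ z ≤ y) ∨ (y ≤ z ∧ z ≤ x) := by
    rcases le_total x y with hle | hle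
    · left; constructor <;> rw [hz] <;> nlinarith
    · right; constructor <;> rw [hz] <;> nlinarith
  have hzm : z ∈ Icc 0 (Γ.len e) := by
    rcases hzb with hb | hb
    · exact ⟨hx.1.trans hb.1, hb.2.trans hy.2⟩
    · exact ⟨hy.1.trans hb.1, hb.2.trans hx.2⟩
  have hzy : z ≠ y := by
    intro h'; rw [h'] at hzx; linarith
  have hxz : x ≠ z := by
    intro h'; rw [← h', sub_self, abs_zero] at hzx; linarith
  have hcut := refines_cut (Γ := Γ) hx hy hzb sub nil
  set R := node e z y sub nil with hRdef
  set P := node e z x nil nil with hPdef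
  set P' := node e x z nil nil with hP'def
  have hR : R.WF Γ (Γ.ptR e z) := ⟨rfl, hzy, hzm, hy, hS, trivial⟩
  have hP' : P'.WF Γ (Γ.ptR e x) := ⟨rfl, hxz, hx, hzm, trivial, trivial⟩
  have hP'len : P'.length = ε := by simp [hP'def, length, hzx]
  have hPlen : P.length = ε := by simp [hPdef, length, abs_sub_comm x z, hzx]
  have hPform : ∀ v w : (Γ.Point → ℝ) × (E → ℝ → ℝ), P.energy ℓ v w = P'.energy ℓ v w := by
    intro v w; simp only [hPdef, hP'def, energy, form, min_comm, max_comm]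
  have hPseg : P.segs = P'.segs := by
    simp only [hPdef, hP'def, segs, min_comm, max_comm]
  have hlenR : R.length = (j + 2) * ℓ - ε := by
    have := hcut.length_eq
    rw [length_append, hPlen, hT] at this; linarith
  have hj : (0 : ℝ) ≤ j * ℓ := by positivity
  -- `R` is longer than `ℓ` and is cut in turn
  obtain ⟨q, A, B, C, hA, hB, hC, hABC, hcase⟩ :=
    hR.exists_cut (C := nil) trivial hℓ (by rw [hlenR]; nlinarith)
  rw [append_nil] at hABC
  have hlen := hABC.length_eq
  rw [length_append, length_append, hlenR] at hlen
  have hform : ∀ v ∈ W, ∀ w ∈ W, (node e x y sub nil).energy ℓ v w =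
      A.energy ℓ v w + B.energy ℓ v w + C.energy ℓ v w + P'.energy ℓ v w := by
    intro v hv w hw
    have h1 := hcut.form_eq ((Real.pi / (2 * ℓ)) ^ 2) v (hW.le hv) w (hW.le hw)
    have h2 := hABC.form_eq ((Real.pi / (2 * ℓ)) ^ 2) v (hW.le hv) w (hW.le hw)
    rw [form_append] at h1
    rw [form_append, form_append] at h2
    have h3 := hPform v w
    simp only [energy] at h3 ⊢
    linarith
  have hvan : ∀ w ∈ W, VanishOn w.1 A → VanishOn w.1 B → VanishOn w.1 C → VanishOn w.1 P' →
      w = 0 := by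
    intro w hw h1 h2 h3 h4
    refine hW.inj w hw (hcut.vanishOn ((hABC.vanishOn (h1.append (h2.append h3))).append ?_))
    intro s hs
    rw [hPseg] at hs
    exact h4 s hs
  have hP0 : ∀ w ∈ W, 0 ≤ P'.energy ℓ w w := fun w hw =>
    hP'.energy_nonneg hℓ (by rw [hP'len]; exact hε2.le) (hW.le hw) (hp w hw)
  have hPv : ∀ w ∈ W, P'.energy ℓ w w ≤ 0 → VanishOn w.1 P' := fun w hw =>
    hP'.vanishOn_of_lt hℓ (by rw [hP'len]; exact hε2) (hW.le hw) (hp w hw)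
  have hCle : C.length < (j + 1) * ℓ := by
    rcases hcase with ⟨h1, rfl⟩ | ⟨-, -, h1⟩
    · simp only [length] at hlen; linarith
    · linarith
  obtain ⟨S, hSlen, hSC⟩ := hC.exists_points hℓ j hCle.le
  rcases hcase with ⟨hAl, rfl⟩ | ⟨hAl, hBl, -⟩
  · by_cases hq : ∀ w ∈ W, w.1 q = 0
    · -- no condition is needed at `q`, which leaves one more for a point of `A`
      obtain ⟨S', hSlen', hSA⟩ := hA.exists_points hℓ 1 (by push_cast; linarith)
      obtain ⟨w, hw, hne, hz⟩ := exists_ne_zero_of_length_lt W (S ++ S')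
        (by rw [List.length_append]; omega)
      have a1 := hSA w (hW.le hw) (hq w hw) fun q hq => hz q (List.mem_append_right _ hq)
      have a2 := hSC w (hW.le hw) (hq w hw) fun q hq => hz q (List.mem_append_left _ hq)
      have a3 := hP0 w hw
      have a4 := hW.nonpos w hw
      rw [hform w hw w hw] at a4
      have a5 : (nil : STree E).energy ℓ w w = 0 := rfl
      rw [a5] at a4
      exact hne (hvan w hw (a1.2 (by push_cast; linarith) (by linarith [a2.1]))
        (fun s hs => absurd hs (notMem_empty s))
        (a2.2 hCle (by linarith [a1.1])) (hPv w hw (by linarith [a1.1, a2.1])))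
    · push Not at hq
      obtain ⟨g, hg, hgq⟩ := hq
      -- some `w` vanishes on `C` and `P'` and is isotropic, hence orthogonal to `g`
      obtain ⟨w, hw, hne, hz⟩ := exists_ne_zero_of_length_lt W (q :: S)
        (by rw [List.length_cons]; omega)
      have hwq := hz q List.mem_cons_self
      have a1 := hA.energy_nonneg hℓ hAl.le (hW.le hw) hwq
      have a2 := hSC w (hW.le hw) hwq fun q hq => hz q (List.mem_cons_of_mem _ hq)
      have a3 := hP0 w hw
      have a4 := hW.nonpos w hw
      rw [hform w hw w hw] at a4
      have a5 : (nil : STree E).energy ℓ w w = 0 := rfl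
      rw [a5] at a4
      have b1 := a2.2 hCle (by linarith)
      have b2 := hPv w hw (by linarith [a2.1])
      have a6 := hW.energy_eq_zero hT0 hw hg (by
        rw [hform w hw w hw, a5]; linarith [a2.1])
      have a7 : (nil : STree E).energy ℓ w g = 0 := rfl
      have a8 : C.energy ℓ w g = 0 := form_eq_zero_of_vanishOn (hW.le hw) hC b1
      have a9 : P'.energy ℓ w g = 0 := form_eq_zero_of_vanishOn (hW.le hw) hP' b2
      rw [hform w hw g hg, a7, a8, a9, add_zero, add_zero, add_zero] at a6
      exact hne (hvan w hw (hA.vanishOn_of_energy_eq_zero hℓ hAl (hW.le hw) (hW.le hg) hwq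
        (by linarith [a2.1]) hgq a6) (fun s hs => absurd hs (notMem_empty s)) b1 b2)
  · -- all parts are strictly shorter than their critical lengths
    obtain ⟨w, hw, hne, hz⟩ := exists_ne_zero_of_length_lt W (q :: S)
      (by rw [List.length_cons]; omega)
    have hwq := hz q List.mem_cons_self
    have a1 := hA.energy_nonneg hℓ hAl.le (hW.le hw) hwq
    have a1' := hB.energy_nonneg hℓ hBl.le (hW.le hw) hwq
    have a2 := hSC w (hW.le hw) hwq fun q hq => hz q (List.mem_cons_of_mem _ hq)
    have a3 := hP0 w hw
    have a4 := hW.nonpos w hw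
    rw [hform w hw w hw] at a4
    exact hne (hvan w hw (hA.vanishOn_of_lt hℓ hAl (hW.le hw) hwq (by linarith [a2.1]))
      (hB.vanishOn_of_lt hℓ hBl (hW.le hw) hwq (by linarith [a2.1]))
      (a2.2 hCle (by linarith)) (hPv w hw (by linarith [a2.1])))

/-- The tree is a union of paths of length `ℓ` which start at the root. -/
def StarLike (ℓ : ℝ) : STree E → Prop
  | nil => True
  | node _ x y sub rest => |y - x| + sub.length = ℓ ∧ sub.IsPath ∧ rest.StarLike ℓ

/-- A tree which carries the maximal possible number, its length divided by `ℓ`, of linearly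
independent functions vanishing at the root with nonpositive energy form is a union of paths of
length `ℓ`. -/
theorem WF.starLike (hℓ : 0 < ℓ) : ∀ {T : STree E} {p : Γ.Point}, T.WF Γ p →
    ∀ {W : Submodule ℝ ((Γ.Point → ℝ) × (E → ℝ → ℝ))} [FiniteDimensional ℝ W],
      T.NegSpace ℓ W → (∀ w ∈ W, w.1 p = 0) → T.length ≤ Module.finrank ℝ W * ℓ → T.StarLike ℓ
  | nil, _, _, _, _, _, _, _ => trivial
  | node e x y sub rest, p, h, W, hfin, hW, hp, hT => by
    have hB : (node e x y sub nil).WF Γ p := ⟨h.1, h.2.1, h.2.2.1, h.2.2.2.1, h.2.2.2.2.1, trivial⟩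
    have hr : rest.WF Γ p := h.2.2.2.2.2
    have n3 : 0 < |y - x| := abs_pos.2 (sub_ne_zero.2 h.2.1.symm)
    set B := node e x y sub nil with hBdef
    have hTB : node e x y sub rest = B.append rest := rfl
    have hBlen : B.length = |y - x| + sub.length := by simp [hBdef, length]
    have hBpos : 0 < B.length := by rw [hBlen]; linarith [sub.length_nonneg]
    rw [hTB] at hW hT
    rw [length_append] at hT
    have hform : ∀ w : (Γ.Point → ℝ) × (E → ℝ → ℝ),
        (B.append rest).energy ℓ w w = B.energy ℓ w w + rest.energy ℓ w w :=
      fun w => form_append _ w w B rest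
    -- counting zeros, the dimension is at most the sum of the integral parts of the lengths of the first
    -- branch `B` and of `rest`, in units of `ℓ`; as it is at least the sum of these lengths,
    -- both are integral
    set i := ⌊B.length / ℓ⌋₊ with hi
    set j := ⌊rest.length / ℓ⌋₊ with hj
    have hi1 : B.length < (i + 1) * ℓ := (div_lt_iff₀ hℓ).1 (Nat.lt_floor_add_one _)
    have hj1 : rest.length < (j + 1) * ℓ := (div_lt_iff₀ hℓ).1 (Nat.lt_floor_add_one _)
    have hi2 : i * ℓ ≤ B.length :=
      (le_div_iff₀ hℓ).1 (Nat.floor_le (div_nonneg B.length_nonneg hℓ.le))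
    have hj2 : j * ℓ ≤ rest.length :=
      (le_div_iff₀ hℓ).1 (Nat.floor_le (div_nonneg rest.length_nonneg hℓ.le))
    obtain ⟨S, hS, hSB⟩ := hB.exists_points hℓ i hi1.le
    obtain ⟨S', hS', hSr⟩ := hr.exists_points hℓ j hj1.le
    have hle : Module.finrank ℝ W ≤ i + j := by
      by_contra hcon
      obtain ⟨w, hw, hne, hz⟩ := exists_ne_zero_of_length_lt W (S ++ S')
        (by rw [List.length_append]; omega)
      have a1 := hSB w (hW.le hw) (hp w hw) fun q hq => hz q (List.mem_append_left _ hq)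
      have a2 := hSr w (hW.le hw) (hp w hw) fun q hq => hz q (List.mem_append_right _ hq)
      have a3 := hW.nonpos w hw
      rw [hform w] at a3
      exact hne (hW.inj w hw ((a1.2 hi1 (by linarith [a2.1])).append
        (a2.2 hj1 (by linarith [a1.1]))))
    have hle' : (Module.finrank ℝ W : ℝ) * ℓ ≤ (i + j) * ℓ :=
      mul_le_mul_of_nonneg_right (by exact_mod_cast hle) hℓ.le
    have hBi : B.length = i * ℓ := by linarith
    have hrj : rest.length = j * ℓ := by linarith
    have hij : i + j ≤ Module.finrank ℝ W := by
      have : ((i + j : ℕ) : ℝ) * ℓ ≤ (Module.finrank ℝ W : ℝ) * ℓ := by push_cast; linarith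
      exact_mod_cast le_of_mul_le_mul_right this hℓ
    -- functions vanishing at the points in one part have nonpositive energy form on the other part
    have hWr : rest.NegSpace ℓ (vanishing W S) := by
      refine ⟨fun w hw => hW.le hw.1, fun w hw => ?_, fun w hw hv => hW.inj w hw.1 ?_⟩
      · have a1 := hSB w (hW.le hw.1) (hp w hw.1) hw.2
        have a3 := hW.nonpos w hw.1
        rw [hform w] at a3
        linarith [a1.1]
      · have a1 := hSB w (hW.le hw.1) (hp w hw.1) hw.2
        have a3 := hW.nonpos w hw.1
        have a4 : rest.energy ℓ w w = 0 := form_eq_zero_of_vanishOn (hW.le hw.1) hr hv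
        rw [hform w] at a3
        exact (a1.2 hi1 (by linarith)).append hv
    have hWB : B.NegSpace ℓ (vanishing W S') := by
      refine ⟨fun w hw => hW.le hw.1, fun w hw => ?_, fun w hw hv => hW.inj w hw.1 ?_⟩
      · have a1 := hSr w (hW.le hw.1) (hp w hw.1) hw.2
        have a3 := hW.nonpos w hw.1
        rw [hform w] at a3
        linarith [a1.1]
      · have a1 := hSr w (hW.le hw.1) (hp w hw.1) hw.2
        have a3 := hW.nonpos w hw.1
        have a4 : B.energy ℓ w w = 0 := form_eq_zero_of_vanishOn (hW.le hw.1) hB hv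
        rw [hform w] at a3
        exact hv.append (a1.2 hj1 (by linarith))
    have d1 := finrank_le_finrank_vanishing W S
    have d2 := finrank_le_finrank_vanishing W S'
    have hrest : rest.StarLike ℓ := by
      refine hr.starLike hℓ hWr (fun w hw => hp w hw.1) ?_
      rw [hrj]
      exact mul_le_mul_of_nonneg_right (by exact_mod_cast (by omega)) hℓ.le
    -- since `B` is a single branch, its length is `ℓ`, and a function which lives on `B` is a sine
    have hi0 : i ≠ 0 := by
      intro h0; rw [h0] at hBi; simp at hBi; linarith
    have hi2 : ¬ 2 ≤ i := fun h2 => by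
      have := hB.finrank_lt_of_branch hℓ h2 hBi hWB fun w hw => hp w hw.1
      omega
    have hi3 : i = 1 := by omega
    rw [hi3, Nat.cast_one, one_mul] at hBi
    refine ⟨hBlen ▸ hBi, ?_, hrest⟩
    obtain ⟨w, hw, hne, -⟩ := exists_ne_zero_of_length_lt (vanishing W S') [] (by simp; omega)
    obtain ⟨c, hc⟩ := hB.exists_eq_sin hℓ hBi (hWB.le hw) (hp w hw.1) (hWB.nonpos w hw)
    have hc0 : c ≠ 0 := by
      rintro rfl
      refine hne (hWB.inj w hw (hB.vanishOn_of_tour fun s hs => ?_))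
      rw [B.tour_τ, hBi] at hs
      rw [hc s hs, zero_mul]
    exact (hB.isPath_of_eq_sin hℓ hc0 le_rfl (by rw [zero_add, hBi]) (by
      rw [hBi]; simpa using hc)).2

theorem StarLike.append : ∀ {A B : STree E}, A.StarLike ℓ → B.StarLike ℓ → (A.append B).StarLike ℓ
  | nil, _, _, hB => hB
  | node _ _ _ _ _, _, hA, hB => ⟨hA.1, hA.2.1, hA.2.2.append hB⟩

/-- On a star with legs of length `ℓ` the energy is nonnegative if there is a zero at the centre. -/
theorem StarLike.energy_nonneg (hℓ : 0 < ℓ) {w : (Γ.Point → ℝ) × (E → ℝ → ℝ)} (hw : w ∈ Γ.H1) :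
    ∀ {T : STree E} {p : Γ.Point}, T.WF Γ p → w.1 p = 0 → T.StarLike ℓ → 0 ≤ T.energy ℓ w w
  | nil, _, _, _, _ => le_rfl
  | node e x y sub rest, p, h, hp, hS => by
    have hB : (node e x y sub nil).WF Γ p := ⟨h.1, h.2.1, h.2.2.1, h.2.2.2.1, h.2.2.2.2.1, trivial⟩
    have h1 := hB.energy_nonneg hℓ (by simp [length, hS.1]) hw hp
    have h2 := hS.2.2.energy_nonneg hℓ hw h.2.2.2.2.2 hp
    have h3 := form_append ((Real.pi / (2 * ℓ)) ^ 2) w w (node e x y sub nil) rest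
    have h4 : (node e x y sub nil).append rest = node e x y sub rest := rfl
    rw [h4] at h3
    rw [energy, h3]
    exact add_nonneg h1 h2

end STree

namespace STree

variable {E : Type*} {Γ : MetricGraph E} {ℓ : ℝ}

open MetricGraph

/-! ### Zeros at `k - 1` points and the extremal case -/

/-- On a connected graph of total length `k ℓ` there are `k - 1` points such that the energy form is
nonnegative on the functions vanishing at these points. The first of them cuts off parts of a spanning
tree of length at most `ℓ` which together are at least that long; the other `k - 2` lie on the
remainder. -/
theorem _root_.MetricGraph.exists_points [Fintype E] [Nonempty E] (hconn : Γ.IsConnected)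
    (hℓ : 0 < ℓ) {k : ℕ} (hk : 2 ≤ k) (hlen : Γ.totalLength = k * ℓ) :
    ∃ S : List Γ.Point, S.length = k - 1 ∧ ∀ w ∈ Γ.H1, (∀ q ∈ S, w.1 q = 0) →
      0 ≤ Γ.form ((Real.pi / (2 * ℓ)) ^ 2) w w := by
  obtain ⟨T, p, hT, hTlen, hTform, -⟩ := exists_spanning hconn
  have hk' : (2 : ℝ) ≤ k := by exact_mod_cast hk
  obtain ⟨q, A, B, C, hA, hB, hC, href, hcase⟩ := hT.exists_cut (C := nil) trivial hℓ
    (by rw [hTlen, hlen]; nlinarith)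
  have hl := href.length_eq
  rw [append_nil, length_append, length_append, hTlen, hlen] at hl
  have hAB : A.length ≤ ℓ ∧ B.length ≤ ℓ ∧ ℓ ≤ A.length + B.length := by
    rcases hcase with ⟨h1, rfl⟩ | h
    · simp [length, h1, hℓ.le]
    · exact ⟨h.1.le, h.2.1.le, h.2.2⟩
  obtain ⟨S, hS, hS'⟩ := hC.exists_points hℓ (k - 2) (by
    rw [Nat.cast_sub hk]; push_cast; linarith [hAB.2.2])
  refine ⟨q :: S, by simp [hS]; omega, fun w hw h0 => ?_⟩
  have hq : w.1 q = 0 := h0 q (by simp)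
  have h1 := hA.energy_nonneg hℓ hAB.1 hw hq
  have h2 := hB.energy_nonneg hℓ hAB.2.1 hw hq
  have h3 := (hS' w hw hq fun q' hq' => h0 q' (by simp [hq'])).1
  have h4 := href.form_eq ((Real.pi / (2 * ℓ)) ^ 2) w hw w hw
  rw [append_nil, form_append, form_append, hTform] at h4
  rw [MetricGraph.form, ← h4]
  exact add_nonneg h1 (add_nonneg h2 h3)

theorem NegSpace.of_refines {R T : STree E} {V : Submodule ℝ ((Γ.Point → ℝ) × (E → ℝ → ℝ))}
    (h : T.NegSpace ℓ V) (href : R.Refines Γ T) : R.NegSpace ℓ V :=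
  ⟨h.le, fun w hw => (href.form_eq _ w (h.le hw) w (h.le hw)).trans_le (h.nonpos w hw),
    fun w hw h0 => h.inj w hw (href.vanishOn h0)⟩

/-- A tree of length `k ℓ` which carries a `k`-dimensional space of functions, without common zeros,
on which the energy form is nonpositive can be rearranged into a star with legs of length `ℓ`. -/
theorem WF.exists_starLike {T : STree E} {p : Γ.Point} (hT : T.WF Γ p) (hℓ : 0 < ℓ) {k : ℕ}
    (hk : 2 ≤ k) (hlen : T.length = k * ℓ) {V : Submodule ℝ ((Γ.Point → ℝ) × (E → ℝ → ℝ))}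
    [FiniteDimensional ℝ V] (hV : T.NegSpace ℓ V) (hdim : k ≤ Module.finrank ℝ V)
    (hne : ∀ q, ∃ g ∈ V, g.1 q ≠ 0) :
    ∃ (q : Γ.Point) (R : STree E), R.WF Γ q ∧ R.Refines Γ T ∧ R.StarLike ℓ := by
  have hk' : (2 : ℝ) ≤ k := by exact_mod_cast hk
  obtain ⟨q, A, B, C, hA, hB, hC, href, hcase⟩ := hT.exists_cut (C := nil) trivial hℓ
    (by rw [hlen]; nlinarith)
  rw [append_nil] at href
  have hl := href.length_eq
  rw [length_append, length_append, hlen] at hl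
  have hAB : A.length ≤ ℓ ∧ B.length ≤ ℓ ∧ ℓ ≤ A.length + B.length := by
    rcases hcase with ⟨h1, rfl⟩ | h
    · simp [length, h1, hℓ.le]
    · exact ⟨h.1.le, h.2.1.le, h.2.2⟩
  obtain ⟨g, hg, hgq⟩ := hne q
  set R := A.append (B.append C) with hR
  have hRW : R.WF Γ q := hA.append (hB.append hC)
  have hRV : R.NegSpace ℓ V := hV.of_refines href
  have hRform : ∀ v w : (Γ.Point → ℝ) × (E → ℝ → ℝ),
      R.energy ℓ v w = A.energy ℓ v w + (B.energy ℓ v w + C.energy ℓ v w) := by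
    intro v w
    rw [hR, energy, form_append, form_append]
  have hfin := finrank_le_finrank_vanishing V [q]
  rw [List.length_singleton] at hfin
  have hq0 : ∀ w ∈ vanishing V [q], w.1 q = 0 := fun w hw => hw.2 q (by simp)
  have hA0 : ∀ w ∈ vanishing V [q], 0 ≤ A.energy ℓ w w := fun w hw =>
    hA.energy_nonneg hℓ hAB.1 (hV.le hw.1) (hq0 w hw)
  have hB0 : ∀ w ∈ vanishing V [q], 0 ≤ B.energy ℓ w w := fun w hw =>
    hB.energy_nonneg hℓ hAB.2.1 (hV.le hw.1) (hq0 w hw)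
  have hRneg : ∀ w ∈ vanishing V [q],
      A.energy ℓ w w + (B.energy ℓ w w + C.energy ℓ w w) ≤ 0 := fun w hw =>
    hRform w w ▸ hRV.nonpos w hw.1
  have hinj : ∀ w ∈ vanishing V [q], VanishOn w.1 A → VanishOn w.1 B → VanishOn w.1 C → w = 0 :=
    fun w hw h1 h2 h3 => hRV.inj w hw.1 (h1.append (h2.append h3))
  -- functions vanishing at the cut are determined by their values on `C`
  have hCneg : C.NegSpace ℓ (vanishing V [q]) := by
    refine ⟨fun w hw => hV.le hw.1, fun w hw => by linarith [hA0 w hw, hB0 w hw, hRneg w hw],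
      fun w hw hwC => ?_⟩
    have c1 : C.energy ℓ w w = 0 := form_eq_zero_of_vanishOn (hV.le hw.1) hC hwC
    have hA1 : A.energy ℓ w w ≤ 0 := by linarith [hB0 w hw, hRneg w hw]
    have hB1 : B.energy ℓ w w ≤ 0 := by linarith [hA0 w hw, hRneg w hw]
    rcases hcase with ⟨h1, rfl⟩ | ⟨h1, h2, -⟩
    · refine hinj w hw ?_ (fun s hs => absurd hs (notMem_empty s)) hwC
      refine hA.vanishOn_of_energy_eq_zero hℓ h1 (hV.le hw.1) (hV.le hg) (hq0 w hw) hA1 hgq ?_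
      have h2 := hRV.energy_eq_zero hRW hw.1 hg (by
        rw [hRform, c1]; linarith [hA0 w hw, hB0 w hw])
      have c2 : C.energy ℓ w g = 0 := form_eq_zero_of_vanishOn (hV.le hw.1) hC hwC
      have c3 : (nil : STree E).energy ℓ w g = 0 := rfl
      rw [hRform, c2, c3] at h2
      linarith
    · exact hinj w hw (hA.vanishOn_of_lt hℓ h1 (hV.le hw.1) (hq0 w hw) hA1)
        (hB.vanishOn_of_lt hℓ h2 (hV.le hw.1) (hq0 w hw) hB1) hwC
  have hCstar : C.StarLike ℓ := by
    refine hC.starLike hℓ hCneg hq0 ?_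
    have h1 : ((k - 1 : ℕ) : ℝ) ≤ Module.finrank ℝ (vanishing V [q]) := by
      exact_mod_cast (by omega)
    rw [Nat.cast_sub (by omega)] at h1
    push_cast at h1
    nlinarith
  have hC0 : ∀ w ∈ vanishing V [q], 0 ≤ C.energy ℓ w w := fun w hw =>
    hCstar.energy_nonneg hℓ (hV.le hw.1) hC (hq0 w hw)
  -- Some function vanishing at the cut is nontrivial on the part which has been cut off. Otherwise some
  -- function would live on a single leg of `C`, where it cannot be orthogonal to `g`.
  have hfree : ∃ w ∈ vanishing V [q], ¬(VanishOn w.1 A ∧ VanishOn w.1 B) := by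
    by_contra hcon
    push Not at hcon
    cases C with
    | nil =>
      obtain ⟨w, hw, hw0, -⟩ := exists_ne_zero_of_length_lt (vanishing V [q]) [] (by simp; omega)
      obtain ⟨h1, h2⟩ := hcon w hw
      exact hw0 (hinj w hw h1 h2 fun s hs => absurd hs (notMem_empty s))
    | node e x y sub rest =>
      have hleg : (node e x y sub nil).WF Γ q :=
        ⟨hC.1, hC.2.1, hC.2.2.1, hC.2.2.2.1, hC.2.2.2.2.1, trivial⟩
      have hleglen : (node e x y sub nil).length = ℓ := by simp [length, hCstar.1]
      have hrest := hC.2.2.2.2.2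
      have happ : (node e x y sub nil).append rest = node e x y sub rest := rfl
      have hlen2 : (node e x y sub rest).length = ℓ + rest.length := by
        rw [← happ, length_append, hleglen]
      have hform2 : ∀ v w : (Γ.Point → ℝ) × (E → ℝ → ℝ), (node e x y sub rest).energy ℓ v w =
          (node e x y sub nil).energy ℓ v w + rest.energy ℓ v w := by
        intro v w
        rw [← happ, energy, form_append]
      have hrl : rest.length < ((k - 2 : ℕ) + 1) * ℓ := by
        rw [Nat.cast_sub hk]; push_cast; linarith [hAB.2.2]
      obtain ⟨S, hS, hS'⟩ := hrest.exists_points hℓ (k - 2) hrl.le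
      obtain ⟨w, hw, hw0, hwS⟩ := exists_ne_zero_of_length_lt (vanishing V [q]) S (by omega)
      obtain ⟨h1, h2⟩ := hcon w hw
      have a1 : A.energy ℓ w w = 0 := form_eq_zero_of_vanishOn (hV.le hw.1) hA h1
      have a2 : B.energy ℓ w w = 0 := form_eq_zero_of_vanishOn (hV.le hw.1) hB h2
      have a3 := hCneg.nonpos w hw
      rw [hform2] at a3
      have a4 := hleg.energy_nonneg hℓ hleglen.le (hV.le hw.1) (hq0 w hw)
      have a5 := hS' w (hV.le hw.1) (hq0 w hw) hwS
      have hvr : VanishOn w.1 rest := a5.2 hrl (by linarith)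
      have h3 := hRV.energy_eq_zero hRW hw.1 hg (by
        rw [hRform]; linarith [hA0 w hw, hB0 w hw, hC0 w hw])
      have b1 : A.energy ℓ w g = 0 := form_eq_zero_of_vanishOn (hV.le hw.1) hA h1
      have b2 : B.energy ℓ w g = 0 := form_eq_zero_of_vanishOn (hV.le hw.1) hB h2
      have b3 : rest.energy ℓ w g = 0 := form_eq_zero_of_vanishOn (hV.le hw.1) hrest hvr
      rw [hRform, b1, b2, hform2, b3] at h3
      have hvl := hleg.vanishOn_of_energy_eq_zero hℓ hleglen (hV.le hw.1) (hV.le hg) (hq0 w hw)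
        (by linarith [a5.1]) hgq (by linarith)
      exact hw0 (hinj w hw h1 h2 (happ ▸ hvl.append hvr))
  obtain ⟨w, hw, hwAB⟩ := hfree
  have e1 := hA0 w hw
  have e2 := hB0 w hw
  have e3 := hC0 w hw
  have e4 := hRneg w hw
  -- on parts shorter than `ℓ` this function would vanish, and on a part of length `ℓ` it is a sine
  rcases hcase with ⟨h1, rfl⟩ | ⟨h1, h2, -⟩
  · refine ⟨q, R, hRW, href, ?_⟩
    have hwA : ¬VanishOn w.1 A := fun h => hwAB ⟨h, fun s hs => absurd hs (notMem_empty s)⟩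
    obtain ⟨c, hc⟩ := hA.exists_eq_sin hℓ h1 (hV.le hw.1) (hq0 w hw) (by linarith)
    have hc0 : c ≠ 0 := by
      rintro rfl
      refine hwA (hA.vanishOn_of_tour fun s hs => ?_)
      rw [A.tour_τ, h1] at hs
      rw [hc s hs, zero_mul]
    have hpath := hA.isPath_of_eq_sin hℓ hc0 le_rfl (by rw [zero_add, h1]) (by
      rw [h1]; simpa using hc)
    have hAstar : A.StarLike ℓ := by
      cases A with
      | nil => trivial
      | node e x y sub rest =>
        obtain ⟨rfl, hs⟩ := hpath
        exact ⟨by simpa [length] using h1, hs, trivial⟩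
    exact hAstar.append hCstar
  · exact absurd ⟨hA.vanishOn_of_lt hℓ h1 (hV.le hw.1) (hq0 w hw) (by linarith),
      hB.vanishOn_of_lt hℓ h2 (hV.le hw.1) (hq0 w hw) (by linarith)⟩ hwAB

/-- The legs of a star. -/
theorem StarLike.exists_legs : ∀ {R : STree E} {q : Γ.Point}, R.WF Γ q → R.StarLike ℓ →
    ∃ (k : ℕ) (B : Fin k → STree E), R.length = k * ℓ ∧
      (∀ i, (B i).WF Γ q ∧ (B i).length = ℓ ∧ (B i).IsPath) ∧
      (∀ (lam : ℝ) (v w : (Γ.Point → ℝ) × (E → ℝ → ℝ)),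
        R.form lam v w = ∑ i, (B i).form lam v w) ∧
      ∀ s ∈ R.segs, ∃ i, s ∈ (B i).segs
  | nil, q, _, _ => ⟨0, Fin.elim0, by simp [length], fun i => i.elim0, by simp [form],
      fun s hs => absurd hs (notMem_empty s)⟩
  | node e x y sub rest, q, h, hS => by
    obtain ⟨k, B, h1, h2, h3, h4⟩ := hS.2.2.exists_legs h.2.2.2.2.2
    refine ⟨k + 1, Fin.cons (node e x y sub nil) B, ?_, ?_, ?_, ?_⟩
    · simp only [length, h1, hS.1]; push_cast; ring
    · intro i
      induction i using Fin.cases with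
      | zero =>
        exact ⟨⟨h.1, h.2.1, h.2.2.1, h.2.2.2.1, h.2.2.2.2.1, trivial⟩, by simp [length, hS.1],
          rfl, hS.2.1⟩
      | succ i => exact h2 i
    · intro lam v w
      simp [Fin.sum_univ_succ, form, h3]
    · intro s hs
      rcases hs with hs | hs | hs
      · exact ⟨0, Or.inl hs⟩
      · exact ⟨0, Or.inr (Or.inl hs)⟩
      · obtain ⟨i, hi⟩ := h4 s hs
        exact ⟨i.succ, hi⟩

/-- Every segment of a path is traversed, at unit speed, on the way from the root to the end. -/
theorem WF.exists_pos_of_mem_segs : ∀ {T : STree E} {p : Γ.Point}, T.WF Γ p → T.IsPath →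
    ∀ s ∈ T.segs, ∃ u : ℝ → ℝ, (∀ t t', |u t - u t'| = |t - t'|) ∧
      ∀ t ∈ Icc s.2.1 s.2.2, u t ∈ Icc 0 T.length ∧ (T.tour Γ p).pos (u t) = Γ.ptR s.1 t
  | nil, _, _, _, s, hs => absurd hs (notMem_empty s)
  | node e x y sub rest, p, h, hP, s, hs => by
    have hWF := h
    obtain ⟨rfl, -, hx, hy, hS, hr⟩ := h
    obtain ⟨rfl, hP⟩ := hP
    have n1 := sub.length_nonneg
    have n3 := abs_nonneg (y - x)
    simp only [segs, union_empty] at hs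
    rcases hs with rfl | hs
    · rcases le_or_gt x y with hxy | hxy
      · refine ⟨fun t => t - x, fun t t' => by rw [sub_sub_sub_cancel_right], fun t ht => ?_⟩
        rw [min_eq_left hxy, max_eq_right hxy] at ht
        have h1 : t - x ≤ |y - x| := by rw [abs_of_nonneg (by linarith)]; linarith [ht.2]
        refine ⟨⟨by linarith [ht.1], by simp only [length]; linarith⟩, ?_⟩
        rw [tour, Curve.append_pos_left _ _ h1]
        simp [Curve.seg, if_pos hxy]
      · refine ⟨fun t => x - t, fun t t' => by rw [sub_sub_sub_cancel_left, abs_sub_comm],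
          fun t ht => ?_⟩
        rw [min_eq_right hxy.le, max_eq_left hxy.le] at ht
        have h1 : x - t ≤ |y - x| := by rw [abs_of_nonpos (by linarith)]; linarith [ht.1]
        refine ⟨⟨by linarith [ht.2], by simp only [length]; linarith⟩, ?_⟩
        rw [tour, Curve.append_pos_left _ _ h1]
        simp [Curve.seg, if_neg (not_le.2 hxy)]
    · obtain ⟨u, hu, hu'⟩ := hS.exists_pos_of_mem_segs hP s hs
      refine ⟨fun t => |y - x| + u t, fun t t' => by rw [add_sub_add_left_eq_sub, hu],
        fun t ht => ?_⟩
      obtain ⟨h1, h2⟩ := hu' t ht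
      refine ⟨⟨by linarith [h1.1], by simp only [length]; linarith [h1.2]⟩, ?_⟩
      rw [hWF.tour_pos_sub h1.1 (by linarith [h1.2]), h2]

/-- In the extremal case, for any two legs of the star there is a function which is a sine on one
of them, the opposite sine on the other, and zero on the remaining legs. Hence different legs only meet
at the centre, and no leg meets itself. The function is found by requiring zeros at the centre and at the
tips of the remaining legs; orthogonality to a function not vanishing at the centre says that the
amplitudes have sum zero. -/
theorem legs_injective {R : STree E} {q : Γ.Point} (hR : R.WF Γ q) (hℓ : 0 < ℓ) {k : ℕ} (hk : 2 ≤ k)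
    {V : Submodule ℝ ((Γ.Point → ℝ) × (E → ℝ → ℝ))} [FiniteDimensional ℝ V]
    (hV : R.NegSpace ℓ V) (hdim : k ≤ Module.finrank ℝ V) (hne : ∃ g ∈ V, g.1 q ≠ 0)
    {B : Fin k → STree E} (hB : ∀ i, (B i).WF Γ q ∧ (B i).length = ℓ)
    (hform : ∀ (lam : ℝ) (v w : (Γ.Point → ℝ) × (E → ℝ → ℝ)),
      R.form lam v w = ∑ i, (B i).form lam v w)
    (hsegs : ∀ s ∈ R.segs, ∃ i, s ∈ (B i).segs)
    {i j : Fin k} {s t : ℝ} (hs : s ∈ Icc 0 ℓ) (ht : t ∈ Icc 0 ℓ)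
    (hst : ((B i).tour Γ q).pos s = ((B j).tour Γ q).pos t) : (i = j ∧ s = t) ∨ (s = 0 ∧ t = 0) := by
  have hpi := Real.pi_pos
  set om := Real.pi / (2 * ℓ) with hom
  have hom0 : 0 < om := by positivity
  have homl : om * ℓ = Real.pi / 2 := by rw [hom]; field_simp
  have key : ∀ i j : Fin k, i ≠ j → ∃ (f : Γ.Point → ℝ) (c : ℝ), c ≠ 0 ∧
      (∀ s ∈ Icc 0 ℓ, f (((B i).tour Γ q).pos s) = c * Real.sin (om * s)) ∧
      ∀ s ∈ Icc 0 ℓ, f (((B j).tour Γ q).pos s) = -c * Real.sin (om * s) := by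
    intro i j hij
    classical
    set S : List Γ.Point := q :: (((Finset.univ.erase i).erase j).toList.map
      fun l => ((B l).tour Γ q).pos ℓ) with hS
    have hcard : S.length = k - 1 := by
      rw [hS, List.length_cons, List.length_map, Finset.length_toList,
        Finset.card_erase_of_mem (by simp [hij.symm]), Finset.card_erase_of_mem (Finset.mem_univ i),
        Finset.card_univ, Fintype.card_fin]
      omega
    obtain ⟨w, hw, hw0, hwS⟩ := exists_ne_zero_of_length_lt V S (by omega)
    have hwq : w.1 q = 0 := hwS q (by simp [hS])
    have e1 : ∀ l, 0 ≤ (B l).energy ℓ w w := fun l =>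
      (hB l).1.energy_nonneg hℓ (hB l).2.le (hV.le hw) hwq
    have e2 : ∑ l, (B l).energy ℓ w w ≤ 0 := by
      have := hV.nonpos w hw
      rwa [energy, hform] at this
    have e3 : ∀ l, (B l).energy ℓ w w = 0 := fun l =>
      (Finset.sum_eq_zero_iff_of_nonneg fun l _ => e1 l).1
        (le_antisymm e2 (Finset.sum_nonneg fun l _ => e1 l)) l (Finset.mem_univ l)
    choose c hc using fun l => (hB l).1.exists_eq_sin hℓ (hB l).2 (hV.le hw) hwq (e3 l).le
    have hc0 : ∀ l, l ≠ i → l ≠ j → c l = 0 := by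
      intro l hli hlj
      have h1 := hwS (((B l).tour Γ q).pos ℓ) (by
        rw [hS]; refine List.mem_cons_of_mem _ (List.mem_map.2 ⟨l, ?_, rfl⟩)
        simp [hli, hlj])
      rw [hc l ℓ ⟨hℓ.le, by linarith⟩, ← hom, homl, Real.sin_pi_div_two, mul_one] at h1
      exact h1
    obtain ⟨g, hg, hgq⟩ := hne
    have hsum : c i + c j = 0 := by
      have h1 := hV.energy_eq_zero hR hw hg (by
        rw [energy, hform]; exact Finset.sum_nonneg fun l _ => e1 l)
      rw [energy, hform, Finset.sum_congr rfl fun l _ =>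
        (hB l).1.form_of_eq_sin hℓ (hB l).2 (hV.le hw) (hV.le hg) (hc l), ← Finset.sum_mul,
        Finset.sum_neg_distrib, ← Finset.sum_mul, ← hom] at h1
      have h2 : ∑ l, c l = 0 := by
        rcases mul_eq_zero.1 h1 with h | h
        · rcases mul_eq_zero.1 (neg_eq_zero.1 h) with h | h
          · exact h
          · exact absurd h hom0.ne'
        · exact absurd h hgq
      rwa [← Finset.sum_subset (Finset.subset_univ {i, j}) (fun l _ hl => by
        simp only [Finset.mem_insert, Finset.mem_singleton, not_or] at hl
        exact hc0 l hl.1 hl.2), Finset.sum_pair hij] at h2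
    have hci : c i ≠ 0 := by
      intro h0
      have hall : ∀ l, c l = 0 := fun l => by
        by_cases hli : l = i
        · rw [hli, h0]
        by_cases hlj : l = j
        · rw [hlj]; linarith
        exact hc0 l hli hlj
      refine hw0 (hV.inj w hw fun s hs => ?_)
      obtain ⟨l, hl⟩ := hsegs s hs
      refine (hB l).1.vanishOn_of_tour (fun s hs => ?_) s hl
      rw [(B l).tour_τ, (hB l).2] at hs
      rw [hc l s hs, hall, zero_mul]
    refine ⟨w.1, c i, hci, fun s hs => hc i s ⟨hs.1, by linarith [hs.2]⟩, fun s hs => ?_⟩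
    rw [hc j s ⟨hs.1, by linarith [hs.2]⟩, ← hom, (by linarith : c j = -c i)]
  have hmem : ∀ {s : ℝ}, s ∈ Icc 0 ℓ → om * s ∈ Icc (-(Real.pi / 2)) (Real.pi / 2) := by
    intro s hs
    have h1 : 0 ≤ om * s := mul_nonneg hom0.le hs.1
    have h2 : om * s ≤ om * ℓ := mul_le_mul_of_nonneg_left hs.2 hom0.le
    exact ⟨by linarith, by linarith⟩
  by_cases hij : i = j
  · subst hij
    have : Nontrivial (Fin k) := Fin.nontrivial_iff_two_le.2 hk
    obtain ⟨j, hj⟩ := exists_ne i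
    obtain ⟨f, c, hc, h1, -⟩ := key i j hj.symm
    have h2 := h1 s hs
    rw [hst, h1 t ht] at h2
    have h3 := Real.injOn_sin (hmem ht) (hmem hs) (mul_left_cancel₀ hc h2)
    exact Or.inl ⟨rfl, (mul_left_cancel₀ hom0.ne' h3).symm⟩
  · obtain ⟨f, c, hc, h1, h2⟩ := key i j hij
    have h3 := h1 s hs
    rw [hst, h2 t ht, neg_mul, ← mul_neg] at h3
    have h4 := mul_left_cancel₀ hc h3
    rw [← Real.sin_neg] at h4
    have h5 := Real.injOn_sin ⟨by linarith [(hmem ht).2], by linarith [(hmem ht).1]⟩ (hmem hs) h4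
    have h6 : 0 ≤ om * s := mul_nonneg hom0.le hs.1
    have h7 : 0 ≤ om * t := mul_nonneg hom0.le ht.1
    refine Or.inr ⟨?_, ?_⟩
    · exact (mul_eq_zero.1 (by linarith : om * s = 0)).resolve_left hom0.ne'
    · exact (mul_eq_zero.1 (by linarith : om * t = 0)).resolve_left hom0.ne'

end STree

/-! ### The isometry with the star -/

namespace MetricGraph

variable {E : Type*} {Γ : MetricGraph E}

theorem equilateralStar_ptR_zero {k : ℕ} {L : ℝ} (hk : 0 < k) (hL : 0 < L) (i j : Fin k) :
    (equilateralStar k L hk hL).ptR i 0 = (equilateralStar k L hk hL).ptR j 0 := by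
  have h0 : ∀ i, projIcc 0 ((equilateralStar k L hk hL).len i)
      ((equilateralStar k L hk hL).len_pos i).le 0 =
        ⟨0, le_rfl, ((equilateralStar k L hk hL).len_pos i).le⟩ := fun i => projIcc_left _
  rw [ptR, ptR, h0, h0]
  exact Quotient.sound (Or.inr ⟨(i, false), (j, false), Or.inr ⟨rfl, rfl⟩, rfl, rfl⟩)

/-- A connected graph carrying a `k`-dimensional space of functions without common zeros on which
the energy form is nonpositive is isometric to a star. -/
theorem isIsometric_equilateralStar [Fintype E] [Nonempty E] (hconn : Γ.IsConnected) {L : ℝ}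
    (hL : 0 < L) (hlen : Γ.totalLength = L) {k : ℕ} (hk : 2 ≤ k)
    {V : Submodule ℝ ((Γ.Point → ℝ) × (E → ℝ → ℝ))} [FiniteDimensional ℝ V] (hV : V ≤ Γ.H1)
    (hneg : ∀ w ∈ V, Γ.form ((Real.pi / (2 * (L / k))) ^ 2) w w ≤ 0)
    (hinj : ∀ w ∈ V, w.1 = 0 → w = 0) (hdim : k ≤ Module.finrank ℝ V)
    (hne : ∀ q, ∃ g ∈ V, g.1 q ≠ 0) :
    Γ.IsIsometric (equilateralStar k L (zero_lt_two.trans_le hk) hL) := by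
  have hk0 : (0 : ℝ) < k := by exact_mod_cast (by omega : 0 < k)
  set ℓ := L / k with hℓdef
  have hℓ : 0 < ℓ := div_pos hL hk0
  have hkl : L = k * ℓ := by rw [hℓdef]; field_simp
  obtain ⟨T, p, hT, hTlen, hTform, hTsegs⟩ := STree.exists_spanning hconn
  have hTV : T.NegSpace ℓ V := by
    refine ⟨hV, fun w hw => ?_, fun w hw h0 => hinj w hw (funext fun q => ?_)⟩
    · rw [STree.energy, hTform]; exact hneg w hw
    · obtain ⟨e, x, hx, rfl⟩ := Γ.exists_eq_ptR q
      exact h0 _ (hTsegs e) x hx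
  have hTk : T.length = k * ℓ := by rw [hTlen, hlen, hkl]
  obtain ⟨q, R, hR, href, hstar⟩ := hT.exists_starLike hℓ hk hTk hTV hdim hne
  obtain ⟨k', B, hRlen, hB, hRform, hRsegs⟩ := hstar.exists_legs hR
  obtain rfl : k' = k := by
    have h1 : (k' : ℝ) * ℓ = k * ℓ := by rw [← hRlen, href.length_eq, hTk]
    exact_mod_cast mul_right_cancel₀ hℓ.ne' h1
  have hinjB := fun {i j : Fin k'} {s t : ℝ} => STree.legs_injective (i := i) (j := j) (s := s)
    (t := t) hR hℓ hk (hTV.of_refines href) hdim (hne q) (fun i => ⟨(hB i).1, (hB i).2.1⟩) hRform hRsegs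
  set Γ' := equilateralStar k' L (by omega) hL with hΓ'
  -- the point of the star with coordinate `s` on the edge `i` corresponds to the point at time `s`
  -- of the walk along the `i`-th leg
  let Ψ : Γ'.Point → Γ.Point := Quotient.lift (fun z : Γ'.Pre => ((B z.1).tour Γ q).pos z.2) (by
    rintro a b (rfl | ⟨s, t, hst, rfl, rfl⟩)
    · rfl
    · rcases hst with rfl | ⟨hs, ht⟩
      · rfl
      · obtain ⟨i, _⟩ := s
        obtain ⟨j, _⟩ := t
        obtain rfl : _ = false := hs
        obtain rfl : _ = false := ht
        exact (hB i).1.isCurve_tour.left.trans (hB j).1.isCurve_tour.left.symm)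
  have hΨ : ∀ (i : Fin k') (s : ℝ), s ∈ Icc 0 ℓ → Ψ (Γ'.ptR i s) = ((B i).tour Γ q).pos s := by
    intro i s hs
    rw [ptR, projIcc_of_mem _ (show s ∈ Icc 0 (Γ'.len i) from hs)]
    rfl
  -- every segment corresponds isometrically to a segment of a leg
  have hseg : ∀ s ∈ R.segs, ∃ (i : Fin k') (u : ℝ → ℝ), (∀ t t', |u t - u t'| = |t - t'|) ∧
      ∀ t ∈ Icc s.2.1 s.2.2, u t ∈ Icc 0 ℓ ∧ Ψ (Γ'.ptR i (u t)) = Γ.ptR s.1 t := by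
    intro s hs
    obtain ⟨i, hi⟩ := hRsegs s hs
    obtain ⟨u, hu, hu'⟩ := (hB i).1.exists_pos_of_mem_segs (hB i).2.2 s hi
    refine ⟨i, u, hu, fun t ht => ?_⟩
    have h1 := hu' t ht
    rw [(hB i).2.1] at h1
    exact ⟨h1.1, by rw [hΨ i _ h1.1, h1.2]⟩
  have hbij : Function.Bijective Ψ := by
    constructor
    · intro x y hxy
      obtain ⟨i, s, hs, rfl⟩ := Γ'.exists_eq_ptR x
      obtain ⟨j, t, ht, rfl⟩ := Γ'.exists_eq_ptR y
      rw [hΨ i s hs, hΨ j t ht] at hxy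
      rcases hinjB hs ht hxy with ⟨rfl, rfl⟩ | ⟨rfl, rfl⟩
      · rfl
      · exact equilateralStar_ptR_zero _ hL i j
    · intro y
      obtain ⟨e, x, hx, rfl⟩ := Γ.exists_eq_ptR y
      rcases href.segs _ (hTsegs e) with h | ⟨c, -, h1, h2⟩
      · obtain ⟨i, u, -, hu⟩ := hseg _ h
        exact ⟨_, (hu x hx).2⟩
      · rcases le_total x c with h | h
        · obtain ⟨i, u, -, hu⟩ := hseg _ h1
          exact ⟨_, (hu x ⟨hx.1, h⟩).2⟩
        · obtain ⟨i, u, -, hu⟩ := hseg _ h2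
          exact ⟨_, (hu x ⟨h, hx.2⟩).2⟩
  let Φ := (Equiv.ofBijective Ψ hbij).symm
  have hΦΨ : ∀ x, Φ (Ψ x) = x := fun x => (Equiv.ofBijective Ψ hbij).symm_apply_apply x
  have hΨΦ : ∀ x, Ψ (Φ x) = x := fun x => (Equiv.ofBijective Ψ hbij).apply_symm_apply x
  -- both the bijection and its inverse are `1`-Lipschitz, as this can be checked on single edges
  refine ⟨Φ, fun x y => le_antisymm ?_ ?_⟩
  · refine le_edist_of_edge Γ (d := fun x y => Γ'.edist (Φ x) (Φ y)) (fun x => Γ'.edist_self _)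
      (fun x y z => Γ'.edist_triangle _ _ _) ?_ x y
    have hsd : ∀ s ∈ R.segs, ∀ a ∈ Icc s.2.1 s.2.2, ∀ b ∈ Icc s.2.1 s.2.2,
        Γ'.edist (Φ (Γ.ptR s.1 a)) (Φ (Γ.ptR s.1 b)) ≤ ENNReal.ofReal |a - b| := by
      intro s hs a ha b hb
      obtain ⟨i, u, hu, hu'⟩ := hseg s hs
      rw [← (hu' a ha).2, ← (hu' b hb).2, hΦΨ, hΦΨ, ← hu a b]
      exact Γ'.edist_ptR_le i (hu' a ha).1 (hu' b hb).1
    have hmain : ∀ e, ∀ a ∈ Icc 0 (Γ.len e), ∀ b ∈ Icc 0 (Γ.len e), a ≤ b →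
        Γ'.edist (Φ (Γ.ptR e a)) (Φ (Γ.ptR e b)) ≤ ENNReal.ofReal |a - b| := by
      intro e a ha b hb hab
      rcases href.segs _ (hTsegs e) with h | ⟨c, -, h1, h2⟩
      · exact hsd _ h a ha b hb
      · rcases le_total b c with hbc | hbc
        · exact hsd _ h1 a ⟨ha.1, hab.trans hbc⟩ b ⟨hb.1, hbc⟩
        rcases le_total c a with hca | hca
        · exact hsd _ h2 a ⟨hca, ha.2⟩ b ⟨hbc, hb.2⟩
        refine (Γ'.edist_triangle _ (Φ (Γ.ptR e c)) _).trans ((add_le_add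
          (hsd _ h1 a ⟨ha.1, hca⟩ c ⟨ha.1.trans hca, le_rfl⟩)
          (hsd _ h2 c ⟨le_rfl, hbc.trans hb.2⟩ b ⟨hbc, hb.2⟩)).trans ?_)
        rw [← ENNReal.ofReal_add (abs_nonneg _) (abs_nonneg _), abs_of_nonpos (by linarith),
          abs_of_nonpos (by linarith), abs_of_nonpos (by linarith)]
        exact ENNReal.ofReal_le_ofReal (by linarith)
    intro e a b
    rw [← Γ.ptR_coe, ← Γ.ptR_coe]
    rcases le_total (a : ℝ) b with hab | hab
    · exact hmain e a a.2 b b.2 hab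
    · rw [Γ'.edist_symm, abs_sub_comm]
      exact hmain e b b.2 a a.2 hab
  · have h := le_edist_of_edge Γ' (d := fun x y => Γ.edist (Ψ x) (Ψ y)) (fun x => Γ.edist_self _)
      (fun x y z => Γ.edist_triangle _ _ _) ?_ (Φ x) (Φ y)
    · simpa only [hΨΦ] using h
    · have hmain : ∀ i, ∀ a ∈ Icc 0 ℓ, ∀ b ∈ Icc 0 ℓ, a ≤ b →
          Γ.edist (Ψ (Γ'.ptR i a)) (Ψ (Γ'.ptR i b)) ≤ ENNReal.ofReal |a - b| := by
        intro i a ha b hb hab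
        have hτ : ((B i).tour Γ q).τ = 2 * ℓ := by rw [STree.tour_τ, (hB i).2.1]
        rw [hΨ i a ha, hΨ i b hb, abs_sub_comm, abs_of_nonneg (by linarith)]
        exact (hB i).1.isCurve_tour.edist_le a ⟨ha.1, by rw [hτ]; linarith [ha.2]⟩ b
          ⟨hb.1, by rw [hτ]; linarith [hb.2]⟩ hab
      intro i a b
      rw [← Γ'.ptR_coe, ← Γ'.ptR_coe]
      rcases le_total (a : ℝ) b with hab | hab
      · exact hmain i a a.2 b b.2 hab
      · rw [Γ.edist_symm, abs_sub_comm]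
        exact hmain i b b.2 a a.2 hab

end MetricGraph

/-! ### Compact operators -/

namespace ContinuousLinearMap

open scoped InnerProductSpace

variable {H H' : Type*} [NormedAddCommGroup H] [InnerProductSpace ℝ H] [CompleteSpace H]
  [NormedAddCommGroup H'] [InnerProductSpace ℝ H'] [CompleteSpace H']

/-- A compact positive operator without eigenvalues in `[ν, ∞)` has norm at most `ν`, since its norm
is an eigenvalue. -/
theorem norm_le_of_forall_eigenvector {S : H →L[ℝ] H} (hS : IsCompactOperator S)
    (hsymm : S.IsSymmetric) (hpos : ∀ u, 0 ≤ ⟪S u, u⟫_ℝ) {ν : ℝ} (hν : 0 < ν)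
    (h : ∀ μ, ν ≤ μ → ∀ u, S u = μ • u → u = 0) : ‖S‖ ≤ ν := by
  by_contra! hlt
  have hS0 : ‖S‖ ≠ 0 := (hν.trans hlt).ne'
  have : Nontrivial H := by
    by_contra hcon
    rw [not_nontrivial_iff_subsingleton] at hcon
    exact hS0 (by rw [Subsingleton.elim S 0, norm_zero])
  rcases hS.hasEigenvalue_or_mem_resolventSet hS0 with h1 | h1
  · obtain ⟨u, hu⟩ := h1.exists_hasEigenvector
    exact hu.2 (h ‖S‖ hlt.le u hu.apply_eq_smul)
  · obtain ⟨ε, hε, h2⟩ := S.rayleighQuotient_le_of_norm_mem_resolventSet h1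
    have h3 : ‖S‖ ≤ ‖S‖ - ε := by
      conv_lhs => rw [norm_eq_iSup_rayleighQuotient S hsymm]
      refine ciSup_le fun u => ?_
      rw [abs_of_nonneg]
      · exact h2 u
      · exact div_nonneg (hpos u) (by positivity)
    linarith

/-- If `‖J u‖² > ν ‖u‖²` on a `k`-dimensional space, where `J` is compact, then the operator `J† J`
has `k` linearly independent eigenvectors with eigenvalues at least `ν`. -/
theorem exists_eigenvectors {J : H →L[ℝ] H'} (hJ : IsCompactOperator J) {ν : ℝ} (hν : 0 < ν)
    {k : ℕ} {U : Submodule ℝ H} [FiniteDimensional ℝ U] (hk : k ≤ Module.finrank ℝ U)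
    (hU : ∀ u ∈ U, u ≠ 0 → ν * ‖u‖ ^ 2 < ‖J u‖ ^ 2) :
    ∃ v : Fin k → H, LinearIndependent ℝ v ∧
      ∀ i, ∃ μ, ν ≤ μ ∧ ∀ w, ⟪J (v i), J w⟫_ℝ = μ * ⟪v i, w⟫_ℝ := by
  set T : H →L[ℝ] H := (adjoint J) ∘L J with hTdef
  have hTin : ∀ u w, ⟪T u, w⟫_ℝ = ⟪J u, J w⟫_ℝ := fun u w => by
    rw [hTdef, comp_apply, adjoint_inner_left]
  have hT : IsCompactOperator T := hJ.clm_comp (adjoint J)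
  have hsymm : T.IsSymmetric := fun u w => by
    change ⟪T u, w⟫_ℝ = ⟪u, T w⟫_ℝ
    rw [hTin, real_inner_comm, ← hTin, real_inner_comm]
  set X : Set H := {v | ∃ μ, ν ≤ μ ∧ T v = μ • v} with hX
  set M : Submodule ℝ H := Submodule.span ℝ X with hM
  have hXM : X ⊆ M := Submodule.subset_span
  have hinv : ∀ u ∈ Mᗮ, (T : H →ₗ[ℝ] H) u ∈ Mᗮ := by
    intro u hu
    rw [hM, Submodule.mem_orthogonal] at hu ⊢
    intro w hw
    change ⟪w, T u⟫_ℝ = 0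
    induction hw using Submodule.span_induction with
    | mem w hw =>
      obtain ⟨μ, hle, hμ⟩ := hw
      refine (hsymm w u).symm.trans ?_
      change ⟪T w, u⟫_ℝ = 0
      rw [hμ, inner_smul_left, hu w (hXM ⟨μ, hle, hμ⟩), mul_zero]
    | zero => exact inner_zero_left _
    | add x y _ _ hx hy => rw [inner_add_left, hx, hy, add_zero]
    | smul a x _ hx => rw [inner_smul_left, hx, mul_zero]
  -- on the orthogonal complement of the eigenvectors the quadratic form is small
  let S : Mᗮ →L[ℝ] Mᗮ := T.restrict hinv
  have hSv : ∀ u : Mᗮ, ((S u : Mᗮ) : H) = T u := fun u => rfl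
  have hSnorm : ‖S‖ ≤ ν := by
    refine norm_le_of_forall_eigenvector (hT.restrict' hinv) (hsymm.restrict_invariant hinv)
      (fun u => ?_) hν fun μ hμ u hu => ?_
    · rw [Submodule.coe_inner, hSv, hTin]
      exact real_inner_self_nonneg
    · have h1 : (u : H) ∈ M := hXM ⟨μ, hμ, by rw [← hSv, hu]; rfl⟩
      have h2 := Submodule.inner_right_of_mem_orthogonal h1 u.2
      exact Subtype.ext (inner_self_eq_zero.1 h2)
  have hsmall : ∀ u ∈ Mᗮ, ‖J u‖ ^ 2 ≤ ν * ‖u‖ ^ 2 := by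
    intro u hu
    rw [← real_inner_self_eq_norm_sq, ← hTin]
    calc ⟪T u, u⟫_ℝ = ⟪S ⟨u, hu⟩, ⟨u, hu⟩⟫_ℝ := rfl
      _ ≤ ‖S ⟨u, hu⟩‖ * ‖(⟨u, hu⟩ : Mᗮ)‖ := real_inner_le_norm _ _
      _ ≤ (ν * ‖(⟨u, hu⟩ : Mᗮ)‖) * ‖(⟨u, hu⟩ : Mᗮ)‖ := by
        gcongr
        exact (S.le_opNorm _).trans (by gcongr)
      _ = ν * ‖u‖ ^ 2 := by rw [Submodule.coe_norm]; ring
  obtain ⟨b, hbX, hbspan, hbli⟩ := exists_linearIndependent ℝ X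
  have hemb : Nonempty (Fin k ↪ b) := by
    rcases finite_or_infinite b with hfin | hinf
    · have := Fintype.ofFinite b
      refine Function.Embedding.nonempty_of_card_le ?_
      rw [Fintype.card_fin]
      by_contra! hlt
      have hMb : M = Submodule.span ℝ b := hbspan.symm
      have hMfin : FiniteDimensional ℝ M := by
        rw [hMb]; exact FiniteDimensional.span_of_finite ℝ hfin
      have hMdim : Module.finrank ℝ M = Fintype.card b := by
        rw [hMb, finrank_span_set_eq_card hbli, Set.toFinset_card]
      let φ : U →ₗ[ℝ] M := M.orthogonalProjectionOnto.toLinearMap ∘ₗ U.subtype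
      have h1 : LinearMap.ker φ ≠ ⊥ := LinearMap.ker_ne_bot_of_finrank_lt (by omega)
      obtain ⟨u, hu, hu0⟩ := (Submodule.ne_bot_iff _).1 h1
      have h2 : (u : H) ∈ Mᗮ := Submodule.orthogonalProjectionOnto_eq_zero_iff.1 hu
      have h3 := hU u u.2 (fun h => hu0 (Subtype.ext h))
      linarith [hsmall u h2]
    · exact ⟨(Fin.valEmbedding).trans (Infinite.natEmbedding b)⟩
  obtain ⟨g⟩ := hemb
  refine ⟨fun i => g i, hbli.comp g g.injective, fun i => ?_⟩
  obtain ⟨μ, hμ, h1⟩ := hbX (g i).2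
  refine ⟨μ, hμ, fun w => ?_⟩
  rw [← hTin, h1, inner_smul_left]
  rfl

/-- An operator which is small on subspaces of finite codimension is compact. -/
theorem isCompactOperator_of_forall_exists (J : H →L[ℝ] H')
    (h : ∀ ε > 0, ∃ (n : ℕ) (P : H →L[ℝ] (Fin n → ℝ)), ∀ u, P u = 0 → ‖J u‖ ≤ ε * ‖u‖) :
    IsCompactOperator J := by
  refine isClosed_setOfPred_isCompactOperator.closure_subset (Metric.mem_closure_iff.2 fun ε hε => ?_)
  obtain ⟨n, P, hP⟩ := h (ε / 2) (by positivity)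
  set N : Submodule ℝ H := LinearMap.ker P.toLinearMap with hN
  have hNcl : IsClosed (N : Set H) := P.isClosed_ker
  have : CompleteSpace N := hNcl.completeSpace_coe
  have hfin : FiniteDimensional ℝ Nᗮ := by
    refine FiniteDimensional.of_injective (P.toLinearMap ∘ₗ Nᗮ.subtype) ?_
    rw [← LinearMap.ker_eq_bot, LinearMap.ker_eq_bot']
    intro u hu
    have h1 : (u : H) ∈ N := hu
    exact Subtype.ext (inner_self_eq_zero.1 (Submodule.inner_right_of_mem_orthogonal h1 u.2))
  refine ⟨(J ∘L Nᗮ.subtypeL) ∘L Nᗮ.orthogonalProjectionOnto, ?_, ?_⟩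
  · have : ProperSpace Nᗮ := FiniteDimensional.proper ℝ Nᗮ
    exact (isCompactOperator_of_locallyCompactSpace_rng (J ∘L Nᗮ.subtypeL)).comp_clm
      Nᗮ.orthogonalProjectionOnto
  · rw [dist_eq_norm]
    refine lt_of_le_of_lt (opNorm_le_bound _ (by positivity) fun u => ?_) (half_lt_self hε)
    have h1 : (J - (J ∘L Nᗮ.subtypeL) ∘L Nᗮ.orthogonalProjectionOnto) u =
        J (u - Nᗮ.orthogonalProjectionOnto u) := by simp
    have h2 : u - Nᗮ.orthogonalProjectionOnto u = (N.orthogonalProjectionOnto u : H) := by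
      rw [sub_eq_iff_eq_add]
      exact (N.starProjection_add_starProjection_orthogonal u).symm
    rw [h1, h2]
    refine (hP _ (N.orthogonalProjectionOnto u).2).trans ?_
    gcongr
    exact N.norm_orthogonalProjectionOnto_apply_le u

end ContinuousLinearMap

/-! ### The Hilbert space `H¹(Γ)` -/

namespace MetricGraph

open scoped InnerProductSpace

variable {E : Type*} {Γ : MetricGraph E}

instance (e : E) : IsFiniteMeasure (Γ.edgeMeasure e) :=
  inferInstanceAs (IsFiniteMeasure (volume.restrict (Ioo 0 (Γ.len e))))

theorem setIntegral_Ioc_edgeMeasure (g : ℝ → ℝ) (e : E) {s : ℝ} (hs : s ∈ Icc 0 (Γ.len e)) :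
    ∫ x in Ioc 0 s, g x ∂(Γ.edgeMeasure e) = ∫ x in (0 : ℝ)..s, g x := by
  rw [edgeMeasure, Measure.restrict_congr_set Ioo_ae_eq_Ioc, Measure.restrict_restrict measurableSet_Ioc,
    inter_eq_left.2 (Ioc_subset_Ioc_right hs.2), intervalIntegral.integral_of_le hs.1]

/-- The functional `u ↦ ∫₀ˢ u` on the space `L²` of an edge. -/
noncomputable def integralL (Γ : MetricGraph E) (e : E) (s : ℝ) :
    Lp ℝ 2 (Γ.edgeMeasure e) →L[ℝ] ℝ :=
  innerSL ℝ (indicatorConstLp 2 (measurableSet_Ioc (a := (0 : ℝ)) (b := s))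
    (measure_ne_top (Γ.edgeMeasure e) _) (1 : ℝ))

theorem integralL_apply (e : E) {s : ℝ} (hs : s ∈ Icc 0 (Γ.len e)) (u : Lp ℝ 2 (Γ.edgeMeasure e)) :
    Γ.integralL e s u = ∫ x in (0 : ℝ)..s, u x := by
  rw [← setIntegral_Ioc_edgeMeasure _ e hs, integralL, innerSL_apply_apply,
    L2.inner_indicatorConstLp_one]

theorem integralL_toLp (e : E) {s : ℝ} (hs : s ∈ Icc 0 (Γ.len e)) {g : ℝ → ℝ}
    (hg : MemLp g 2 (Γ.edgeMeasure e)) : Γ.integralL e s hg.toLp = ∫ x in (0 : ℝ)..s, g x := by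
  rw [integralL_apply e hs, ← setIntegral_Ioc_edgeMeasure _ e hs, ← setIntegral_Ioc_edgeMeasure _ e hs]
  exact setIntegral_congr_ae measurableSet_Ioc (hg.coeFn_toLp.mono fun x hx _ => hx)

theorem abs_integralL_le (e : E) (s : ℝ) (u : Lp ℝ 2 (Γ.edgeMeasure e)) :
    |Γ.integralL e s u| ≤ √(Γ.len e) * ‖u‖ := by
  rw [integralL, innerSL_apply_apply]
  refine (abs_real_inner_le_norm _ _).trans ?_
  gcongr
  refine norm_indicatorConstLp_le.trans ?_
  have h1 : (Γ.edgeMeasure e).real (Ioc 0 s) ≤ Γ.len e := by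
    refine (measureReal_mono (subset_univ _)).trans ?_
    rw [edgeMeasure, measureReal_restrict_apply MeasurableSet.univ, univ_inter, Real.volume_real_Ioo,
      sub_zero]
    exact (max_eq_left (Γ.len_pos e).le).le
  rw [norm_one, one_mul, Real.sqrt_eq_rpow]
  simpa using Real.rpow_le_rpow measureReal_nonneg h1 (by norm_num)

theorem memLp_fst {w : (Γ.Point → ℝ) × (E → ℝ → ℝ)} (hw : w ∈ Γ.H1) (e : E) :
    MemLp (Γ.onEdge w.1 e) 2 (Γ.edgeMeasure e) :=
  Γ.memLp_edgeMeasure_iff.2 ((isH1On_onEdge hw e).memLp_self (Γ.len_pos e).le)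

theorem memLp_snd {w : (Γ.Point → ℝ) × (E → ℝ → ℝ)} (hw : w ∈ Γ.H1) (e : E) :
    MemLp (w.2 e) 2 (Γ.edgeMeasure e) := (hw.2 e).1

theorem inner_toLp (e : E) {f g : ℝ → ℝ} (hf : MemLp f 2 (Γ.edgeMeasure e))
    (hg : MemLp g 2 (Γ.edgeMeasure e)) :
    ⟪hf.toLp, hg.toLp⟫_ℝ = ∫ x, f x * g x ∂(Γ.edgeMeasure e) := by
  rw [L2.inner_def]
  refine integral_congr_ae ?_
  filter_upwards [hf.coeFn_toLp, hg.coeFn_toLp] with x h1 h2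
  rw [h1, h2]
  exact mul_comm _ _

/-- The space `L²(Γ)`. -/
abbrev L2 (Γ : MetricGraph E) := PiLp 2 fun e => Lp ℝ 2 (Γ.edgeMeasure e)

/-- A function in `H¹(Γ)` as an element of `L²(Γ)`. -/
noncomputable def toL2 (Γ : MetricGraph E) : Γ.H1 →ₗ[ℝ] Γ.L2 where
  toFun w := WithLp.toLp 2 fun e => (memLp_fst w.2 e).toLp
  map_add' _ _ := rfl
  map_smul' _ _ := rfl

/-- The derivative of a function in `H¹(Γ)` as an element of `L²(Γ)`. -/
noncomputable def derivToL2 (Γ : MetricGraph E) : Γ.H1 →ₗ[ℝ] Γ.L2 where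
  toFun w := WithLp.toLp 2 fun e => (memLp_snd w.2 e).toLp
  map_add' _ _ := rfl
  map_smul' _ _ := rfl

theorem eq_zero_of_toL2_eq_zero {w : Γ.H1} (h : Γ.toL2 w = 0) : w.1.1 = 0 := by
  have hl : ∀ e, 0 < Γ.len e := Γ.len_pos
  funext q
  obtain ⟨e, x, hx, rfl⟩ := Γ.exists_eq_ptR q
  have h1 : (memLp_fst w.2 e).toLp = 0 := congrArg (fun u : Γ.L2 => u e) h
  have h2 : Γ.onEdge w.1.1 e =ᵐ[Γ.edgeMeasure e] 0 :=
    (memLp_fst w.2 e).coeFn_toLp.symm.trans (h1 ▸ Lp.coeFn_zero _ _ _)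
  have hc := Γ.continuous_onEdge w.2.1 e
  rw [edgeMeasure, Measure.restrict_congr_set Ioo_ae_eq_Icc] at h2
  exact Measure.eqOn_Icc_of_ae_eq volume (hl e).ne h2 hc.continuousOn continuousOn_const hx

variable [Fintype E]

theorem inner_toL2 (v w : Γ.H1) : ⟪Γ.toL2 v, Γ.toL2 w⟫_ℝ =
    ∑ e, ∫ x, Γ.onEdge v.1.1 e x * Γ.onEdge w.1.1 e x ∂(Γ.edgeMeasure e) := by
  rw [PiLp.inner_apply]
  exact Finset.sum_congr rfl fun e _ => inner_toLp e (memLp_fst v.2 e) (memLp_fst w.2 e)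

theorem inner_derivToL2 (v w : Γ.H1) : ⟪Γ.derivToL2 v, Γ.derivToL2 w⟫_ℝ =
    ∑ e, ∫ x, v.1.2 e x * w.1.2 e x ∂(Γ.edgeMeasure e) := by
  rw [PiLp.inner_apply]
  exact Finset.sum_congr rfl fun e _ => inner_toLp e (memLp_snd v.2 e) (memLp_snd w.2 e)

theorem form_eq_inner (lam : ℝ) (v w : Γ.H1) : Γ.form lam v w =
    ⟪Γ.derivToL2 v, Γ.derivToL2 w⟫_ℝ - lam * ⟪Γ.toL2 v, Γ.toL2 w⟫_ℝ := by
  rw [inner_toL2, inner_derivToL2, Finset.mul_sum, ← Finset.sum_sub_distrib]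
  refine Finset.sum_congr rfl fun e _ => ?_
  rw [integral_edgeMeasure, integral_edgeMeasure, ← intervalIntegral.integral_const_mul,
    ← intervalIntegral.integral_sub]
  · rfl
  · exact IsH1On.integrable_mul (isH1On_onEdge v.2 e).memLp (isH1On_onEdge w.2 e).memLp
      (Γ.len_pos e).le
  · exact (IsH1On.integrable_mul ((isH1On_onEdge v.2 e).memLp_self (Γ.len_pos e).le)
      ((isH1On_onEdge w.2 e).memLp_self (Γ.len_pos e).le) (Γ.len_pos e).le).const_mul lam

/-- The Hilbert space in which `H¹(Γ)` is embedded by a function and its derivative. -/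
abbrev L2Prod (Γ : MetricGraph E) := WithLp 2 (Γ.L2 × Γ.L2)

/-- The embedding of `H¹(Γ)`. -/
noncomputable def embed (Γ : MetricGraph E) : Γ.H1 →ₗ[ℝ] Γ.L2Prod where
  toFun w := WithLp.toLp 2 (Γ.toL2 w, Γ.derivToL2 w)
  map_add' _ _ := by rw [map_add, map_add]; rfl
  map_smul' _ _ := by rw [map_smul, map_smul]; rfl

theorem norm_toL2_le (w : Γ.H1) : ‖Γ.toL2 w‖ ≤ ‖Γ.embed w‖ := WithLp.norm_fst_le _ (Γ.embed w)

theorem norm_derivToL2_le (w : Γ.H1) : ‖Γ.derivToL2 w‖ ≤ ‖Γ.embed w‖ :=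
  WithLp.norm_snd_le _ (Γ.embed w)

/-- Functions in `H¹(Γ)` are bounded pointwise by their norm: on an edge, the oscillation is bounded by
the norm of the derivative and the mean value by the norm of the function. -/
theorem exists_abs_le_norm_embed (Γ : MetricGraph E) :
    ∃ C, 0 ≤ C ∧ ∀ (w : Γ.H1) (q : Γ.Point), |w.1.1 q| ≤ C * ‖Γ.embed w‖ := by
  have hl : ∀ e, 0 < Γ.len e := Γ.len_pos
  refine ⟨∑ e, (√(Γ.len e) / Γ.len e + 2 * √(Γ.len e)), Finset.sum_nonneg fun e _ => by
    have := hl e; positivity, fun w q => ?_⟩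
  obtain ⟨e, x, hx, rfl⟩ := Γ.exists_eq_ptR q
  have hle := hl e
  have h0 : (0 : ℝ) ∈ Icc 0 (Γ.len e) := ⟨le_rfl, hle.le⟩
  set N := ‖Γ.embed w‖ with hN
  have hA : ‖Γ.toL2 w e‖ ≤ N := (PiLp.norm_apply_le _ _).trans (norm_toL2_le w)
  have hB : ‖Γ.derivToL2 w e‖ ≤ N := (PiLp.norm_apply_le _ _).trans (norm_derivToL2_le w)
  have hH := isH1On_onEdge w.2 e
  have hdiff : ∀ s ∈ Icc 0 (Γ.len e), |w.1.1 (Γ.ptR e s) - w.1.1 (Γ.ptR e 0)| ≤ √(Γ.len e) * N := by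
    intro s hs
    rw [hH.eq_add s hs, add_sub_cancel_left, ← integralL_toLp e hs (memLp_snd w.2 e)]
    exact (abs_integralL_le e s _).trans (by gcongr; exact hB)
  have hmean : |∫ s in (0 : ℝ)..(Γ.len e), w.1.1 (Γ.ptR e s)| ≤ √(Γ.len e) * N := by
    have := integralL_toLp e (s := Γ.len e) ⟨hle.le, le_rfl⟩ (memLp_fst w.2 e)
    refine (congrArg abs this).symm.le.trans ((abs_integralL_le e _ _).trans ?_)
    gcongr
    exact hA
  have hconst : |(∫ s in (0 : ℝ)..(Γ.len e), w.1.1 (Γ.ptR e s)) - Γ.len e * w.1.1 (Γ.ptR e 0)| ≤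
      √(Γ.len e) * N * Γ.len e := by
    have h1 : (∫ s in (0 : ℝ)..(Γ.len e), w.1.1 (Γ.ptR e s)) - Γ.len e * w.1.1 (Γ.ptR e 0) =
        ∫ s in (0 : ℝ)..(Γ.len e), (w.1.1 (Γ.ptR e s) - w.1.1 (Γ.ptR e 0)) := by
      rw [intervalIntegral.integral_sub _ (by simp)]
      · simp
      · exact (uIcc_of_le hle.le ▸ hH.continuousOn hle.le :
          ContinuousOn _ (uIcc 0 (Γ.len e))).intervalIntegrable
    rw [h1, ← Real.norm_eq_abs]
    refine (intervalIntegral.norm_integral_le_of_norm_le_const (C := √(Γ.len e) * N)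
      fun s hs => ?_).trans ?_
    · rw [uIoc_of_le hle.le] at hs
      exact hdiff s (Ioc_subset_Icc_self hs)
    · rw [sub_zero, abs_of_pos hle]
  have hzero : |w.1.1 (Γ.ptR e 0)| ≤ (√(Γ.len e) / Γ.len e + √(Γ.len e)) * N := by
    have h2 : |Γ.len e * w.1.1 (Γ.ptR e 0)| ≤ √(Γ.len e) * N + √(Γ.len e) * N * Γ.len e := by
      rw [abs_le] at hconst hmean ⊢
      constructor <;> linarith [hconst.1, hconst.2, hmean.1, hmean.2]
    rw [abs_mul, abs_of_pos hle] at h2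
    have h3 : (√(Γ.len e) / Γ.len e + √(Γ.len e)) * N =
        (√(Γ.len e) * N + √(Γ.len e) * N * Γ.len e) / Γ.len e := by field_simp
    rw [h3, le_div_iff₀ hle]
    linarith
  have hN0 : 0 ≤ N := norm_nonneg _
  have h4 : |w.1.1 (Γ.ptR e x)| ≤ (√(Γ.len e) / Γ.len e + 2 * √(Γ.len e)) * N := by
    have := hdiff x hx
    have h5 := abs_sub_abs_le_abs_sub (w.1.1 (Γ.ptR e x)) (w.1.1 (Γ.ptR e 0))
    linarith
  refine h4.trans (mul_le_mul_of_nonneg_right ?_ hN0)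
  exact Finset.single_le_sum (f := fun e => √(Γ.len e) / Γ.len e + 2 * √(Γ.len e))
    (fun e _ => by have := hl e; positivity) (Finset.mem_univ e)

/-- The derivative of a function in `H¹(Γ)` is determined almost everywhere by the function. -/
theorem embed_eq_zero_iff {w : Γ.H1} : Γ.embed w = 0 ↔ w.1.1 = 0 := by
  constructor
  · intro h
    refine eq_zero_of_toL2_eq_zero ?_
    rw [← norm_le_zero_iff]
    simpa [h] using norm_toL2_le w
  · intro h
    have h1 : Γ.toL2 w = 0 := by
      rw [← inner_self_eq_zero (𝕜 := ℝ), inner_toL2]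
      refine Finset.sum_eq_zero fun e _ => ?_
      have : Γ.onEdge w.1.1 e = 0 := by rw [h]; rfl
      simp [this]
    have h2 : Γ.derivToL2 w = 0 := by
      rw [← inner_self_eq_zero (𝕜 := ℝ), inner_derivToL2]
      refine Finset.sum_eq_zero fun e _ => integral_eq_zero_of_ae ?_
      rw [edgeMeasure]
      refine (ae_restrict_iff' measurableSet_Ioo).2 ?_
      filter_upwards [(isH1On_onEdge w.2 e).ae_hasDerivAt (Γ.len_pos e).le] with x hx hxm
      have h3 := hx hxm
      rw [h] at h3
      have h4 : w.1.2 e x = 0 := h3.unique (hasDerivAt_const x (0 : ℝ))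
      simp [h4]
    change WithLp.toLp 2 (Γ.toL2 w, Γ.derivToL2 w) = 0
    rw [h1, h2]
    rfl

theorem norm_toL2_le_of_abs_le {w : Γ.H1} {M : ℝ} (hM : ∀ q, |w.1.1 q| ≤ M) :
    ‖Γ.toL2 w‖ ^ 2 ≤ Γ.totalLength * M ^ 2 := by
  rw [← real_inner_self_eq_norm_sq, inner_toL2, totalLength, Finset.sum_mul]
  refine Finset.sum_le_sum fun e _ => ?_
  rw [integral_edgeMeasure]
  have h1 := intervalIntegral.norm_integral_le_of_norm_le_const (a := 0) (b := Γ.len e)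
    (C := M ^ 2) (f := fun x => Γ.onEdge w.1.1 e x * Γ.onEdge w.1.1 e x) fun s _ => by
      rw [← pow_two, Real.norm_eq_abs, abs_pow]
      exact pow_le_pow_left₀ (abs_nonneg _) (hM _) 2
  rw [sub_zero, abs_of_pos (Γ.len_pos e), mul_comm] at h1
  exact (le_abs_self _).trans h1

/-- Point evaluations on `H¹(Γ)` extend to continuous functionals with a common bound. -/
theorem exists_eval (Γ : MetricGraph E) : ∃ C, 0 ≤ C ∧ ∀ q : Γ.Point, ∃ ev : Γ.L2Prod →L[ℝ] ℝ,
    (∀ w : Γ.H1, ev (Γ.embed w) = w.1.1 q) ∧ ‖ev‖ ≤ C := by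
  obtain ⟨C, hC0, hC⟩ := exists_abs_le_norm_embed Γ
  have : Module.Free ℝ (LinearMap.range Γ.embed) := Module.Free.of_divisionRing ℝ _
  have : Module.Projective ℝ (LinearMap.range Γ.embed) := Module.Projective.of_free
  obtain ⟨R, hR⟩ := LinearMap.exists_rightInverse_of_surjective Γ.embed.rangeRestrict
    Γ.embed.range_rangeRestrict
  have hR' : ∀ u, Γ.embed (R u) = u := fun u => congrArg Subtype.val (LinearMap.congr_fun hR u)
  refine ⟨C, hC0, fun q => ?_⟩
  let ev : LinearMap.range Γ.embed →ₗ[ℝ] ℝ :=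
    { toFun := fun u => (R u).1.1 q
      map_add' := fun _ _ => by rw [map_add]; rfl
      map_smul' := fun _ _ => by rw [map_smul]; rfl }
  have hb : ∀ u, ‖ev u‖ ≤ C * ‖u‖ := fun u => by
    have := hC (R u) q
    rw [hR'] at this
    exact this
  obtain ⟨g, hg, hg'⟩ := exists_extension_norm_eq _ (ev.mkContinuous C hb)
  refine ⟨g, fun w => ?_, hg' ▸ LinearMap.mkContinuous_norm_le _ hC0 _⟩
  refine (hg (Γ.embed.rangeRestrict w)).trans ?_
  have h2 : Γ.embed (R (Γ.embed.rangeRestrict w) - w) = 0 := by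
    rw [map_sub, hR']; exact sub_self _
  exact sub_eq_zero.1 (congrFun (embed_eq_zero_iff.1 h2) q)

/-- The space `H¹(Γ)` is complete. A limit `u` of functions in `H¹(Γ)` is represented by its point
evaluations, as these are continuous. -/
theorem isClosed_range_embed (Γ : MetricGraph E) :
    IsClosed (LinearMap.range Γ.embed : Set Γ.L2Prod) := by
  obtain ⟨C, hC0, hev⟩ := exists_eval Γ
  choose ev hev hevC using hev
  refine isClosed_of_closure_subset fun u hu => ?_
  set f : Γ.Point → ℝ := fun q => ev q u with hf
  set g : E → ℝ → ℝ := fun e => u.snd e with hg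
  have hfg : ∀ e, ∀ s ∈ Icc 0 (Γ.len e), f (Γ.ptR e s) = f (Γ.ptR e 0) + ∫ t in (0 : ℝ)..s, g e t := by
    intro e s hs
    have hcl : IsClosed {u : Γ.L2Prod | ev (Γ.ptR e s) u = ev (Γ.ptR e 0) u +
        Γ.integralL e s (u.snd e)} :=
      isClosed_eq (ev _).continuous ((ev _).continuous.add ((Γ.integralL e s).continuous.comp
        ((PiLp.continuous_apply 2 _ e).comp (WithLp.sndL 2 ℝ Γ.L2 Γ.L2).continuous)))
    have hsub : (LinearMap.range Γ.embed : Set Γ.L2Prod) ⊆ {u : Γ.L2Prod | ev (Γ.ptR e s) u =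
        ev (Γ.ptR e 0) u + Γ.integralL e s (u.snd e)} := by
      rintro _ ⟨w, rfl⟩
      change ev (Γ.ptR e s) (Γ.embed w) = ev (Γ.ptR e 0) (Γ.embed w) +
        Γ.integralL e s (memLp_snd w.2 e).toLp
      rw [hev, hev, integralL_toLp e hs]
      exact (isH1On_onEdge w.2 e).eq_add s hs
    have h1 := (closure_minimal hsub hcl) hu
    rw [← integralL_apply e hs]
    exact h1
  have hH1 : (f, g) ∈ Γ.H1 := by
    have hon : ∀ e, IsH1On (Γ.onEdge f e) (g e) 0 (Γ.len e) := fun e =>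
      ⟨Γ.memLp_edgeMeasure_iff.1 (Lp.memLp (u.snd e)), hfg e⟩
    exact Γ.memH1_iff.2 ⟨Γ.continuous_of_onEdge fun e => (hon e).continuousOn (Γ.len_pos e).le, hon⟩
  set w : Γ.H1 := ⟨(f, g), hH1⟩ with hw
  refine ⟨w, ?_⟩
  have hB : Γ.derivToL2 w = u.snd := by
    ext1 e
    exact Lp.toLp_coeFn (u.snd e) (Lp.memLp _)
  have hA : Γ.toL2 w = u.fst := by
    refine eq_of_forall_dist_le fun ε hε => ?_
    set D := √Γ.totalLength * C + 1 with hD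
    have hD0 : 0 < D := by positivity
    obtain ⟨_, ⟨v, rfl⟩, hv⟩ := Metric.mem_closure_iff.1 hu (ε / D) (by positivity)
    rw [dist_eq_norm] at hv ⊢
    have h1 : ‖Γ.toL2 v - u.fst‖ ≤ ε / D := by
      have h2 : Γ.toL2 v - u.fst = (Γ.embed v - u).fst := rfl
      rw [h2]
      refine (WithLp.norm_fst_le _ _).trans ?_
      rw [norm_sub_rev]
      exact hv.le
    have h3 : ‖Γ.toL2 (w - v)‖ ≤ √Γ.totalLength * (C * (ε / D)) := by
      have h4 : ∀ q, |(w - v).1.1 q| ≤ C * (ε / D) := by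
        intro q
        have h5 : (w - v).1.1 q = ev q (u - Γ.embed v) := by
          rw [map_sub, hev]
          rfl
        rw [h5, ← Real.norm_eq_abs]
        exact ((ev q).le_opNorm _).trans (mul_le_mul (hevC q) hv.le (norm_nonneg _) hC0)
      have h6 := norm_toL2_le_of_abs_le h4
      have hL : 0 ≤ Γ.totalLength := Finset.sum_nonneg fun e _ => (Γ.len_pos e).le
      refine le_of_sq_le_sq ?_ (by positivity)
      rwa [mul_pow, Real.sq_sqrt hL]
    calc ‖Γ.toL2 w - u.fst‖ = ‖Γ.toL2 (w - v) + (Γ.toL2 v - u.fst)‖ := by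
          rw [map_sub, sub_add_sub_cancel]
      _ ≤ √Γ.totalLength * (C * (ε / D)) + ε / D := (norm_add_le _ _).trans (add_le_add h3 h1)
      _ = ε := by rw [hD]; field_simp
  change WithLp.toLp 2 (Γ.toL2 w, Γ.derivToL2 w) = u
  rw [hA, hB]
  rfl

end MetricGraph

/-! ### The variational principle -/

namespace MetricGraph

open scoped InnerProductSpace

variable {E : Type*} {Γ : MetricGraph E} [Fintype E]

/-- The weak form of the eigenvalue equation, in terms of inner products in `L²(Γ)`. -/
theorem isEigenfunction_iff {s : ℝ} {f : Γ.Point → ℝ} : Γ.IsEigenfunction s f ↔ f ≠ 0 ∧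
    ∃ w : Γ.H1, w.1.1 = f ∧
      ∀ v : Γ.H1, ⟪Γ.derivToL2 w, Γ.derivToL2 v⟫_ℝ = s * ⟪Γ.toL2 w, Γ.toL2 v⟫_ℝ := by
  have key : ∀ w v : Γ.H1, ∑ e, ∫ x, Γ.onEdge (s • w.1.1) e x * Γ.onEdge v.1.1 e x
      ∂(Γ.edgeMeasure e) = s * ⟪Γ.toL2 w, Γ.toL2 v⟫_ℝ := by
    intro w v
    rw [inner_toL2, Finset.mul_sum]
    refine Finset.sum_congr rfl fun e _ => ?_
    rw [← integral_const_mul]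
    exact integral_congr_ae (Filter.Eventually.of_forall fun x => mul_assoc _ _ _)
  refine and_congr_right fun _ => ⟨?_, ?_⟩
  · rintro ⟨-, f', hf, h⟩
    refine ⟨⟨(f, f'), hf⟩, rfl, fun v => ?_⟩
    rw [← key, inner_derivToL2]
    exact h v.1.1 v.1.2 v.2
  · rintro ⟨w, rfl, h⟩
    refine ⟨fun e => (memLp_fst w.2 e).const_mul s, w.1.2, w.2, fun v v' hv => ?_⟩
    have h1 := h ⟨(v, v'), hv⟩
    rw [← key, inner_derivToL2] at h1
    exact h1

/-- The Hilbert space `H¹(Γ)`. -/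
def Sobolev (Γ : MetricGraph E) : Type _ := LinearMap.range Γ.embed

noncomputable instance : NormedAddCommGroup Γ.Sobolev :=
  inferInstanceAs (NormedAddCommGroup (LinearMap.range Γ.embed))

noncomputable instance : InnerProductSpace ℝ Γ.Sobolev :=
  inferInstanceAs (InnerProductSpace ℝ (LinearMap.range Γ.embed))

instance : CompleteSpace Γ.Sobolev :=
  (isClosed_range_embed Γ).completeSpace_coe

/-- The embedding of `H¹(Γ)` into `L²(Γ)`. -/
noncomputable def embedL (Γ : MetricGraph E) : Γ.Sobolev →L[ℝ] Γ.L2 :=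
  (WithLp.fstL 2 ℝ Γ.L2 Γ.L2) ∘L (LinearMap.range Γ.embed).subtypeL

/-- The element of the Hilbert space given by a function and its derivative. -/
noncomputable def toSobolev (Γ : MetricGraph E) : Γ.H1 →ₗ[ℝ] Γ.Sobolev := Γ.embed.rangeRestrict

theorem toSobolev_surjective : Function.Surjective Γ.toSobolev := by
  rintro ⟨_, w, rfl⟩
  exact ⟨w, rfl⟩

theorem embedL_toSobolev (w : Γ.H1) : Γ.embedL (Γ.toSobolev w) = Γ.toL2 w := rfl

theorem inner_toSobolev (v w : Γ.H1) : ⟪Γ.toSobolev v, Γ.toSobolev w⟫_ℝ =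
    ⟪Γ.toL2 v, Γ.toL2 w⟫_ℝ + ⟪Γ.derivToL2 v, Γ.derivToL2 w⟫_ℝ := rfl

theorem norm_toSobolev_sq (w : Γ.H1) :
    ‖Γ.toSobolev w‖ ^ 2 = ‖Γ.toL2 w‖ ^ 2 + ‖Γ.derivToL2 w‖ ^ 2 := by
  rw [← real_inner_self_eq_norm_sq, inner_toSobolev, real_inner_self_eq_norm_sq,
    real_inner_self_eq_norm_sq]

theorem toSobolev_eq_zero_iff {w : Γ.H1} : Γ.toSobolev w = 0 ↔ w.1.1 = 0 := by
  rw [← embed_eq_zero_iff]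
  exact Subtype.ext_iff

/-- Point evaluations are continuous on `H¹(Γ)`. -/
theorem exists_evalL (Γ : MetricGraph E) (q : Γ.Point) :
    ∃ ev : Γ.Sobolev →L[ℝ] ℝ, ∀ w : Γ.H1, ev (Γ.toSobolev w) = w.1.1 q := by
  obtain ⟨C, -, hev⟩ := exists_eval Γ
  obtain ⟨ev, h, -⟩ := hev q
  exact ⟨ev ∘L (LinearMap.range Γ.embed).subtypeL, h⟩

/-- The embedding of `H¹(Γ)` into `L²(Γ)` is compact: on functions vanishing at sufficiently many
suitable points the `L²` norm is much smaller than the norm of the derivative. -/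
theorem isCompactOperator_embedL [Nonempty E] (hconn : Γ.IsConnected) :
    IsCompactOperator Γ.embedL := by
  have hL : 0 < Γ.totalLength := Finset.sum_pos (fun e _ => Γ.len_pos e) Finset.univ_nonempty
  have hpi := Real.pi_pos
  refine ContinuousLinearMap.isCompactOperator_of_forall_exists _ fun ε hε => ?_
  obtain ⟨k, hk⟩ := exists_nat_ge (2 * Γ.totalLength / (Real.pi * ε) + 2)
  have hk0 : 0 < 2 * Γ.totalLength / (Real.pi * ε) := by positivity
  have hk2' : (2 : ℝ) ≤ k := by linarith
  have hk2 : 2 ≤ k := by exact_mod_cast hk2'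
  have hkpos : (0 : ℝ) < k := by linarith
  set om := Real.pi / (2 * (Γ.totalLength / k)) with hom
  have hom0 : 0 < om := by positivity
  have hom1 : 1 ≤ ε * om := by
    have h1 : 2 * Γ.totalLength / (Real.pi * ε) ≤ k := by linarith
    rw [div_le_iff₀ (by positivity)] at h1
    have h2 : ε * om = k * (Real.pi * ε) / (2 * Γ.totalLength) := by
      rw [hom]; field_simp
    rw [h2, le_div_iff₀ (by positivity)]
    linarith
  obtain ⟨S, hS, hS'⟩ := exists_points hconn (ℓ := Γ.totalLength / k) (by positivity) hk2
    (by field_simp)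
  choose ev hev using exists_evalL Γ
  refine ⟨S.length, ContinuousLinearMap.pi fun i => ev (S.get i), fun u hu => ?_⟩
  obtain ⟨w, rfl⟩ := toSobolev_surjective u
  have h0 : ∀ q ∈ S, w.1.1 q = 0 := by
    intro q hq
    obtain ⟨i, rfl⟩ := List.get_of_mem hq
    rw [← hev]
    exact congrFun hu i
  have h1 := hS' w w.2 h0
  rw [form_eq_inner, real_inner_self_eq_norm_sq, real_inner_self_eq_norm_sq, ← hom] at h1
  have h3 : ‖Γ.derivToL2 w‖ ≤ ‖Γ.toSobolev w‖ :=
    le_of_sq_le_sq (by rw [norm_toSobolev_sq]; linarith [sq_nonneg ‖Γ.toL2 w‖]) (norm_nonneg _)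
  rw [embedL_toSobolev]
  have h2 : om * ‖Γ.toL2 w‖ ≤ ‖Γ.derivToL2 w‖ :=
    le_of_sq_le_sq (by rw [mul_pow]; linarith) (norm_nonneg _)
  calc ‖Γ.toL2 w‖ ≤ (ε * om) * ‖Γ.toL2 w‖ := le_mul_of_one_le_left (norm_nonneg _) hom1
    _ = ε * (om * ‖Γ.toL2 w‖) := by ring
    _ ≤ ε * ‖Γ.toSobolev w‖ := by gcongr; exact h2.trans h3

/-- The variational principle: a `k`-dimensional space on which the Rayleigh quotient is at most `λ`
yields `k` linearly independent eigenfunctions with eigenvalues at most `t`, for every `t > λ`. The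
eigenvalue `s` of the Laplacian corresponds to the eigenvalue `1 / (s + 1)` of the embedding of `H¹(Γ)`
into `L²(Γ)`, composed with its adjoint. -/
theorem exists_eigenfunctions [Nonempty E] (hconn : Γ.IsConnected) {lam t : ℝ} (hlam : 0 ≤ lam)
    (ht : lam < t) {V : Submodule ℝ ((Γ.Point → ℝ) × (E → ℝ → ℝ))} [FiniteDimensional ℝ V]
    (hV : V ≤ Γ.H1) (hneg : ∀ w ∈ V, Γ.form lam w w ≤ 0) (hinj : ∀ w ∈ V, w.1 = 0 → w = 0) {k : ℕ}
    (hk : k ≤ Module.finrank ℝ V) : ∃ f : Fin k → Γ.Point → ℝ, LinearIndependent ℝ f ∧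
      ∀ i, ∃ s ≤ t, Γ.IsEigenfunction s (f i) := by
  let φ : V →ₗ[ℝ] Γ.Sobolev := Γ.toSobolev ∘ₗ Submodule.inclusion hV
  have hφ : Function.Injective φ := by
    rw [← LinearMap.ker_eq_bot, LinearMap.ker_eq_bot']
    intro w hw
    exact Subtype.ext (hinj w w.2 (toSobolev_eq_zero_iff.1 hw))
  have hdim : k ≤ Module.finrank ℝ (LinearMap.range φ) := by
    rwa [LinearMap.finrank_range_of_inj hφ]
  have ht1 : 0 < t + 1 := by linarith
  obtain ⟨v, hvli, hv⟩ := ContinuousLinearMap.exists_eigenvectors (isCompactOperator_embedL hconn)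
    (ν := 1 / (t + 1)) (by positivity) hdim (by
      rintro _ ⟨w, rfl⟩ hne
      set w' := Submodule.inclusion hV w with hw'
      have h1 : Γ.form lam w'.1 w'.1 ≤ 0 := hneg w w.2
      rw [form_eq_inner, real_inner_self_eq_norm_sq, real_inner_self_eq_norm_sq] at h1
      change 1 / (t + 1) * ‖Γ.toSobolev w'‖ ^ 2 < ‖Γ.embedL (Γ.toSobolev w')‖ ^ 2
      rw [embedL_toSobolev]
      have h3 : 0 < ‖Γ.toL2 w'‖ := by
        rw [norm_pos_iff]
        intro h0
        exact hne (toSobolev_eq_zero_iff.2 (eq_zero_of_toL2_eq_zero h0))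
      rw [div_mul_eq_mul_div, one_mul, div_lt_iff₀ ht1, norm_toSobolev_sq]
      nlinarith [pow_pos h3 2])
  choose w hw using fun i => toSobolev_surjective (v i)
  obtain rfl : (fun i => Γ.toSobolev (w i)) = v := funext hw
  choose μ hμ hμ' using hv
  refine ⟨fun i => (w i).1.1, ?_, fun i => ?_⟩
  · rw [Fintype.linearIndependent_iff] at hvli ⊢
    intro c hc
    refine hvli c ?_
    have h1 : Γ.toSobolev (∑ i, c i • w i) = 0 := by
      rw [toSobolev_eq_zero_iff, ← hc]
      simp [Prod.fst_sum]
    simpa only [map_sum, map_smul] using h1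
  · have hμ0 : 0 < μ i := lt_of_lt_of_le (by positivity) (hμ i)
    refine ⟨1 / μ i - 1, ?_, isEigenfunction_iff.2 ⟨?_, w i, rfl, fun u => ?_⟩⟩
    · have := one_div_le_one_div_of_le (by positivity) (hμ i)
      rw [one_div_one_div] at this
      linarith
    · intro h0
      exact hvli.ne_zero i (toSobolev_eq_zero_iff.2 h0)
    · have h2 := hμ' i (Γ.toSobolev u)
      rw [embedL_toSobolev, embedL_toSobolev, inner_toSobolev] at h2
      field_simp
      linarith

end MetricGraph

/-! ### The eigenvalues -/

namespace MetricGraph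

open scoped InnerProductSpace

/-- On a finite-dimensional space every linear map is bounded by any injective one. -/
theorem exists_norm_le_of_injective {V F G : Type*} [AddCommGroup V] [Module ℝ V]
    [FiniteDimensional ℝ V] [NormedAddCommGroup F] [NormedSpace ℝ F] [NormedAddCommGroup G]
    [NormedSpace ℝ G] {a : V →ₗ[ℝ] F} (b : V →ₗ[ℝ] G) (ha : Function.Injective a) :
    ∃ C, ∀ w, ‖b w‖ ≤ C * ‖a w‖ := by
  let a' := LinearEquiv.ofInjective a ha
  let c := LinearMap.toContinuousLinearMap (b ∘ₗ a'.symm.toLinearMap)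
  refine ⟨‖c‖, fun w => ?_⟩
  have h1 := c.le_opNorm (a' w)
  have h2 : c (a' w) = b w := by simp [c]
  rw [h2] at h1
  exact h1

variable {E : Type*} {Γ : MetricGraph E}

/-- A function on an edge which vanishes at its endpoints, extended by zero to the other edges. -/
def extendByZero (Γ : MetricGraph E) [DecidableEq E] (e₀ : E) (F : ℝ → ℝ) (h0 : F 0 = 0)
    (h1 : F (Γ.len e₀) = 0) : Γ.Point → ℝ :=
  Quotient.lift (fun z : Γ.Pre => if z.1 = e₀ then F z.2 else 0) (by
    have key : ∀ s : E × Bool, (if (Γ.endpt s).1 = e₀ then F (Γ.endpt s).2 else 0) = 0 := by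
      rintro ⟨e, b⟩
      by_cases he : e = e₀
      · subst he
        cases b
        · exact (if_pos rfl).trans h0
        · exact (if_pos rfl).trans h1
      · exact if_neg he
    rintro a b (rfl | ⟨s, t, -, rfl, rfl⟩)
    · rfl
    · exact (key s).trans (key t).symm)

theorem extendByZero_ptR [DecidableEq E] {e₀ : E} {F : ℝ → ℝ} (h0 : F 0 = 0)
    (h1 : F (Γ.len e₀) = 0) {e : E} {x : ℝ} (hx : x ∈ Icc 0 (Γ.len e)) :
    Γ.extendByZero e₀ F h0 h1 (Γ.ptR e x) = if e = e₀ then F x else 0 := by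
  rw [ptR, projIcc_of_mem _ hx]
  rfl

/-- A polynomial multiple of `x (l - x)` on an edge `e₀` of length `l`, extended by zero to the other
edges. -/
noncomputable def bump (Γ : MetricGraph E) [DecidableEq E] (e₀ : E) (p : Polynomial ℝ) :
    Γ.Point → ℝ :=
  Γ.extendByZero e₀ (fun x =>
    (Polynomial.X * (Polynomial.C (Γ.len e₀) - Polynomial.X) * p).eval x) (by simp) (by simp)

theorem bump_ptR [DecidableEq E] (e₀ : E) (p : Polynomial ℝ) (e : E) {x : ℝ}
    (hx : x ∈ Icc 0 (Γ.len e)) : Γ.bump e₀ p (Γ.ptR e x) = if e = e₀ then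
      (Polynomial.X * (Polynomial.C (Γ.len e₀) - Polynomial.X) * p).eval x else 0 :=
  extendByZero_ptR _ _ hx

/-- The space `H¹(Γ)` is infinite-dimensional: it contains polynomials, cut off at the endpoints of a
single edge. -/
theorem exists_submodule_finrank_eq [Nonempty E] (Γ : MetricGraph E) (k : ℕ) :
    ∃ V : Submodule ℝ ((Γ.Point → ℝ) × (E → ℝ → ℝ)), FiniteDimensional ℝ V ∧ V ≤ Γ.H1 ∧
      (∀ w ∈ V, w.1 = 0 → w = 0) ∧ Module.finrank ℝ V = k := by
  classical
  obtain ⟨e₀⟩ := ‹Nonempty E›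
  set q : Polynomial ℝ := Polynomial.X * (Polynomial.C (Γ.len e₀) - Polynomial.X) with hq
  have hq0 : q ≠ 0 := by
    refine mul_ne_zero Polynomial.X_ne_zero fun h => ?_
    have := congrArg (Polynomial.eval 0) h
    simp at this
    exact (Γ.len_pos e₀).ne' this
  let φ : Polynomial ℝ →ₗ[ℝ] (Γ.Point → ℝ) × (E → ℝ → ℝ) :=
    { toFun := fun p => (Γ.bump e₀ p, fun e x => if e = e₀ then (Polynomial.derivative (q * p)).eval x else 0)
      map_add' := fun p p' => by
        refine Prod.ext (funext fun z => ?_) (funext fun e => funext fun x => ?_)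
        · obtain ⟨e, x, hx, rfl⟩ := Γ.exists_eq_ptR z
          simp only [Prod.fst_add, Pi.add_apply, bump_ptR _ _ _ hx, mul_add, Polynomial.eval_add]
          split_ifs <;> simp
        · simp only [Prod.snd_add, Pi.add_apply, mul_add, map_add, Polynomial.eval_add]
          split_ifs <;> simp
      map_smul' := fun c p => by
        refine Prod.ext (funext fun z => ?_) (funext fun e => funext fun x => ?_)
        · obtain ⟨e, x, hx, rfl⟩ := Γ.exists_eq_ptR z
          simp only [Prod.smul_fst, Pi.smul_apply, bump_ptR _ _ _ hx, mul_smul_comm,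
            Polynomial.eval_smul, RingHom.id_apply]
          split_ifs <;> simp
        · simp only [Prod.smul_snd, Pi.smul_apply, mul_smul_comm, Polynomial.derivative_smul,
            Polynomial.eval_smul, RingHom.id_apply]
          split_ifs <;> simp }
  have hinj : ∀ p, (φ p).1 = 0 → p = 0 := by
    intro p hp
    have h1 : ∀ x ∈ Icc 0 (Γ.len e₀), (q * p).IsRoot x := by
      intro x hx
      have h2 := congrFun hp (Γ.ptR e₀ x)
      have h3 := bump_ptR (Γ := Γ) e₀ p e₀ hx
      rw [if_pos rfl] at h3
      exact h3.symm.trans h2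
    have h2 := Polynomial.eq_zero_of_infinite_isRoot _
      ((Icc_infinite (Γ.len_pos e₀)).mono h1)
    exact (mul_eq_zero.1 h2).resolve_left hq0
  have hφ : Function.Injective φ := by
    rw [← LinearMap.ker_eq_bot, LinearMap.ker_eq_bot']
    exact fun p hp => hinj p (by rw [hp]; rfl)
  refine ⟨(Polynomial.degreeLT ℝ k).map φ, ?_, ?_, ?_, ?_⟩
  · have : FiniteDimensional ℝ (Polynomial.degreeLT ℝ k) :=
      (Polynomial.degreeLTEquiv ℝ k).symm.finiteDimensional
    infer_instance
  · rintro _ ⟨p, -, rfl⟩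
    have hon : ∀ e, IsH1On (Γ.onEdge (φ p).1 e) ((φ p).2 e) 0 (Γ.len e) := by
      intro e
      by_cases he : e = e₀
      · subst he
        refine (IsH1On.of_continuousOn (F := fun x => (q * p).eval x)
          (G := fun x => (Polynomial.derivative (q * p)).eval x)
          (fun x _ => (q * p).hasDerivAt x) (Polynomial.continuous _).continuousOn).congr
          (fun s hs => ?_) fun s _ => if_pos rfl
        exact (bump_ptR e p e hs).trans (if_pos rfl)
      · refine (⟨MemLp.zero, fun s _ => by simp⟩ : IsH1On (fun _ => (0 : ℝ)) 0 0 (Γ.len e)).congr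
          (fun s hs => ?_) fun s _ => if_neg he
        exact (bump_ptR e₀ p e hs).trans (if_neg he)
    exact Γ.memH1_iff.2 ⟨Γ.continuous_of_onEdge fun e => (hon e).continuousOn (Γ.len_pos e).le, hon⟩
  · rintro _ ⟨p, -, rfl⟩ h0
    rw [hinj p h0, map_zero]
  · rw [← (Submodule.equivMapOfInjective φ hφ _).finrank_eq,
      (Polynomial.degreeLTEquiv ℝ k).finrank_eq, Module.finrank_fin_fun]

variable [Fintype E]

/-- The numbers `t` such that there are `k` linearly independent eigenfunctions with eigenvalues at
most `t`. -/
def spectralBounds (Γ : MetricGraph E) (k : ℕ) : Set ℝ :=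
  {t : ℝ | ∃ f : Fin k → Γ.Point → ℝ, LinearIndependent ℝ f ∧
    ∀ i, ∃ s ≤ t, Γ.IsEigenfunction s (f i)}

/-- Eigenfunctions with different eigenvalues are orthogonal. -/
theorem inner_eq_zero_of_eigenvalue_ne {s s' : ℝ} {w w' : Γ.H1}
    (h : ∀ v : Γ.H1, ⟪Γ.derivToL2 w, Γ.derivToL2 v⟫_ℝ = s * ⟪Γ.toL2 w, Γ.toL2 v⟫_ℝ)
    (h' : ∀ v : Γ.H1, ⟪Γ.derivToL2 w', Γ.derivToL2 v⟫_ℝ = s' * ⟪Γ.toL2 w', Γ.toL2 v⟫_ℝ)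
    (hne : s ≠ s') : ⟪Γ.toL2 w, Γ.toL2 w'⟫_ℝ = 0 := by
  have h1 := h w'
  have h2 := h' w
  rw [real_inner_comm, h2, real_inner_comm] at h1
  have h3 : (s - s') * ⟪Γ.toL2 w, Γ.toL2 w'⟫_ℝ = 0 := by linarith
  exact (mul_eq_zero.1 h3).resolve_left (sub_ne_zero.2 hne)

/-- Eigenvalues are nonnegative. -/
theorem IsEigenfunction.nonneg {s : ℝ} {f : Γ.Point → ℝ} (h : Γ.IsEigenfunction s f) : 0 ≤ s := by
  obtain ⟨hf, w, rfl, hw⟩ := isEigenfunction_iff.1 h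
  have h1 := hw w
  have h2 : 0 < ⟪Γ.toL2 w, Γ.toL2 w⟫_ℝ :=
    real_inner_self_pos.2 fun h0 => hf (eq_zero_of_toL2_eq_zero h0)
  by_contra! hs
  have h3 : 0 ≤ ⟪Γ.derivToL2 w, Γ.derivToL2 w⟫_ℝ := real_inner_self_nonneg
  nlinarith

/-- On linear combinations of eigenfunctions with eigenvalues `s i ≤ t` the form `a - t` is
nonpositive: by orthogonality of the eigenfunctions it is equal to
`-‖∑ i, c i • √(t - s i) • w i‖²`. -/
theorem form_sum_nonpos {k : ℕ} {t : ℝ} {s : Fin k → ℝ} (hs : ∀ i, s i ≤ t) {w : Fin k → Γ.H1}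
    (hw : ∀ i, ∀ v : Γ.H1,
      ⟪Γ.derivToL2 (w i), Γ.derivToL2 v⟫_ℝ = s i * ⟪Γ.toL2 (w i), Γ.toL2 v⟫_ℝ) (c : Fin k → ℝ) :
    Γ.form t (∑ i, c i • w i : Γ.H1) (∑ i, c i • w i : Γ.H1) ≤ 0 := by
  have h1 : ∀ i j, (s i - t) * ⟪Γ.toL2 (w i), Γ.toL2 (w j)⟫_ℝ =
      -(√(t - s i) * √(t - s j) * ⟪Γ.toL2 (w i), Γ.toL2 (w j)⟫_ℝ) := by
    intro i j
    by_cases hij : s i = s j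
    · rw [← hij, Real.mul_self_sqrt (by linarith [hs i])]
      ring
    · rw [inner_eq_zero_of_eigenvalue_ne (hw i) (hw j) hij]
      ring
  have h2 : Γ.form t (∑ i, c i • w i : Γ.H1) (∑ i, c i • w i : Γ.H1) =
      -⟪∑ i, (c i * √(t - s i)) • Γ.toL2 (w i), ∑ i, (c i * √(t - s i)) • Γ.toL2 (w i)⟫_ℝ := by
    rw [form_eq_inner]
    simp only [map_sum, map_smul, sum_inner, inner_sum, inner_smul_left, inner_smul_right,
      Finset.mul_sum, ← Finset.sum_sub_distrib, ← Finset.sum_neg_distrib, conj_trivial]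
    refine Finset.sum_congr rfl fun i _ => Finset.sum_congr rfl fun j _ => ?_
    rw [hw j (w i)]
    have := h1 j i
    linear_combination (c i * c j) * this
  rw [h2]
  exact neg_nonpos.2 real_inner_self_nonneg

/-- The span of eigenfunctions, as a space of functions in `H¹` together with their derivatives. -/
theorem exists_submodule_of_eigenfunctions {k : ℕ} {t : ℝ} {f : Fin k → Γ.Point → ℝ}
    (hf : LinearIndependent ℝ f) (h : ∀ i, ∃ s ≤ t, Γ.IsEigenfunction s (f i)) :
    ∃ V : Submodule ℝ ((Γ.Point → ℝ) × (E → ℝ → ℝ)), FiniteDimensional ℝ V ∧ V ≤ Γ.H1 ∧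
      (∀ w ∈ V, Γ.form t w w ≤ 0) ∧ (∀ w ∈ V, w.1 = 0 → w = 0) ∧ Module.finrank ℝ V = k ∧
      ∀ i, ∃ w ∈ V, w.1 = f i := by
  choose s hs hE using h
  choose hne w hwf hw using fun i => isEigenfunction_iff.1 (hE i)
  have hli : LinearIndependent ℝ fun i => ((w i : Γ.H1) : (Γ.Point → ℝ) × (E → ℝ → ℝ)) := by
    refine LinearIndependent.of_comp (LinearMap.fst ℝ _ _) ?_
    convert hf using 1
    exact funext hwf
  have hmem : ∀ v ∈ Submodule.span ℝ (range fun i => ((w i : Γ.H1) : (Γ.Point → ℝ) × (E → ℝ → ℝ))),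
      ∃ c : Fin k → ℝ, v = (∑ i, c i • w i : Γ.H1) := by
    intro v hv
    obtain ⟨c, rfl⟩ := (Submodule.mem_span_range_iff_exists_fun ℝ).1 hv
    exact ⟨c, by simp⟩
  refine ⟨_, FiniteDimensional.span_of_finite ℝ (finite_range _), ?_, ?_, ?_,
    (finrank_span_eq_card hli).trans (Fintype.card_fin k),
    fun i => ⟨w i, Submodule.subset_span ⟨i, rfl⟩, hwf i⟩⟩
  · rw [Submodule.span_le]
    rintro _ ⟨i, rfl⟩
    exact (w i).2
  · intro v hv
    obtain ⟨c, rfl⟩ := hmem v hv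
    exact form_sum_nonpos hs hw c
  · intro v hv h0
    obtain ⟨c, rfl⟩ := hmem v hv
    have h1 : ∑ i, c i • f i = 0 := by
      rw [← h0]
      simp [Prod.fst_sum, hwf]
    have h2 := Fintype.linearIndependent_iff.1 hf c h1
    simp [h2]

/-- Eigenfunctions with different eigenvalues are linearly independent. -/
theorem linearIndependent_of_eigenvalue_injective {ι : Type*} [Fintype ι] {s : ι → ℝ}
    (hs : Function.Injective s) {f : ι → Γ.Point → ℝ} (h : ∀ i, Γ.IsEigenfunction (s i) (f i)) :
    LinearIndependent ℝ f := by
  choose hne w hwf hw using fun i => isEigenfunction_iff.1 (h i)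
  have h1 : LinearIndependent ℝ fun i => Γ.toL2 (w i) :=
    linearIndependent_of_ne_zero_of_inner_eq_zero
      (fun i h0 => hne i (hwf i ▸ eq_zero_of_toL2_eq_zero h0))
      fun i j hij => inner_eq_zero_of_eigenvalue_ne (hw i) (hw j) (hs.ne hij)
  rw [Fintype.linearIndependent_iff] at h1 ⊢
  intro c hc
  refine h1 c ?_
  have h2 : Γ.toSobolev (∑ i, c i • w i) = 0 := by
    rw [toSobolev_eq_zero_iff, ← hc]
    simp [Prod.fst_sum, hwf]
  have h3 := congrArg Γ.embedL h2
  rw [embedL_toSobolev, map_zero] at h3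
  simpa only [map_sum, map_smul] using h3

/-- The lower bound: among the combinations of `k` eigenfunctions there is one with zeros at `k - 1`
given points. -/
theorem le_of_mem_spectralBounds [Nonempty E] (hconn : Γ.IsConnected) {k : ℕ} (hk : 2 ≤ k) {t : ℝ}
    (ht : t ∈ Γ.spectralBounds k) : (Real.pi / (2 * (Γ.totalLength / k))) ^ 2 ≤ t := by
  have hL : 0 < Γ.totalLength := Finset.sum_pos (fun e _ => Γ.len_pos e) Finset.univ_nonempty
  have hk0 : (0 : ℝ) < k := by exact_mod_cast (by omega : 0 < k)
  obtain ⟨f, hf, hE⟩ := ht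
  obtain ⟨V, hfin, hV, hneg, hinj, hdim, -⟩ := exists_submodule_of_eigenfunctions hf hE
  obtain ⟨S, hS, hS'⟩ := exists_points hconn (ℓ := Γ.totalLength / k) (by positivity) hk
    (by field_simp)
  obtain ⟨w, hw, hw0, hwS⟩ := exists_ne_zero_of_length_lt V S (by omega)
  have h1 := hS' w (hV hw) hwS
  have h2 := hneg w hw
  have e1 := form_eq_inner ((Real.pi / (2 * (Γ.totalLength / k))) ^ 2) ⟨w, hV hw⟩ ⟨w, hV hw⟩
  have e2 := form_eq_inner t ⟨w, hV hw⟩ ⟨w, hV hw⟩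
  have h3 : 0 < ⟪Γ.toL2 ⟨w, hV hw⟩, Γ.toL2 ⟨w, hV hw⟩⟫_ℝ :=
    real_inner_self_pos.2 fun h0 => hw0 (hinj w hw (eq_zero_of_toL2_eq_zero h0))
  refine le_of_mul_le_mul_right ?_ h3
  dsimp only at e1 e2
  linarith

/-- There are at least `k` eigenvalues. -/
theorem spectralBounds_nonempty [Nonempty E] (hconn : Γ.IsConnected) (k : ℕ) :
    (Γ.spectralBounds k).Nonempty := by
  obtain ⟨V, hfin, hV, hinj, hdim⟩ := exists_submodule_finrank_eq Γ k
  have hinj' : Function.Injective (Γ.toL2 ∘ₗ Submodule.inclusion hV) := by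
    rw [← LinearMap.ker_eq_bot, LinearMap.ker_eq_bot']
    intro w hw
    exact Subtype.ext (hinj w w.2 (eq_zero_of_toL2_eq_zero (w := Submodule.inclusion hV w) hw))
  obtain ⟨C, hC⟩ := exists_norm_le_of_injective (Γ.derivToL2 ∘ₗ Submodule.inclusion hV) hinj'
  refine ⟨C ^ 2 + 1, exists_eigenfunctions hconn (sq_nonneg C) (lt_add_one _) hV (fun w hw => ?_)
    hinj hdim.ge⟩
  have h1 := form_eq_inner (C ^ 2) ⟨w, hV hw⟩ ⟨w, hV hw⟩
  have h2 : ‖Γ.derivToL2 ⟨w, hV hw⟩‖ ≤ C * ‖Γ.toL2 ⟨w, hV hw⟩‖ := hC ⟨w, hw⟩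
  have h3 := pow_le_pow_left₀ (norm_nonneg _) h2 2
  rw [real_inner_self_eq_norm_sq, real_inner_self_eq_norm_sq] at h1
  rw [mul_pow] at h3
  dsimp only at h1
  linarith

/-- There are only finitely many eigenvalues below a given bound, since `n` of them would imply a lower
bound which grows with `n`. -/
theorem finite_eigenvalues_le [Nonempty E] (hconn : Γ.IsConnected) (t : ℝ) :
    {s | s ≤ t ∧ ∃ f, Γ.IsEigenfunction s f}.Finite := by
  by_contra hinf
  have hL : 0 < Γ.totalLength := Finset.sum_pos (fun e _ => Γ.len_pos e) Finset.univ_nonempty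
  have hpi := Real.pi_pos
  obtain ⟨n, hn⟩ := exists_nat_gt ((2 * Γ.totalLength / Real.pi) * (|t| + 1) + 2)
  have h0 : 0 ≤ (2 * Γ.totalLength / Real.pi) * (|t| + 1) := by positivity
  have hn2' : (2 : ℝ) ≤ n := by linarith
  have hn2 : 2 ≤ n := by exact_mod_cast hn2'
  obtain ⟨S, hS, hcard⟩ := Set.Infinite.exists_subset_card_eq hinf n
  let g : Fin n ≃ S := (Finset.equivFinOfCardEq hcard).symm
  have hg : ∀ i, ∃ f, Γ.IsEigenfunction (g i : ℝ) f := fun i => (hS (g i).2).2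
  choose f hf using hg
  have h1 := le_of_mem_spectralBounds hconn hn2 (t := t)
    ⟨f, linearIndependent_of_eigenvalue_injective (Subtype.val_injective.comp g.injective) hf,
      fun i => ⟨g i, (hS (g i).2).1, hf i⟩⟩
  have h2 : |t| + 1 < Real.pi / (2 * (Γ.totalLength / n)) := by
    have h3 : Real.pi / (2 * (Γ.totalLength / n)) = n / (2 * Γ.totalLength / Real.pi) := by
      field_simp
    rw [h3, lt_div_iff₀ (by positivity), mul_comm]
    linarith
  have h3 : (|t| + 1) ^ 2 < (Real.pi / (2 * (Γ.totalLength / n))) ^ 2 :=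
    pow_lt_pow_left₀ h2 (by positivity) two_ne_zero
  nlinarith [le_abs_self t, abs_nonneg t]

/-- The infimum in the definition of the eigenvalues is attained. -/
theorem eigenvalue_mem_spectralBounds [Nonempty E] (hconn : Γ.IsConnected) {k : ℕ} (hk : 0 < k) :
    Γ.eigenvalue k ∈ Γ.spectralBounds k := by
  have : Nonempty (Fin k) := ⟨⟨0, hk⟩⟩
  -- a bound can be lowered to an eigenvalue
  have key : ∀ t ∈ Γ.spectralBounds k, ∃ s ≤ t, s ∈ Γ.spectralBounds k ∧
      ∃ f, Γ.IsEigenfunction s f := by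
    rintro t ⟨f, hf, h⟩
    choose s hs hE using h
    obtain ⟨i, hi⟩ := Finite.exists_max s
    exact ⟨s i, hs i, ⟨f, hf, fun j => ⟨s j, hi j, hE j⟩⟩, f i, hE i⟩
  obtain ⟨t₀, ht₀⟩ := spectralBounds_nonempty hconn k
  have hfin : {s | s ∈ Γ.spectralBounds k ∧ s ≤ t₀ ∧ ∃ f, Γ.IsEigenfunction s f}.Finite :=
    (finite_eigenvalues_le hconn t₀).subset fun s hs => hs.2
  obtain ⟨s₀, h1, h2, h3⟩ := key t₀ ht₀
  obtain ⟨m, hm, hmin⟩ := Set.exists_min_image _ id hfin ⟨s₀, h2, h1, h3⟩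
  have hleast : IsLeast (Γ.spectralBounds k) m := by
    refine ⟨hm.1, fun t ht => ?_⟩
    rcases le_total t t₀ with hle | hle
    · obtain ⟨s, h4, h5, h6⟩ := key t ht
      exact (hmin s ⟨h5, h4.trans hle, h6⟩).trans h4
    · exact hm.2.1.trans hle
  have : Γ.eigenvalue k = m := hleast.csInf_eq
  exact this ▸ hm.1

theorem bddBelow_spectralBounds {k : ℕ} (hk : 0 < k) : BddBelow (Γ.spectralBounds k) := by
  refine ⟨0, ?_⟩
  rintro t ⟨f, -, h⟩
  obtain ⟨s, hs, hE⟩ := h ⟨0, hk⟩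
  exact hE.nonneg.trans hs

/-- The constant functions are eigenfunctions with eigenvalue `0`. -/
theorem isEigenfunction_one [Nonempty E] (Γ : MetricGraph E) : Γ.IsEigenfunction 0 1 := by
  refine isEigenfunction_iff.2 ⟨fun h => ?_, ⟨(1, 0), Γ.memH1_iff.2 ⟨continuous_const, fun e =>
    ⟨MemLp.zero, fun s _ => by simp [onEdge]⟩⟩⟩, rfl, fun v => ?_⟩
  · obtain ⟨e⟩ := ‹Nonempty E›
    exact one_ne_zero (congrFun h (Γ.ptR e 0))
  · rw [inner_derivToL2]
    simp

theorem eigenvalue_one [Nonempty E] (Γ : MetricGraph E) : Γ.eigenvalue 1 = 0 := by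
  have hone : (1 : Γ.Point → ℝ) ≠ 0 := (isEigenfunction_one Γ).1
  refine IsLeast.csInf_eq ⟨⟨fun _ => 1, ?_, fun _ => ⟨0, le_rfl, isEigenfunction_one Γ⟩⟩, ?_⟩
  · exact linearIndependent_unique_iff.2 hone
  · rintro t ⟨f, -, h⟩
    obtain ⟨s, hs, hE⟩ := h 0
    exact hE.nonneg.trans hs

/-- The extremal case. Here the eigenfunctions have no common zero, as otherwise a constant function
could be added to them, contradicting the bound for the next eigenvalue. -/
theorem isIsometric_of_mem_spectralBounds [Nonempty E] (hconn : Γ.IsConnected) {L : ℝ} (hL : 0 < L)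
    (hlen : Γ.totalLength = L) {k : ℕ} (hk : 2 ≤ k)
    (h : (Real.pi / (2 * (L / k))) ^ 2 ∈ Γ.spectralBounds k) :
    Γ.IsIsometric (equilateralStar k L (zero_lt_two.trans_le hk) hL) := by
  obtain ⟨f, hf, hE⟩ := h
  obtain ⟨V, hfin, hV, hneg, hinj, hdim, hVf⟩ := exists_submodule_of_eigenfunctions hf hE
  refine isIsometric_equilateralStar hconn hL hlen hk hV hneg hinj hdim.ge fun q => ?_
  by_contra! hcon
  have hpi := Real.pi_pos
  have hk0 : (0 : ℝ) < k := by exact_mod_cast (by omega : 0 < k)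
  have hq : ∀ i, f i q = 0 := fun i => by
    obtain ⟨w, hw, hwf⟩ := hVf i
    rw [← hwf]
    exact hcon w hw
  have hli : LinearIndependent ℝ (Fin.cons 1 f : Fin (k + 1) → Γ.Point → ℝ) := by
    refine linearIndependent_finCons.2 ⟨hf, fun h1 => ?_⟩
    obtain ⟨c, hc⟩ := (Submodule.mem_span_range_iff_exists_fun ℝ).1 h1
    have := congrFun hc q
    simp [hq] at this
  have h1 := le_of_mem_spectralBounds hconn (k := k + 1) (by omega)
    (t := (Real.pi / (2 * (L / k))) ^ 2) ⟨_, hli, fun i => by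
      induction i using Fin.cases with
      | zero => exact ⟨0, sq_nonneg _, isEigenfunction_one Γ⟩
      | succ i => exact hE i⟩
  rw [hlen] at h1
  have h2 : Real.pi / (2 * (L / k)) < Real.pi / (2 * (L / ((k + 1 : ℕ) : ℝ))) := by
    have e1 : Real.pi / (2 * (L / k)) = Real.pi / (2 * L) * k := by field_simp
    have e2 : Real.pi / (2 * (L / ((k + 1 : ℕ) : ℝ))) = Real.pi / (2 * L) * (k + 1) := by
      push_cast; field_simp
    rw [e1, e2]
    exact mul_lt_mul_of_pos_left (lt_add_one _) (by positivity)
  have h3 := pow_lt_pow_left₀ h2 (by positivity) two_ne_zero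
  linarith

end MetricGraph

/-! ### Graphs isometric to a star -/

namespace MetricGraph

open scoped InnerProductSpace

variable {E : Type*} {Γ : MetricGraph E}

/-- Points of an edge which are closer to each other than one of them is to the endpoints have the
same distance in the graph as on the edge. The lower bound comes from a tent function on the edge. -/
theorem edist_ptR_eq (e : E) {x y : ℝ} (hx : x ∈ Icc 0 (Γ.len e)) (h0 : |x - y| ≤ y)
    (h1 : |x - y| ≤ Γ.len e - y) : Γ.edist (Γ.ptR e x) (Γ.ptR e y) = ENNReal.ofReal |x - y| := by
  classical
  have hy : y ∈ Icc 0 (Γ.len e) := ⟨(abs_nonneg _).trans h0, by linarith [abs_nonneg (x - y)]⟩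
  refine le_antisymm (Γ.edist_ptR_le e hx hy) ?_
  set F : ℝ → ℝ := fun z => max 0 (|x - y| - |z - y|) with hF
  have hF0 : F 0 = 0 := by
    rw [hF]; dsimp only
    rw [zero_sub, abs_neg, abs_of_nonneg hy.1, max_eq_left (by linarith)]
  have hF1 : F (Γ.len e) = 0 := by
    rw [hF]; dsimp only
    rw [abs_of_nonneg (by linarith [hy.2] : 0 ≤ Γ.len e - y), max_eq_left (by linarith)]
  have hFlip : ∀ a b, |F a - F b| ≤ |a - b| := by
    intro a b
    refine (abs_max_sub_max_le_max _ _ _ _).trans (max_le (by simp) ?_)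
    have h2 := abs_abs_sub_abs_le_abs_sub (b - y) (a - y)
    have h3 : |x - y| - |a - y| - (|x - y| - |b - y|) = |b - y| - |a - y| := by ring
    have h4 : b - y - (a - y) = -(a - b) := by ring
    rw [h3]
    rwa [h4, abs_neg] at h2
  set T := Γ.extendByZero e F hF0 hF1 with hT
  have h2 := le_edist_of_edge Γ (d := fun p q => ENNReal.ofReal |T p - T q|) (by simp)
    (fun p q r => by
      rw [← ENNReal.ofReal_add (abs_nonneg _) (abs_nonneg _)]
      exact ENNReal.ofReal_le_ofReal (abs_sub_le _ _ _)) (fun e' a b => by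
      refine ENNReal.ofReal_le_ofReal ?_
      rw [← Γ.ptR_coe, ← Γ.ptR_coe, hT, extendByZero_ptR _ _ a.2, extendByZero_ptR _ _ b.2]
      split_ifs
      · exact hFlip _ _
      · simp) (Γ.ptR e x) (Γ.ptR e y)
  rw [hT, extendByZero_ptR _ _ hx, extendByZero_ptR _ _ hy, if_pos rfl, if_pos rfl] at h2
  refine le_trans ?_ h2
  simp [hF]

variable {k : ℕ} {L : ℝ} {hk : 0 < k} {hL : 0 < L}

/-- The coordinate on the leg `i` of the star, extended by zero to the other legs. -/
noncomputable def legCoord (hk : 0 < k) (hL : 0 < L) (i : Fin k) :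
    (equilateralStar k L hk hL).Point → ℝ :=
  Quotient.lift (fun z : (equilateralStar k L hk hL).Pre => if z.1 = i then (z.2 : ℝ) else 0) (by
    rintro a b (rfl | ⟨s, t, h, rfl, rfl⟩)
    · rfl
    · rcases h with rfl | ⟨h, h'⟩
      · rfl
      · obtain ⟨s, _⟩ := s
        obtain ⟨t, _⟩ := t
        obtain rfl : _ = false := h
        obtain rfl : _ = false := h'
        simp [endpt])

theorem legCoord_ptR (i j : Fin k) {y : ℝ} (hy : y ∈ Icc 0 (L / k)) :
    legCoord hk hL i ((equilateralStar k L hk hL).ptR j y) = if j = i then y else 0 := by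
  rw [ptR, projIcc_of_mem _ (show y ∈ Icc 0 ((equilateralStar k L hk hL).len j) from hy)]
  rfl

theorem legCoord_mem (i : Fin k) (p : (equilateralStar k L hk hL).Point) :
    legCoord hk hL i p ∈ Icc 0 (L / k) := by
  obtain ⟨j, y, hy, rfl⟩ := (equilateralStar k L hk hL).exists_eq_ptR p
  rw [legCoord_ptR i j hy]
  split_ifs
  · exact hy
  · exact ⟨le_rfl, hy.1.trans hy.2⟩

theorem eq_ptR_of_legCoord_pos {i : Fin k} {p : (equilateralStar k L hk hL).Point}
    (h : 0 < legCoord hk hL i p) :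
    p = (equilateralStar k L hk hL).ptR i (legCoord hk hL i p) := by
  obtain ⟨j, y, hy, rfl⟩ := (equilateralStar k L hk hL).exists_eq_ptR p
  rw [legCoord_ptR i j hy] at h ⊢
  split_ifs at h ⊢ with hji
  · rw [hji]
  · exact absurd h (lt_irrefl _)

theorem legCoord_eq_zero_of_pos {i j : Fin k} (hij : i ≠ j)
    {p : (equilateralStar k L hk hL).Point} (h : 0 < legCoord hk hL i p) :
    legCoord hk hL j p = 0 := by
  rw [eq_ptR_of_legCoord_pos h, legCoord_ptR j i (legCoord_mem i p), if_neg hij]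

/-- The coordinate on a leg is `1`-Lipschitz. -/
theorem ofReal_abs_legCoord_sub_le (i : Fin k) (p q : (equilateralStar k L hk hL).Point) :
    ENNReal.ofReal |legCoord hk hL i p - legCoord hk hL i q| ≤
      (equilateralStar k L hk hL).edist p q := by
  refine le_edist_of_edge _
    (d := fun p q => ENNReal.ofReal |legCoord hk hL i p - legCoord hk hL i q|) (by simp)
    (fun p q r => ?_) (fun j a b => ENNReal.ofReal_le_ofReal ?_) p q
  · rw [← ENNReal.ofReal_add (abs_nonneg _) (abs_nonneg _)]
    exact ENNReal.ofReal_le_ofReal (abs_sub_le _ _ _)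
  · rw [← ptR_coe, ← ptR_coe, legCoord_ptR i j a.2, legCoord_ptR i j b.2]
    split_ifs
    · exact le_rfl
    · simp

variable {Φ : Γ.Point ≃ (equilateralStar k L hk hL).Point}

theorem abs_legCoord_sub_le
    (hΦ : ∀ p q, (equilateralStar k L hk hL).edist (Φ p) (Φ q) = Γ.edist p q) (e : E) (i : Fin k)
    (x y : ℝ) :
    |legCoord hk hL i (Φ (Γ.ptR e x)) - legCoord hk hL i (Φ (Γ.ptR e y))| ≤ |x - y| := by
  have h1 := (ofReal_abs_legCoord_sub_le i (Φ (Γ.ptR e x)) (Φ (Γ.ptR e y))).trans_eq (hΦ _ _)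
  have h2 := h1.trans (Γ.edist_pt_le e _ _)
  rw [ENNReal.ofReal_le_ofReal_iff (abs_nonneg _)] at h2
  exact h2.trans (abs_projIcc_sub_projIcc _)

/-- At a point which corresponds to a point of the leg `i`, the coordinate on this leg has derivative
`1` or `-1`: near the point, both the distance on the edge and the distance on the leg are equal to
the distances in the graphs. -/
theorem exists_hasDerivAt_legCoord
    (hΦ : ∀ p q, (equilateralStar k L hk hL).edist (Φ p) (Φ q) = Γ.edist p q) {e : E} {i : Fin k}
    {x : ℝ} (hx : x ∈ Ioo 0 (Γ.len e)) (hpos : 0 < legCoord hk hL i (Φ (Γ.ptR e x))) :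
    ∃ s : ℝ, s ^ 2 = 1 ∧ HasDerivAt (fun x => legCoord hk hL i (Φ (Γ.ptR e x))) s x := by
  set δ : ℝ → ℝ := fun x => legCoord hk hL i (Φ (Γ.ptR e x)) with hδ
  have hlip : ∀ x y, |δ x - δ y| ≤ |x - y| := abs_legCoord_sub_le hΦ e i
  obtain ⟨r, hr0, hr⟩ : ∃ r > 0, r < x / 3 ∧ r < (Γ.len e - x) / 3 ∧ r < δ x := by
    have h1 : 0 < min (min (x / 3) ((Γ.len e - x) / 3)) (δ x) :=
      lt_min (lt_min (by linarith [hx.1]) (by linarith [hx.2])) hpos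
    obtain ⟨r, hr, hr'⟩ := exists_between h1
    exact ⟨r, hr, hr'.trans_le ((min_le_left _ _).trans (min_le_left _ _)),
      hr'.trans_le ((min_le_left _ _).trans (min_le_right _ _)), hr'.trans_le (min_le_right _ _)⟩
  have hδpos : ∀ y ∈ Icc (x - r) (x + r), 0 < δ y := by
    intro y hy
    have h1 := (le_abs_self _).trans (hlip x y)
    have h2 : |x - y| ≤ r := abs_le.2 ⟨by linarith [hy.2], by linarith [hy.1]⟩
    linarith
  have hiso : ∀ y ∈ Icc (x - r) (x + r), ∀ z ∈ Icc (x - r) (x + r), |δ y - δ z| = |y - z| := by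
    intro y hy z hz
    have h2 : |y - z| ≤ 2 * r :=
      abs_le.2 ⟨by linarith [hy.1, hz.2], by linarith [hy.2, hz.1]⟩
    have h3 := edist_ptR_eq (Γ := Γ) e (x := y) (y := z) ⟨by linarith [hy.1], by linarith [hy.2]⟩
      (by linarith [hz.1]) (by linarith [hz.2])
    refine le_antisymm (hlip y z) ?_
    rw [← ENNReal.ofReal_le_ofReal_iff (abs_nonneg _), ← h3, ← hΦ,
      eq_ptR_of_legCoord_pos (hδpos y hy), eq_ptR_of_legCoord_pos (hδpos z hz)]
    exact edist_ptR_le _ i (legCoord_mem i _) (legCoord_mem i _)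
  have ha : x - r ∈ Icc (x - r) (x + r) := ⟨le_rfl, by linarith⟩
  have hb : x + r ∈ Icc (x - r) (x + r) := ⟨by linarith, le_rfl⟩
  have hab := hiso (x + r) hb (x - r) ha
  rw [show x + r - (x - r) = 2 * r by ring, abs_of_pos (by linarith : 0 < 2 * r)] at hab
  obtain ⟨s, hs, hsab⟩ : ∃ s : ℝ, s ^ 2 = 1 ∧ s * (δ (x + r) - δ (x - r)) = 2 * r := by
    rcases abs_choice (δ (x + r) - δ (x - r)) with h | h
    · exact ⟨1, by norm_num, by linarith⟩
    · exact ⟨-1, by norm_num, by linarith⟩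
  have hs1 : |s| = 1 := by
    have := congrArg Real.sqrt hs
    rwa [Real.sqrt_sq_eq_abs, Real.sqrt_one] at this
  refine ⟨s, hs, ?_⟩
  -- an isometry of an interval into the line is affine
  have hlin : ∀ y ∈ Icc (x - r) (x + r), δ y = δ (x - r) + s * (y - (x - r)) := by
    intro y hy
    have h1 := hiso y hy (x - r) ha
    have h2 := hiso (x + r) hb y hy
    rw [abs_of_nonneg (by linarith [hy.1] : 0 ≤ y - (x - r))] at h1
    rw [abs_of_nonneg (by linarith [hy.2] : 0 ≤ x + r - y)] at h2
    have h3 : s * (δ y - δ (x - r)) ≤ y - (x - r) := by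
      refine (le_abs_self _).trans ?_
      rw [abs_mul, hs1, one_mul, h1]
    have h4 : s * (δ (x + r) - δ y) ≤ x + r - y := by
      refine (le_abs_self _).trans ?_
      rw [abs_mul, hs1, one_mul, h2]
    have h5 : s * (δ y - δ (x - r)) = y - (x - r) := by linarith
    have h6 : s * (s * (δ y - δ (x - r))) = δ y - δ (x - r) := by
      rw [← mul_assoc, ← pow_two, hs, one_mul]
    rw [h5] at h6
    linarith
  have h7 : HasDerivAt (fun y => δ (x - r) + s * (y - (x - r))) s x := by
    have := (((hasDerivAt_id x).sub_const (x - r)).const_mul s).const_add (δ (x - r))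
    simpa using this
  refine h7.congr_of_eventuallyEq ?_
  filter_upwards [Ioo_mem_nhds (by linarith : x - r < x) (by linarith : x < x + r)] with y hy
  exact hlin y (Ioo_subset_Icc_self hy)

/-- An isometry to a star preserves integrals over the legs, by the change of variables formula on the
parts of the edges which are mapped into the leg. -/
theorem sum_setIntegral_legCoord [Fintype E]
    (hΦ : ∀ p q, (equilateralStar k L hk hL).edist (Φ p) (Φ q) = Γ.edist p q) (i : Fin k)
    {g : ℝ → ℝ} (hg : Continuous g) :
    ∑ e, ∫ x in {x ∈ Ioo 0 (Γ.len e) | 0 < legCoord hk hL i (Φ (Γ.ptR e x))},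
      g (legCoord hk hL i (Φ (Γ.ptR e x))) = ∫ y in (0 : ℝ)..(L / k), g y := by
  set δ : E → ℝ → ℝ := fun e x => legCoord hk hL i (Φ (Γ.ptR e x)) with hδ
  set O : E → Set ℝ := fun e => {x ∈ Ioo 0 (Γ.len e) | 0 < δ e x} with hO
  have hcont : ∀ e, Continuous (δ e) := fun e =>
    (LipschitzWith.of_dist_le_mul (K := 1) fun x y => by
      rw [NNReal.coe_one, one_mul]; exact abs_legCoord_sub_le hΦ e i x y).continuous
  have hOm : ∀ e, MeasurableSet (O e) := fun e =>
    (isOpen_Ioo.inter (isOpen_lt continuous_const (hcont e))).measurableSet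
  have heq : ∀ {e e' : E} {x x' : ℝ}, x ∈ O e → x' ∈ O e' → δ e x = δ e' x' →
      e = e' ∧ x = x' := by
    intro e e' x x' hx hx' h
    have h1 : Φ (Γ.ptR e x) = Φ (Γ.ptR e' x') := by
      rw [eq_ptR_of_legCoord_pos hx.2, eq_ptR_of_legCoord_pos hx'.2]
      exact congrArg _ h
    rcases ptR_eq_ptR (Ioo_subset_Icc_self hx.1) (Ioo_subset_Icc_self hx'.1) (Φ.injective h1) with
      h2 | ⟨h2 | h2, -⟩
    · exact h2
    · exact absurd h2 hx.1.1.ne'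
    · exact absurd h2 hx.1.2.ne
  have hinj : ∀ e, InjOn (δ e) (O e) := fun e x hx y hy h => (heq hx hy h).2
  have hder : ∀ e, ∀ x ∈ O e, |deriv (δ e) x| = 1 ∧ HasDerivAt (δ e) (deriv (δ e) x) x := by
    intro e x hx
    obtain ⟨s, hs, h⟩ := exists_hasDerivAt_legCoord hΦ hx.1 hx.2
    have := congrArg Real.sqrt hs
    rw [Real.sqrt_sq_eq_abs, Real.sqrt_one] at this
    rw [h.deriv]
    exact ⟨this, h⟩
  have h1 : ∀ e, ∫ x in O e, g (δ e x) = ∫ y in δ e '' O e, g y := by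
    intro e
    rw [integral_image_eq_integral_abs_deriv_smul (hOm e)
      (fun x hx => (hder e x hx).2.hasDerivWithinAt) (hinj e)]
    refine setIntegral_congr_fun (hOm e) fun x hx => ?_
    rw [(hder e x hx).1, one_smul]
  have hsub : ∀ e, δ e '' O e ⊆ Icc 0 (L / k) := by
    rintro e _ ⟨x, -, rfl⟩
    exact legCoord_mem i _
  have hint : IntegrableOn g (Icc 0 (L / k)) := hg.continuousOn.integrableOn_compact isCompact_Icc
  have h2 : ∑ e, ∫ y in δ e '' O e, g y = ∫ y in ⋃ e, δ e '' O e, g y := by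
    refine (integral_iUnion_fintype (fun e => (hOm e).image_of_continuousOn_injOn
      (hcont e).continuousOn (hinj e)) (fun e e' hne => ?_) fun e => hint.mono_set (hsub e)).symm
    rw [Function.onFun, Set.disjoint_left]
    rintro _ ⟨x, hx, rfl⟩ ⟨x', hx', h⟩
    exact hne (heq hx hx' h.symm).1
  -- the union of the images is the leg up to the images of the vertices
  have h3 : (⋃ e, δ e '' O e : Set ℝ) =ᵐ[volume] Ioc 0 (L / k) := by
    refine (LE.le.eventuallyLE ?_).antisymm ?_
    · refine iUnion_subset ?_
      rintro e _ ⟨x, hx, rfl⟩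
      exact ⟨hx.2, (legCoord_mem i _).2⟩
    · have hfin : ((range fun e => δ e 0) ∪ range fun e => δ e (Γ.len e)).Countable :=
        ((finite_range _).union (finite_range _)).countable
      filter_upwards [hfin.ae_notMem volume] with y hy hyl
      obtain ⟨e, x, hx, hxe⟩ := Γ.exists_eq_ptR
        (Φ.symm ((equilateralStar k L hk hL).ptR i y))
      have hδy : δ e x = y := by
        rw [hδ]
        dsimp only
        rw [← hxe, Equiv.apply_symm_apply, legCoord_ptR i i (Ioc_subset_Icc_self hyl), if_pos rfl]
      have hx0 : x ≠ 0 := by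
        rintro rfl
        exact hy (Or.inl ⟨e, hδy⟩)
      have hx1 : x ≠ Γ.len e := by
        rintro rfl
        exact hy (Or.inr ⟨e, hδy⟩)
      exact mem_iUnion.2 ⟨e, x, ⟨⟨lt_of_le_of_ne hx.1 hx0.symm, lt_of_le_of_ne hx.2 hx1⟩,
        hδy ▸ hyl.1⟩, hδy⟩
  rw [Finset.sum_congr rfl fun e _ => h1 e, h2, setIntegral_congr_set h3,
    intervalIntegral.integral_of_le (div_nonneg hL.le (Nat.cast_nonneg k))]

end MetricGraph

/-! ### Test functions on a star -/

namespace MetricGraph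

open scoped InnerProductSpace

variable {E : Type*} {Γ : MetricGraph E} {k : ℕ} {L : ℝ} {hk : 0 < k} {hL : 0 < L}
  {Φ : Γ.Point ≃ (equilateralStar k L hk hL).Point}

/-- The sine of the coordinate on the leg `i`, extended by zero to the other legs, together with its
derivative. -/
noncomputable def legSine (Φ : Γ.Point ≃ (equilateralStar k L hk hL).Point) (om : ℝ) (i : Fin k) :
    (Γ.Point → ℝ) × (E → ℝ → ℝ) :=
  (fun p => Real.sin (om * legCoord hk hL i (Φ p)),
    fun e => deriv fun x => Real.sin (om * legCoord hk hL i (Φ (Γ.ptR e x))))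

theorem lipschitzWith_legSine
    (hΦ : ∀ p q, (equilateralStar k L hk hL).edist (Φ p) (Φ q) = Γ.edist p q) {om : ℝ}
    (hom : 0 ≤ om) (e : E) (i : Fin k) :
    LipschitzWith om.toNNReal fun x => (legSine Φ om i).1 (Γ.ptR e x) := by
  refine LipschitzWith.of_dist_le_mul fun x y => ?_
  rw [Real.coe_toNNReal _ hom, Real.dist_eq, Real.dist_eq]
  refine (Real.abs_sin_sub_sin_le _ _).trans ?_
  rw [← mul_sub, abs_mul, abs_of_nonneg hom]
  exact mul_le_mul_of_nonneg_left (abs_legCoord_sub_le hΦ e i x y) hom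

/-- The function is Lipschitz on the edges, hence absolutely continuous. -/
theorem legSine_mem_H1
    (hΦ : ∀ p q, (equilateralStar k L hk hL).edist (Φ p) (Φ q) = Γ.edist p q) {om : ℝ}
    (hom : 0 ≤ om) (i : Fin k) : legSine Φ om i ∈ Γ.H1 := by
  have hon : ∀ e, IsH1On (Γ.onEdge (legSine Φ om i).1 e) ((legSine Φ om i).2 e) 0 (Γ.len e) := by
    intro e
    have hlip := lipschitzWith_legSine hΦ hom e i
    refine ⟨?_, fun s hs => ?_⟩
    · exact MemLp.of_bound (stronglyMeasurable_deriv _).aestronglyMeasurable (om.toNNReal : ℝ)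
        (Filter.Eventually.of_forall fun x => norm_deriv_le_of_lipschitz hlip)
    · have h1 := (hlip.lipschitzOnWith (s := uIcc 0 s)).absolutelyContinuousOnInterval.integral_deriv_eq_sub
      have h2 : ∫ t in (0 : ℝ)..s, (legSine Φ om i).2 e t =
        Γ.onEdge (legSine Φ om i).1 e s - Γ.onEdge (legSine Φ om i).1 e 0 := h1
      rw [h2]
      ring
  exact Γ.memH1_iff.2 ⟨Γ.continuous_of_onEdge fun e => (hon e).continuousOn (Γ.len_pos e).le, hon⟩

/-- Outside its leg the function and its derivative vanish; the derivative vanishes also at the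
points where the leg is reached, which are minima. -/
theorem legSine_eq_zero {om : ℝ} (hom0 : 0 ≤ om) (hom : om * (L / k) ≤ Real.pi) {e : E} {i : Fin k}
    {x : ℝ} (h : legCoord hk hL i (Φ (Γ.ptR e x)) = 0) :
    (legSine Φ om i).1 (Γ.ptR e x) = 0 ∧ (legSine Φ om i).2 e x = 0 := by
  have h1 : (legSine Φ om i).1 (Γ.ptR e x) = 0 := by
    change Real.sin (om * legCoord hk hL i (Φ (Γ.ptR e x))) = 0
    rw [h, mul_zero, Real.sin_zero]
  refine ⟨h1, IsLocalMin.deriv_eq_zero (Filter.Eventually.of_forall fun y => ?_)⟩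
  refine h1.le.trans ?_
  have h2 := legCoord_mem i (Φ (Γ.ptR e y))
  exact Real.sin_nonneg_of_nonneg_of_le_pi (mul_nonneg hom0 h2.1)
    ((mul_le_mul_of_nonneg_left h2.2 hom0).trans hom)

theorem density_legSine_of_ne {om : ℝ} (hom0 : 0 ≤ om) (hom : om * (L / k) ≤ Real.pi) (lam : ℝ)
    {e : E} {i j : Fin k} (hij : i ≠ j) (x : ℝ) :
    density lam (legSine Φ om i) (legSine Φ om j) e x = 0 := by
  rcases (legCoord_mem i (Φ (Γ.ptR e x))).1.eq_or_lt with h | h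
  · obtain ⟨h1, h2⟩ := legSine_eq_zero hom0 hom h.symm
    simp [density, h1, h2]
  · obtain ⟨h1, h2⟩ := legSine_eq_zero hom0 hom (legCoord_eq_zero_of_pos hij h)
    simp [density, h1, h2]

theorem density_legSine_self
    (hΦ : ∀ p q, (equilateralStar k L hk hL).edist (Φ p) (Φ q) = Γ.edist p q) {om : ℝ} {e : E}
    {i : Fin k} {x : ℝ} (hx : x ∈ Ioo 0 (Γ.len e)) (h : 0 < legCoord hk hL i (Φ (Γ.ptR e x))) :
    density (om ^ 2) (legSine Φ om i) (legSine Φ om i) e x =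
      om ^ 2 * (Real.cos (om * legCoord hk hL i (Φ (Γ.ptR e x))) ^ 2 -
        Real.sin (om * legCoord hk hL i (Φ (Γ.ptR e x))) ^ 2) := by
  obtain ⟨s, hs, hd⟩ := exists_hasDerivAt_legCoord hΦ hx h
  have h1 := (hd.const_mul om).sin.deriv
  have h2 : (legSine Φ om i).2 e x =
      Real.cos (om * legCoord hk hL i (Φ (Γ.ptR e x))) * (om * s) := h1
  rw [density, h2]
  change _ * _ - om ^ 2 * (Real.sin (om * legCoord hk hL i (Φ (Γ.ptR e x))) *
    Real.sin (om * legCoord hk hL i (Φ (Γ.ptR e x)))) = _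
  linear_combination om ^ 2 * Real.cos (om * legCoord hk hL i (Φ (Γ.ptR e x))) ^ 2 * hs

variable [Fintype E]

/-- Integrals over the graph of functions which vanish outside one leg are integrals over that leg. -/
theorem sum_integral_eq_of_leg
    (hΦ : ∀ p q, (equilateralStar k L hk hL).edist (Φ p) (Φ q) = Γ.edist p q) (i : Fin k)
    {g : ℝ → ℝ} (hg : Continuous g) {F : E → ℝ → ℝ}
    (h0 : ∀ e, ∀ x ∈ Ioo 0 (Γ.len e), legCoord hk hL i (Φ (Γ.ptR e x)) = 0 → F e x = 0)
    (h1 : ∀ e, ∀ x ∈ Ioo 0 (Γ.len e), 0 < legCoord hk hL i (Φ (Γ.ptR e x)) →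
      F e x = g (legCoord hk hL i (Φ (Γ.ptR e x)))) :
    ∑ e, ∫ x, F e x ∂(Γ.edgeMeasure e) = ∫ y in (0 : ℝ)..(L / k), g y := by
  rw [← sum_setIntegral_legCoord hΦ i hg]
  refine Finset.sum_congr rfl fun e _ => ?_
  have hcont : Continuous fun x => legCoord hk hL i (Φ (Γ.ptR e x)) :=
    (LipschitzWith.of_dist_le_mul (K := 1) fun x y => by
      rw [NNReal.coe_one, one_mul]; exact abs_legCoord_sub_le hΦ e i x y).continuous
  have hm : MeasurableSet {x ∈ Ioo 0 (Γ.len e) | 0 < legCoord hk hL i (Φ (Γ.ptR e x))} :=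
    (isOpen_Ioo.inter (isOpen_lt continuous_const hcont)).measurableSet
  refine (setIntegral_eq_of_subset_of_forall_sdiff_eq_zero measurableSet_Ioo
    (s := {x ∈ Ioo 0 (Γ.len e) | 0 < legCoord hk hL i (Φ (Γ.ptR e x))}) (fun x hx => hx.1)
    fun x hx => ?_).trans (setIntegral_congr_fun hm fun x hx => h1 e x hx.1 hx.2)
  refine h0 e x hx.1 (le_antisymm ?_ (legCoord_mem i _).1)
  by_contra! hpos
  exact hx.2 ⟨hx.1, hpos⟩

/-- A graph which is isometric to the equilateral star carries a `k`-dimensional space of functions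
whose Rayleigh quotients are at most `(π / (2 ℓ))²`, where `ℓ` is the length of the legs: the functions
`m + ∑ i, c i sin (π y_i / (2 ℓ))` with `∑ i, c i = 0`, where `y_i` is the coordinate on the leg `i`.
They are parametrised by their values `d i = m + c i` at the tips of the legs. -/
theorem exists_submodule_of_isIsometric [Nonempty E]
    (h : Γ.IsIsometric (equilateralStar k L hk hL)) :
    ∃ V : Submodule ℝ ((Γ.Point → ℝ) × (E → ℝ → ℝ)), FiniteDimensional ℝ V ∧ V ≤ Γ.H1 ∧
      (∀ w ∈ V, Γ.form ((Real.pi / (2 * (L / k))) ^ 2) w w ≤ 0) ∧ (∀ w ∈ V, w.1 = 0 → w = 0) ∧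
      Module.finrank ℝ V = k := by
  obtain ⟨Φ, hΦ⟩ := h
  have hpi := Real.pi_pos
  have hk0 : (0 : ℝ) < k := by exact_mod_cast hk
  have hℓ : 0 < L / k := by positivity
  set om := Real.pi / (2 * (L / k)) with hom
  have hom0 : 0 < om := by positivity
  have homl : om * (L / k) = Real.pi / 2 := by rw [hom]; field_simp
  have homl' : om * (L / k) ≤ Real.pi := by rw [homl]; linarith
  obtain ⟨-, one, hone1, hone⟩ := isEigenfunction_iff.1 (isEigenfunction_one Γ)
  let u : Fin k → Γ.H1 := fun i => ⟨legSine Φ om i, legSine_mem_H1 hΦ hom0.le i⟩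
  -- the form vanishes on the sines
  have huu : ∀ i j, ⟪Γ.derivToL2 (u i), Γ.derivToL2 (u j)⟫_ℝ =
      om ^ 2 * ⟪Γ.toL2 (u i), Γ.toL2 (u j)⟫_ℝ := by
    intro i j
    rw [← sub_eq_zero, ← form_eq_inner, form]
    by_cases hij : i = j
    · subst hij
      have h1 := sum_integral_eq_of_leg hΦ i
        (g := fun y => om ^ 2 * (Real.cos (om * y) ^ 2 - Real.sin (om * y) ^ 2)) (by fun_prop)
        (F := fun e => density (om ^ 2) (legSine Φ om i) (legSine Φ om i) e)
        (fun e x _ h0 => by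
          obtain ⟨h1, h2⟩ := legSine_eq_zero hom0.le homl' h0
          simp [density, h1, h2])
        fun e x hx h0 => density_legSine_self hΦ hx h0
      have h2 : ∫ y in (0 : ℝ)..(L / k), om ^ 2 * (Real.cos (om * y) ^ 2 - Real.sin (om * y) ^ 2) =
          0 := by
        rw [intervalIntegral.integral_eq_sub_of_hasDerivAt
          (f := fun y => om * (Real.sin (om * y) * Real.cos (om * y))) (fun y _ => ?_)
          (Continuous.intervalIntegrable (by fun_prop) _ _)]
        · simp [homl]
        · have h3 : HasDerivAt (fun y => om * y) om y := by
            simpa using (hasDerivAt_id y).const_mul om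
          exact ((h3.sin.mul h3.cos).const_mul om).congr_deriv (by ring)
      exact (Finset.sum_congr rfl fun e _ => (Γ.integral_edgeMeasure _ e).symm).trans (h1.trans h2)
    · refine Finset.sum_eq_zero fun e _ => ?_
      have : density (om ^ 2) (u i).1 (u j).1 e = fun _ => 0 :=
        funext fun x => density_legSine_of_ne (Φ := Φ) hom0.le homl' _ hij x
      rw [this, intervalIntegral.integral_zero]
  have hone_u : ∀ i, ⟪Γ.toL2 one, Γ.toL2 (u i)⟫_ℝ = ∫ y in (0 : ℝ)..(L / k), Real.sin (om * y) := by
    intro i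
    rw [inner_toL2]
    refine sum_integral_eq_of_leg hΦ i (g := fun y => Real.sin (om * y)) (by fun_prop)
      (fun e x _ h0 => ?_) fun e x _ _ => ?_
    · have := (legSine_eq_zero hom0.le homl' h0).1
      exact mul_eq_zero_of_right _ this
    · rw [hone1]
      exact one_mul _
  have hD1 : Γ.derivToL2 one = 0 := by
    have := hone one
    rwa [zero_mul, inner_self_eq_zero] at this
  let m : (Fin k → ℝ) →ₗ[ℝ] ℝ := (1 / (k : ℝ)) • ∑ j, LinearMap.proj j
  have hm : ∀ d, ∑ i, (d i - m d) = 0 := by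
    intro d
    simp only [m, Finset.sum_sub_distrib, Finset.sum_const, Finset.card_univ, Fintype.card_fin,
      LinearMap.smul_apply, LinearMap.sum_apply, LinearMap.proj_apply, smul_eq_mul, nsmul_eq_mul]
    field_simp
    ring
  let ψ : (Fin k → ℝ) →ₗ[ℝ] Γ.H1 :=
    m.smulRight one + ∑ i, (LinearMap.proj i - m).smulRight (u i)
  have hψ : ∀ d, ψ d = m d • one + ∑ i, (d i - m d) • u i := by
    intro d
    simp [ψ]
  have hform : ∀ d, Γ.form (om ^ 2) (ψ d) (ψ d) ≤ 0 := by
    intro d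
    set z := ∑ i, (d i - m d) • u i with hz
    have hzz : ⟪Γ.derivToL2 z, Γ.derivToL2 z⟫_ℝ = om ^ 2 * ⟪Γ.toL2 z, Γ.toL2 z⟫_ℝ := by
      rw [hz]
      simp only [map_sum, map_smul, sum_inner, inner_sum, inner_smul_left, inner_smul_right, huu,
        Finset.mul_sum, conj_trivial]
      exact Finset.sum_congr rfl fun i _ => Finset.sum_congr rfl fun j _ => by ring
    have h1z : ⟪Γ.toL2 one, Γ.toL2 z⟫_ℝ = 0 := by
      rw [hz]
      simp only [map_sum, map_smul, inner_sum, inner_smul_right, hone_u]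
      rw [← Finset.sum_mul, hm, zero_mul]
    have hz1 : ⟪Γ.toL2 z, Γ.toL2 one⟫_ℝ = 0 := by rw [real_inner_comm, h1z]
    rw [form_eq_inner, hψ, ← hz]
    simp only [map_add, map_smul, hD1, smul_zero, zero_add, inner_add_left, inner_add_right,
      inner_smul_left, inner_smul_right, h1z, hz1, hzz, conj_trivial]
    have h3 : 0 ≤ ⟪Γ.toL2 one, Γ.toL2 one⟫_ℝ := real_inner_self_nonneg
    have h4 : 0 ≤ om ^ 2 * (m d ^ 2 * ⟪Γ.toL2 one, Γ.toL2 one⟫_ℝ) := by positivity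
    linarith
  have hinj : ∀ d, (ψ d).1.1 = 0 → d = 0 := by
    intro d hd
    funext i
    have h1 := congrFun hd (Φ.symm ((equilateralStar k L hk hL).ptR i (L / k)))
    have hu : ∀ j, (u j).1.1 (Φ.symm ((equilateralStar k L hk hL).ptR i (L / k))) =
        if i = j then 1 else 0 := by
      intro j
      change Real.sin (om * legCoord hk hL j (Φ (Φ.symm _))) = _
      rw [Equiv.apply_symm_apply, legCoord_ptR j i ⟨hℓ.le, le_rfl⟩]
      split_ifs
      · rw [homl, Real.sin_pi_div_two]
      · simp
    rw [hψ] at h1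
    simpa [Prod.fst_sum, hone1, hu] using h1
  refine ⟨LinearMap.range (Γ.H1.subtype ∘ₗ ψ), inferInstance, ?_, ?_, ?_, ?_⟩
  · rintro _ ⟨d, rfl⟩
    exact (ψ d).2
  · rintro _ ⟨d, rfl⟩
    exact hform d
  · rintro _ ⟨d, rfl⟩ h0
    rw [hinj d h0, map_zero]
  · rw [LinearMap.finrank_range_of_inj, Module.finrank_fin_fun]
    rw [← LinearMap.ker_eq_bot, LinearMap.ker_eq_bot']
    intro d hd
    exact hinj d (congrArg Prod.fst hd)

end MetricGraph

theorem mainTheorem3 {E : Type*} [Fintype E] (Γ : MetricGraph E) (hconn : Γ.IsConnected)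
    (L : ℝ) (hL : 0 < L) (hlen : Γ.totalLength = L) :
    Γ.eigenvalue 1 = 0 ∧
    ∀ (k : ℕ) (hk : 2 ≤ k),
      Real.pi ^ 2 * (k : ℝ) ^ 2 / (4 * L ^ 2) ≤ Γ.eigenvalue k ∧
      (Γ.eigenvalue k = Real.pi ^ 2 * (k : ℝ) ^ 2 / (4 * L ^ 2) ↔
        Γ.IsIsometric (MetricGraph.equilateralStar k L (by omega) hL)) := by
  have : Nonempty E := by
    by_contra hE
    rw [not_nonempty_iff] at hE
    rw [MetricGraph.totalLength, Finset.univ_eq_empty, Finset.sum_empty] at hlen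
    exact hL.ne hlen
  refine ⟨MetricGraph.eigenvalue_one Γ, fun k hk => ?_⟩
  have hk0 : 0 < k := by omega
  have hval : Real.pi ^ 2 * (k : ℝ) ^ 2 / (4 * L ^ 2) = (Real.pi / (2 * (L / k))) ^ 2 := by
    have : (k : ℝ) ≠ 0 := by exact_mod_cast hk0.ne'
    field_simp
    norm_num
  have hmem := MetricGraph.eigenvalue_mem_spectralBounds hconn hk0
  have hle : (Real.pi / (2 * (L / k))) ^ 2 ≤ Γ.eigenvalue k :=
    hlen ▸ MetricGraph.le_of_mem_spectralBounds hconn hk hmem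
  rw [hval]
  refine ⟨hle, fun h => ?_, fun h => le_antisymm ?_ hle⟩
  · exact MetricGraph.isIsometric_of_mem_spectralBounds hconn hL hlen hk (h ▸ hmem)
  · obtain ⟨V, hfin, hV, hneg, hinj, hdim⟩ := MetricGraph.exists_submodule_of_isIsometric h
    refine le_of_forall_gt_imp_ge_of_dense fun t ht => ?_
    exact csInf_le (MetricGraph.bddBelow_spectralBounds hk0)
      (MetricGraph.exists_eigenfunctions hconn (sq_nonneg _) ht hV hneg hinj hdim.ge)
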